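/- A hyperbolic surface with convex boundary is a surface $X$, with a metric, each of whose points has a neighbourhood isometric to a neighbourhood of a point in a closed convex subset, with nonempty interior, of the hyperbolic plane $\mathbb H^2$; its boundary $\partial X$ consists of the points that have no neighbourhood isometric to an open disc of $\mathbb H^2$. A geodesic path is a unit speed geodesic $s:[a,b]\to X$, $a<b$; it is called simple if $s|_{(a,b)}$ is injective. Let $X$ be a compact connected hyperbolic surface with convex boundary that is not simply connected. (1) If $X$ is homeomorphic to $S^1\times[0,1]$, then every geodesic path in $X$ joining different components of $\partial X$ is simple. (2) Let $s:[a,b]\to X$ be a geodesic path joining different components of $\partial X$, and let $t:[c,d]\to X$, $c<d$, be a path that is either a simple geodesic path or an arbitrary continuous path injective on $[c,d]$. Suppose that $s$ and $t$ are homotopic through paths with endpoints in $\partial X$: there is a continuous $H:[0,1]\times[0,1]\to X$ with $H(\tau,0)=s(a+\tau(b-a))$, $H(\tau,1)=t(c+\tau(d-c))$ and $H(\{0,1\}\times[0,1])\subset\partial X$. Then $s$ is simple. (3) Let $p\in\partial X$, let $s:[a,b]\to X$ be a geodesic path with $s(a)=s(b)=p$, and let $t:[c,d]\to X$, $c<d$,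 be a continuous loop with $t(c)=t(d)=p$ that is simple, i.e. injective on $[c,d)$. If $s$ and $t$ are homotopic relative to $p$, that is, through loops based at $p$, then $s$ is a simple loop, i.e. injective on $[a,b)$. -/

import Mathlib

open Set

namespace ConvexHyperbolic

/-- Geodesic convexity of a set in the hyperbolic plane (the upper half-plane with its metric of
curvature `-1`): `C` contains the geodesic segment `{r | d(p,r) + d(r,q) = d(p,q)}` between any
two of its points. -/
def GeodesicallyConvex (C : Set UpperHalfPlane) : Prop :=
  ∀ p ∈ C, ∀ q ∈ C, ∀ r, dist p r + dist r q = dist p q → r ∈ C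

section

variable {X : Type*} [MetricSpace X]

/-- `φ` maps the open ball of radius `ε` about `x` isometrically onto the part of `C` in the open
hyperbolic disc of radius `ε` about `φ x`. -/
def IsIsometricChart (C : Set UpperHalfPlane) (x : X) (ε : ℝ) (φ : X → UpperHalfPlane) : Prop :=
  (∀ y ∈ Metric.ball x ε, ∀ z ∈ Metric.ball x ε, dist (φ y) (φ z) = dist y z) ∧
    φ '' Metric.ball x ε = C ∩ Metric.ball (φ x) ε

variable (X) in
/-- Hyperbolic surface with (locally) convex, possibly empty, boundary: near each of its points
the metric space `X` is isometric to a closed convex subset of the hyperbolic plane with nonempty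
interior. The boundary curves may have corners. -/
def IsConvexHyperbolicSurface : Prop :=
  ∀ x : X, ∃ C : Set UpperHalfPlane, IsClosed C ∧ GeodesicallyConvex C ∧ (interior C).Nonempty ∧
    ∃ ε > 0, ∃ φ : X → UpperHalfPlane, IsIsometricChart C x ε φ

variable (X) in
/-- The boundary `∂X`: the points without a neighbourhood isometric to an open disc of the
hyperbolic plane. -/
def surfaceBoundary : Set X :=
  {x | ¬ ∃ ε > 0, ∃ φ : X → UpperHalfPlane, IsIsometricChart univ x ε φ}

/-- `s` restricted to `[a, b]`, `a < b`, is a unit speed geodesic: locally distance preserving. -/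
def IsGeodesicPath (s : ℝ → X) (a b : ℝ) : Prop :=
  a < b ∧ ∀ τ ∈ Icc a b, ∃ δ > 0, ∀ u ∈ Icc a b, ∀ v ∈ Icc a b,
    |u - τ| < δ → |v - τ| < δ → dist (s u) (s v) = |u - v|

/-- A geodesic path on `[a, b]` is simple if it is injective on the open interval `(a, b)`. -/
def IsSimple (s : ℝ → X) (a b : ℝ) : Prop :=
  InjOn s (Ioo a b)

/-- A simple loop at `p` on `[a, b]`: starts and ends at `p`, and takes no value twice otherwise. -/
def IsSimpleLoop (s : ℝ → X) (a b : ℝ) (p : X) : Prop :=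
  s a = p ∧ s b = p ∧ InjOn s (Ico a b)

/-- The path `s` on `[a, b]` joins two different components of `∂X`. -/
def JoinsDifferentBoundaryComponents (s : ℝ → X) (a b : ℝ) : Prop :=
  s a ∈ surfaceBoundary X ∧ s b ∈ surfaceBoundary X ∧
    connectedComponentIn (surfaceBoundary X) (s a) ≠
      connectedComponentIn (surfaceBoundary X) (s b)

/-- The paths `s` on `[a, b]` and `t` on `[c, d]`, with endpoints in `∂X`, are homotopic through
paths with endpoints in `∂X`. -/
def PathsHomotopic (s : ℝ → X) (a b : ℝ) (t : ℝ → X) (c d : ℝ) : Prop :=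
  ∃ H : unitInterval × unitInterval → X, Continuous H ∧
    (∀ τ : unitInterval, H (τ, 0) = s (a + τ * (b - a))) ∧
    (∀ τ : unitInterval, H (τ, 1) = t (c + τ * (d - c))) ∧
    ∀ u : unitInterval, H (0, u) ∈ surfaceBoundary X ∧ H (1, u) ∈ surfaceBoundary X

/-- The loops `s` on `[a, b]` and `t` on `[c, d]` at `p` are homotopic through loops at `p`. -/
def LoopsHomotopicRel (p : X) (s : ℝ → X) (a b : ℝ) (t : ℝ → X) (c d : ℝ) : Prop :=
  ∃ H : unitInterval × unitInterval → X, Continuous H ∧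
    (∀ τ : unitInterval, H (τ, 0) = s (a + τ * (b - a))) ∧
    (∀ τ : unitInterval, H (τ, 1) = t (c + τ * (d - c))) ∧
    ∀ u : unitInterval, H (0, u) = p ∧ H (1, u) = p

end

end ConvexHyperbolic

/-! The surface is developed into the hyperbolic plane, which turns the theorem into planar convex
geometry. `exists_developed_cover` produces a convex set `K` in `ℍ` and a locally isometric covering
map `π` from `K` to `X`. Its points are germs of charts continued along chains of nearby points.
Among the chains with given ends, number of steps and holonomy, compactness gives one of least
energy; it is equally spaced and its development is straight. Hence a continuation is determined by
its position in `ℍ`, and the positions form a convex set. Geodesic paths of `X` lift to pieces of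
geodesic lines, and a point of `K` lies over `∂X` exactly when it is not interior to `K`
(`mem_surfaceBoundary_iff`). In the chart `klein` geodesics are straight, so `K` becomes a planar
convex set.

A double point of `s` gives two lifts `F`, `G` of the homotopy that agree nowhere, although the
chords they trace at time `0` meet. In (2) the ends of both chords slide along the boundary of `K`,
never coincide, and the chords run through the interior because they join different boundary
components. A meeting is therefore a transversal crossing, and it persists until time `1`
(`segments_meet_of_continuous`). There the two lifts of `t` have crossing end chords, so they meet
(`paths_meet_of_crossing`, by counting the turning of `f x - g y` around a square). Injectivity of
`t` makes the parameters equal, and then `F` and `G` agree somewhere, a contradiction.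

In (3) the ends of the lifts do not move. If `s` leaves `∂X`, the same crossing argument applies.
Otherwise both lifts of `s` lie on one support line of `K`, their ends interlace there, and
`paths_meet_of_interlacing` replaces the crossing lemma.

In (1) the ends of `s` lie on the two different boundary circles. In the strip covering the annulus
the lift of `s` deforms linearly to a straight segment, whose height is monotone and whose image is
therefore an injective arc, and (2) applies. This needs the metric boundary to be the topological
one, which is invariance of the boundary for planar convex sets
(`mem_interior_of_local_homeomorph`). -/

namespace ConvexHyperbolic

open UpperHalfPlane

/-! ### The hyperboloid model -/

/-- The point of the hyperboloid `v₀ v₂ - v₁² = 1` representing a point of the upper half-plane. -/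
noncomputable def hvec (z : ℍ) : Fin 3 → ℝ :=
  ![(z.re ^ 2 + z.im ^ 2) / z.im, z.re / z.im, 1 / z.im]

/-- The Lorentzian form on `ℝ³`. -/
noncomputable def lform (v w : Fin 3 → ℝ) : ℝ := (v 0 * w 2 + v 2 * w 0) / 2 - v 1 * w 1

theorem lform_comm (v w : Fin 3 → ℝ) : lform v w = lform w v := by
  simp only [lform]; ring

theorem lform_comb (a b : ℝ) (u v w : Fin 3 → ℝ) :
    lform (a • u + b • v) w = a * lform u w + b * lform v w := by
  simp only [lform, Pi.add_apply, Pi.smul_apply, smul_eq_mul]; ring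

theorem lform_comb_right (a b : ℝ) (u v w : Fin 3 → ℝ) :
    lform w (a • u + b • v) = a * lform w u + b * lform w v := by
  rw [lform_comm, lform_comb, lform_comm u, lform_comm v]

/-- Bridge to linear algebra: every later computation with hyperbolic distances is an identity for
the Lorentzian form. -/
theorem cosh_dist_eq_lform (z w : ℍ) : Real.cosh (dist z w) = lform (hvec z) (hvec w) := by
  have hz := z.im_ne_zero
  have hw := w.im_ne_zero
  rw [cosh_dist']
  simp only [lform, hvec, Matrix.cons_val_zero, Matrix.cons_val_one, Matrix.cons_val]
  field_simp
  ring

theorem lform_hvec_self (z : ℍ) : lform (hvec z) (hvec z) = 1 := by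
  rw [← cosh_dist_eq_lform, dist_self, Real.cosh_zero]

theorem hvec_two_pos (z : ℍ) : 0 < hvec z 2 := by
  have := z.im_pos
  simp only [hvec, Matrix.cons_val]
  positivity

theorem hvec_injective : Function.Injective hvec := by
  intro z w h
  have : Real.cosh (dist z w) = 1 := by
    rw [cosh_dist_eq_lform, h, lform_hvec_self]
  by_contra hne
  exact (Real.one_lt_cosh.2 (dist_ne_zero.2 hne)).ne' this

theorem exists_hvec_eq {v : Fin 3 → ℝ} (hv : lform v v = 1) (h2 : 0 < v 2) :
    ∃ z : ℍ, hvec z = v := by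
  refine ⟨⟨⟨v 1 / v 2, 1 / v 2⟩, by simpa using h2⟩, ?_⟩
  have h2' := h2.ne'
  simp only [lform] at hv
  ext i
  fin_cases i <;> simp only [hvec, UpperHalfPlane.re, UpperHalfPlane.im] <;> simp
  · field_simp
    nlinarith
  · field_simp

/-- The quadric `lform v v = 1` has two sheets; pairing positively with one point of the upper sheet
excludes the lower one. -/
theorem exists_hvec_eq_of_lform_pos {v : Fin 3 → ℝ} (hv : lform v v = 1) {z : ℍ}
    (hz : 0 < lform v (hvec z)) : ∃ z : ℍ, hvec z = v := by
  refine exists_hvec_eq hv ?_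
  by_contra h2
  have h2' : v 2 ≠ 0 := by
    intro h
    simp only [lform, h] at hv
    nlinarith [sq_nonneg (v 1)]
  have hneg : 0 < (-v) 2 := by
    simp only [Pi.neg_apply]
    exact neg_pos.2 (lt_of_le_of_ne (not_lt.1 h2) h2')
  obtain ⟨w, hw⟩ := exists_hvec_eq (v := -v) (by simp only [lform, Pi.neg_apply] at hv ⊢; linarith)
    hneg
  have h1 := Real.one_le_cosh (dist w z)
  rw [cosh_dist_eq_lform, hw] at h1
  simp only [lform, Pi.neg_apply] at h1 hz
  linarith

theorem dist_eq_abs_of_lform {z w : ℍ} {t : ℝ} (h : lform (hvec z) (hvec w) = Real.cosh t) :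
    dist z w = |t| := by
  rw [← cosh_dist_eq_lform] at h
  have := le_antisymm (Real.cosh_le_cosh.1 h.le) (Real.cosh_le_cosh.1 h.ge)
  rwa [abs_of_nonneg dist_nonneg] at this

theorem sinh_dist_pos {p q : ℍ} (hpq : p ≠ q) : 0 < Real.sinh (dist p q) :=
  Real.sinh_pos_iff.2 (dist_pos.2 hpq)

/-! ### Geodesic lines -/

/-- Explicit parametrization of the geodesic line through two points. -/
theorem exists_line_hvec {p q : ℍ} (hpq : p ≠ q) : ∃ γ : ℝ → ℍ, ∀ t,
    hvec (γ t) = (Real.sinh (dist p q - t) / Real.sinh (dist p q)) • hvec p +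
      (Real.sinh t / Real.sinh (dist p q)) • hvec q := by
  have hs := (sinh_dist_pos hpq).ne'
  have hc := cosh_dist_eq_lform p q
  set d := dist p q
  suffices ∀ t, ∃ z : ℍ, hvec z = (Real.sinh (d - t) / Real.sinh d) • hvec p +
      (Real.sinh t / Real.sinh d) • hvec q by
    choose γ hγ using this
    exact ⟨γ, hγ⟩
  intro t
  have hd := Real.cosh_sq d
  have ht := Real.cosh_sq t
  refine exists_hvec_eq_of_lform_pos (z := p) ?_ ?_
  · rw [lform_comb, lform_comb_right, lform_comb_right, lform_hvec_self, lform_hvec_self,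
      lform_comm (hvec q), ← hc, Real.sinh_sub]
    field_simp
    linear_combination (Real.sinh t) ^ 2 * (-1) * hd + (Real.sinh d) ^ 2 * ht
  · rw [lform_comb, lform_hvec_self, lform_comm (hvec q), ← hc, Real.sinh_sub]
    have : (Real.sinh d * Real.cosh t - Real.cosh d * Real.sinh t) / Real.sinh d * 1 +
      Real.sinh t / Real.sinh d * Real.cosh d = Real.cosh t := by
      field_simp
      ring
    rw [this]
    exact Real.cosh_pos t

theorem isometry_of_line_hvec {p q : ℍ} (hpq : p ≠ q) {γ : ℝ → ℍ} (hγ : ∀ t,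
    hvec (γ t) = (Real.sinh (dist p q - t) / Real.sinh (dist p q)) • hvec p +
      (Real.sinh t / Real.sinh (dist p q)) • hvec q) :
    Isometry γ ∧ γ 0 = p ∧ γ (dist p q) = q := by
  have hs := (sinh_dist_pos hpq).ne'
  have hc := cosh_dist_eq_lform p q
  refine ⟨Isometry.of_dist_eq fun s t => ?_, ?_, ?_⟩
  · refine (dist_eq_abs_of_lform (t := s - t) ?_).trans (Real.dist_eq s t).symm
    rw [hγ, hγ, lform_comb, lform_comb_right, lform_comb_right, lform_hvec_self, lform_hvec_self,
      lform_comm (hvec q), ← hc, Real.sinh_sub, Real.sinh_sub, Real.cosh_sub]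
    have hd := Real.cosh_sq (dist p q)
    field_simp
    linear_combination (-1 : ℝ) * Real.sinh s * Real.sinh t * hd
  · apply hvec_injective
    rw [hγ]
    simp [hs]
  · apply hvec_injective
    rw [hγ]
    simp [hs]

theorem eq_line_of_dist {p q : ℍ} (hpq : p ≠ q) {γ : ℝ → ℍ} (hγ : ∀ t,
    hvec (γ t) = (Real.sinh (dist p q - t) / Real.sinh (dist p q)) • hvec p +
      (Real.sinh t / Real.sinh (dist p q)) • hvec q) {r : ℍ} {u : ℝ}
    (hp : dist p r = |u|) (hq : dist q r = |u - dist p q|) : r = γ u := by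
  have hs := (sinh_dist_pos hpq).ne'
  have h1 := cosh_dist_eq_lform p r
  have h2 := cosh_dist_eq_lform q r
  rw [hp, Real.cosh_abs] at h1
  rw [hq, Real.cosh_abs, Real.cosh_sub] at h2
  have hu := Real.cosh_sq u
  have : lform (hvec r) (hvec (γ u)) = Real.cosh 0 := by
    rw [lform_comm, hγ, lform_comb, ← h1, ← h2, Real.sinh_sub, Real.cosh_zero]
    field_simp
    linear_combination hu * Real.sinh (dist p q)
  simpa using dist_eq_abs_of_lform this

theorem exists_isometry_line {p q : ℍ} (hpq : p ≠ q) :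
    ∃ γ : ℝ → ℍ, Isometry γ ∧ γ 0 = p ∧ γ (dist p q) = q := by
  obtain ⟨γ, hγ⟩ := exists_line_hvec hpq
  exact ⟨γ, isometry_of_line_hvec hpq hγ⟩

/-- A point of a geodesic line is determined by its distances to two points of the line. -/
theorem eq_of_isometry_line {γ : ℝ → ℍ} (hγ : Isometry γ) {s t u : ℝ} (hst : s ≠ t) {r : ℍ}
    (hs : dist (γ s) r = |u - s|) (ht : dist (γ t) r = |u - t|) : r = γ u := by
  wlog hlt : s < t generalizing s t
  · exact this hst.symm ht hs (lt_of_le_of_ne (not_lt.1 hlt) hst.symm)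
  have hne : γ s ≠ γ t := fun h => hst (hγ.injective h)
  obtain ⟨δ, hδ⟩ := exists_line_hvec hne
  have hd : dist (γ s) (γ t) = t - s := by
    rw [hγ.dist_eq, Real.dist_eq, abs_sub_comm, abs_of_pos (sub_pos.2 hlt)]
  have key : ∀ r', dist (γ s) r' = |u - s| → dist (γ t) r' = |u - t| → r' = δ (u - s) := by
    intro r' h1 h2
    refine eq_line_of_dist hne hδ h1 ?_
    rw [hd, h2]
    congr 1
    ring
  rw [key r hs ht, key (γ u)]
  · rw [hγ.dist_eq, Real.dist_eq, abs_sub_comm]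
  · rw [hγ.dist_eq, Real.dist_eq, abs_sub_comm]

/-! ### The projective model -/

/-- The chart `x + i y ↦ x + i (x² + y²)`, in which geodesics are straight segments. -/
noncomputable def klein (z : ℍ) : ℂ := ⟨z.re, z.re ^ 2 + z.im ^ 2⟩

/-- `klein` is central projection of the hyperboloid, which takes planes through the origin, hence
geodesics, to straight lines. -/
theorem klein_eq_hvec (z : ℍ) : klein z = ⟨hvec z 1 / hvec z 2, hvec z 0 / hvec z 2⟩ := by
  have := z.im_ne_zero
  simp only [klein, hvec, Matrix.cons_val_zero, Matrix.cons_val_one, Matrix.cons_val]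
  congr 1 <;> field_simp

theorem klein_injective : Function.Injective klein := by
  intro z w h
  have h1 := congrArg Complex.re h
  have h2 := congrArg Complex.im h
  simp only [klein] at h1 h2
  rw [h1] at h2
  refine UpperHalfPlane.ext_re_im h1 ?_
  have := z.im_pos
  have := w.im_pos
  nlinarith

theorem continuous_klein : Continuous klein := by
  have : klein = fun z : ℍ => (z.re : ℂ) + ((z.re ^ 2 + z.im ^ 2 : ℝ) : ℂ) * Complex.I := by
    ext z
    apply Complex.ext <;> simp [klein, -Complex.ofReal_add, -Complex.ofReal_pow]
  rw [this]
  have h1 := UpperHalfPlane.continuous_re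
  have h2 := UpperHalfPlane.continuous_im
  fun_prop

theorem range_klein : range klein = {c : ℂ | c.re ^ 2 < c.im} := by
  ext c
  constructor
  · rintro ⟨z, rfl⟩
    have := z.im_pos
    simp only [klein, mem_ofPred_eq]
    nlinarith
  · intro hc
    refine ⟨⟨⟨c.re, √(c.im - c.re ^ 2)⟩, Real.sqrt_pos.2 (sub_pos.2 hc)⟩, ?_⟩
    apply Complex.ext
    · rfl
    · change c.re ^ 2 + √(c.im - c.re ^ 2) ^ 2 = c.im
      rw [Real.sq_sqrt (sub_pos.2 hc).le]
      ring

theorem isOpenEmbedding_klein : Topology.IsOpenEmbedding klein := by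
  refine ⟨?_, range_klein ▸ isOpen_lt (by fun_prop) (by fun_prop)⟩
  let g : range klein → ℍ := fun c =>
    ⟨⟨c.1.re, √(c.1.im - c.1.re ^ 2)⟩, Real.sqrt_pos.2 (sub_pos.2 (range_klein ▸ c.2 :
      c.1 ∈ {c : ℂ | c.re ^ 2 < c.im}))⟩
  have hg : Continuous g := by
    rw [UpperHalfPlane.isOpenEmbedding_coe.isEmbedding.continuous_iff]
    have : UpperHalfPlane.coe ∘ g = fun c : range klein =>
        (c.1.re : ℂ) + (√(c.1.im - c.1.re ^ 2) : ℝ) * Complex.I := by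
      ext c
      apply Complex.ext <;> simp [g]
    rw [this]
    fun_prop
  have hleft : Function.LeftInverse g (rangeFactorization klein) := by
    intro z
    refine UpperHalfPlane.ext_re_im rfl ?_
    change √(z.re ^ 2 + z.im ^ 2 - z.re ^ 2) = z.im
    rw [add_sub_cancel_left, Real.sqrt_sq z.im_pos.le]
  have h1 : Topology.IsEmbedding (rangeFactorization klein) :=
    Topology.IsEmbedding.of_leftInverse hleft hg (continuous_klein.subtype_mk _)
  exact Topology.IsEmbedding.subtypeVal.comp h1

theorem mem_segment_klein_iff_hvec {p q r : ℍ} : klein r ∈ segment ℝ (klein p) (klein q) ↔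
    ∃ α β : ℝ, 0 ≤ α ∧ 0 ≤ β ∧ hvec r = α • hvec p + β • hvec q := by
  have hp := hvec_two_pos p
  have hq := hvec_two_pos q
  have hr := hvec_two_pos r
  constructor
  · rintro ⟨a, b, ha, hb, hab, h⟩
    refine ⟨hvec r 2 * a / hvec p 2, hvec r 2 * b / hvec q 2, by positivity, by positivity, ?_⟩
    have h1 := congrArg Complex.re h
    have h2 := congrArg Complex.im h
    simp only [Complex.add_re, Complex.add_im, Complex.real_smul, Complex.mul_re, Complex.mul_im,
      Complex.ofReal_re, Complex.ofReal_im, zero_mul, sub_zero, add_zero] at h1 h2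
    simp only [klein_eq_hvec] at h1 h2
    ext i
    fin_cases i <;> simp
    · field_simp at h2 ⊢
      linarith
    · field_simp at h1 ⊢
      linarith
    · field_simp
      linarith
  · rintro ⟨α, β, hα, hβ, h⟩
    have h0 := congrFun h 0
    have h1 := congrFun h 1
    have h2 := congrFun h 2
    simp only [Pi.add_apply, Pi.smul_apply, smul_eq_mul] at h0 h1 h2
    refine ⟨α * hvec p 2 / hvec r 2, β * hvec q 2 / hvec r 2, by positivity, by positivity, ?_, ?_⟩
    · rw [← add_div, ← h2, div_self hr.ne']
    · apply Complex.ext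
      · simp only [Complex.add_re, Complex.real_smul, Complex.mul_re,
          Complex.ofReal_re, Complex.ofReal_im, zero_mul, sub_zero, klein_eq_hvec]
        rw [h1]
        field_simp
      · simp only [Complex.add_im, Complex.real_smul, Complex.mul_im,
          Complex.ofReal_re, Complex.ofReal_im, zero_mul, add_zero, klein_eq_hvec]
        rw [h0]
        field_simp

/-- Metric betweenness is betweenness in the projective model. -/
theorem dist_add_dist_eq_iff {p q r : ℍ} :
    dist p r + dist r q = dist p q ↔ klein r ∈ segment ℝ (klein p) (klein q) := by
  rcases eq_or_ne p q with rfl | hpq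
  · rw [segment_same, mem_singleton_iff, klein_injective.eq_iff, dist_self, dist_comm r p]
    constructor
    · intro h
      exact (dist_eq_zero.1 (by linarith [dist_nonneg (x := p) (y := r)])).symm
    · rintro rfl
      simp
  rw [mem_segment_klein_iff_hvec]
  constructor
  · intro h
    obtain ⟨γ, hγ⟩ := exists_line_hvec hpq
    have h0 : 0 ≤ dist p r := dist_nonneg
    have h1 : 0 ≤ dist r q := dist_nonneg
    have hr : r = γ (dist p r) := by
      refine eq_line_of_dist hpq hγ (abs_of_nonneg h0).symm ?_
      rw [← h, dist_comm q r, abs_sub_comm, add_sub_cancel_left, abs_of_nonneg h1]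
    refine ⟨_, _, ?_, ?_, (congrArg hvec hr).trans (hγ _)⟩
    · exact div_nonneg (Real.sinh_nonneg_iff.2 (by linarith)) (sinh_dist_pos hpq).le
    · exact div_nonneg (Real.sinh_nonneg_iff.2 h0) (sinh_dist_pos hpq).le
  · rintro ⟨α, β, hα, hβ, h⟩
    have hc := cosh_dist_eq_lform p q
    have hpr := cosh_dist_eq_lform p r
    have hrq := cosh_dist_eq_lform r q
    have hrr := lform_hvec_self r
    rw [h, lform_comb, lform_comb_right, lform_comb_right, lform_hvec_self, lform_hvec_self,
      lform_comm (hvec q), ← hc] at hrr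
    rw [h, lform_comb_right, lform_hvec_self, ← hc] at hpr
    rw [h, lform_comb, lform_hvec_self, ← hc] at hrq
    have hs := Real.cosh_sq (dist p q)
    have s0 : 0 ≤ Real.sinh (dist p q) := Real.sinh_nonneg_iff.2 dist_nonneg
    -- The coefficients of `hvec r` are ratios of hyperbolic sines; `hrr`, the norm of `hvec r`,
    -- turns the known `cosh` values into these.
    have s1 : Real.sinh (dist p r) = β * Real.sinh (dist p q) := by
      have hs1 := Real.cosh_sq (dist p r)
      rw [hpr] at hs1
      refine (sq_eq_sq₀ (Real.sinh_nonneg_iff.2 dist_nonneg) (mul_nonneg hβ s0)).1 ?_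
      linear_combination hrr - hs1 + β ^ 2 * hs
    have s2 : Real.sinh (dist r q) = α * Real.sinh (dist p q) := by
      have hs1 := Real.cosh_sq (dist r q)
      rw [hrq] at hs1
      refine (sq_eq_sq₀ (Real.sinh_nonneg_iff.2 dist_nonneg) (mul_nonneg hα s0)).1 ?_
      linear_combination hrr - hs1 + α ^ 2 * hs
    have : Real.cosh (dist p r + dist r q) = Real.cosh (dist p q) := by
      rw [Real.cosh_add, hpr, hrq, s1, s2]
      linear_combination Real.cosh (dist p q) * hrr - α * β * hs
    have := le_antisymm (Real.cosh_le_cosh.1 this.le) (Real.cosh_le_cosh.1 this.ge)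
    rwa [abs_of_nonneg (add_nonneg dist_nonneg dist_nonneg), abs_of_nonneg dist_nonneg] at this

/-- The image of `klein` is the convex region above a parabola, so every Euclidean segment between
image points is the image of a geodesic segment. -/
theorem convex_klein_image {C : Set ℍ} (hC : GeodesicallyConvex C) : Convex ℝ (klein '' C) := by
  rw [convex_iff_segment_subset]
  rintro _ ⟨p, hp, rfl⟩ _ ⟨q, hq, rfl⟩ c hc
  have hconv : Convex ℝ (range klein) := by
    rw [range_klein]
    intro x hx y hy a b ha hb hab
    have hb' : b = 1 - a := by linarith
    simp only [mem_ofPred_eq] at hx hy ⊢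
    simp only [Complex.add_re, Complex.add_im, Complex.real_smul, Complex.mul_re, Complex.mul_im,
      Complex.ofReal_re, Complex.ofReal_im, zero_mul, sub_zero, add_zero]
    have hpos : 0 < a * (x.im - x.re ^ 2) + b * (y.im - y.re ^ 2) := by
      rcases ha.eq_or_lt with rfl | ha'
      · have : b = 1 := by linarith
        subst this
        linarith
      · have := mul_pos ha' (sub_pos.2 hx)
        have := mul_nonneg hb (sub_pos.2 hy).le
        linarith
    have : 0 ≤ a * b * (x.re - y.re) ^ 2 := by positivity
    subst hb'
    nlinarith
  obtain ⟨r, rfl⟩ := hconv.segment_subset (mem_range_self p) (mem_range_self q) hc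
  exact ⟨r, hC p hp q hq r (dist_add_dist_eq_iff.2 hc), rfl⟩

theorem GeodesicallyConvex.image_isometryEquiv {C : Set ℍ} (hC : GeodesicallyConvex C)
    (g : ℍ ≃ᵢ ℍ) : GeodesicallyConvex (g '' C) := by
  rintro _ ⟨p, hp, rfl⟩ _ ⟨q, hq, rfl⟩ r hr
  refine ⟨g.symm r, hC p hp q hq _ ?_, g.apply_symm_apply r⟩
  rw [← g.dist_eq, ← g.dist_eq (g.symm r), ← g.dist_eq p q, g.apply_symm_apply]
  exact hr

end ConvexHyperbolic

/-! ### Local geodesics, interiors of convex sets and rigidity of isometries in the hyperbolic plane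
-/

namespace ConvexHyperbolic

open UpperHalfPlane

/-! ### Geodesics of the hyperbolic plane -/

theorem dist_line {γ : ℝ → ℍ} (hγ : Isometry γ) {s t : ℝ} (hst : s ≤ t) :
    dist (γ s) (γ t) = t - s := by
  rw [hγ.dist_eq, Real.dist_eq, abs_sub_comm, abs_of_nonneg (sub_nonneg.2 hst)]

theorem exists_midpoint (p q : ℍ) : ∃ m, dist p m = dist p q / 2 ∧ dist m q = dist p q / 2 := by
  rcases eq_or_ne p q with rfl | hpq
  · exact ⟨p, by simp⟩
  obtain ⟨γ, hγ, h0, h1⟩ := exists_isometry_line hpq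
  have hd : 0 ≤ dist p q := dist_nonneg
  refine ⟨γ (dist p q / 2), ?_, ?_⟩
  · nth_rw 1 [← h0]
    rw [hγ.dist_eq, Real.dist_eq, zero_sub, abs_neg, abs_of_nonneg (by linarith)]
  · nth_rw 2 [← h1]
    rw [hγ.dist_eq, Real.dist_eq, abs_sub_comm, abs_of_nonneg (by linarith)]
    ring

theorem GeodesicallyConvex.exists_midpoint {C : Set ℍ} (hC : GeodesicallyConvex C) {p q : ℍ}
    (hp : p ∈ C) (hq : q ∈ C) :
    ∃ m ∈ C, dist p m = dist p q / 2 ∧ dist m q = dist p q / 2 := by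
  obtain ⟨m, h1, h2⟩ := ConvexHyperbolic.exists_midpoint p q
  exact ⟨m, hC p hp q hq m (by rw [h1, h2]; ring), h1, h2⟩

/-- A chain of points, each of which is the midpoint of its neighbours, lies on a line. -/
theorem exists_line_of_midpoint_chain {P : ℕ → ℍ} {N : ℕ} {ℓ : ℝ} (hℓ : 0 < ℓ) (hN : 0 < N)
    (h1 : ∀ i < N, dist (P i) (P (i + 1)) = ℓ)
    (h2 : ∀ i, i + 1 < N → dist (P i) (P (i + 2)) = 2 * ℓ) :
    ∃ γ : ℝ → ℍ, Isometry γ ∧ ∀ i ≤ N, P i = γ (i * ℓ) := by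
  have hne : P 0 ≠ P 1 := by
    intro h
    have := h1 0 hN
    rw [zero_add, h, dist_self] at this
    exact hℓ.ne this
  obtain ⟨γ, hγ, hγ0, hγ1⟩ := exists_isometry_line hne
  rw [show dist (P 0) (P 1) = ℓ from h1 0 hN] at hγ1
  have key : ∀ i, i + 1 ≤ N → P i = γ (i * ℓ) ∧ P (i + 1) = γ ((i + 1 : ℕ) * ℓ) := by
    intro i
    induction i with
    | zero => intro _; simp [hγ0, hγ1]
    | succ i ih =>
      intro hi
      obtain ⟨ha, hb⟩ := ih (by omega)
      refine ⟨hb, eq_of_isometry_line hγ (s := i * ℓ) (t := (i + 1 : ℕ) * ℓ) ?_ ?_ ?_⟩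
      · push_cast
        intro h
        linarith
      · rw [← ha, h2 i hi]
        push_cast
        rw [abs_of_nonneg] <;> linarith
      · rw [← hb, h1 (i + 1) hi]
        push_cast
        rw [abs_of_nonneg] <;> linarith
  refine ⟨γ, hγ, fun i hi => ?_⟩
  cases i with
  | zero => simp [hγ0]
  | succ i => exact (key i hi).2

/-- A unit speed local geodesic of the hyperbolic plane is part of a geodesic line. -/
theorem IsGeodesicPath.exists_line {σ : ℝ → ℍ} {a b : ℝ} (h : IsGeodesicPath σ a b) :
    ∃ γ : ℝ → ℍ, Isometry γ ∧ ∀ τ ∈ Icc a b, σ τ = γ τ := by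
  obtain ⟨hab, hloc⟩ := h
  obtain ⟨δ, hδ, hδa⟩ := hloc a (left_mem_Icc.2 hab.le)
  set η := min (δ / 2) (b - a) with hη
  have hη0 : 0 < η := lt_min (by linarith) (by linarith)
  have hη1 : η ≤ δ / 2 := min_le_left _ _
  have hη2 : η ≤ b - a := min_le_right _ _
  have hmem : a + η ∈ Icc a b := ⟨by linarith, by linarith⟩
  have hda : dist (σ a) (σ (a + η)) = η := by
    rw [hδa a (left_mem_Icc.2 hab.le) _ hmem (by simpa) (by simp [abs_of_pos hη0]; linarith)]
    rw [abs_sub_comm, add_sub_cancel_left, abs_of_pos hη0]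
  have hne : σ a ≠ σ (a + η) := by
    intro h
    rw [h, dist_self] at hda
    exact hη0.ne hda
  obtain ⟨γ₀, hγ₀, h0, h1⟩ := exists_isometry_line hne
  rw [hda] at h1
  set γ : ℝ → ℍ := fun t => γ₀ (t - a) with hγdef
  have hγ : Isometry γ := Isometry.of_dist_eq fun s t => by
    rw [hγdef, hγ₀.dist_eq, Real.dist_eq, Real.dist_eq]
    congr 1
    ring
  have hγa : σ a = γ a := by simp [hγdef, h0]
  have hγη : σ (a + η) = γ (a + η) := by simp [hγdef, h1]
  refine ⟨γ, hγ, ?_⟩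
  -- Two points of agreement with the line inside a window where the path is isometric force
  -- agreement on the whole window.
  have step : ∀ τ ∈ Icc a b, ∀ ε > 0, (∀ u ∈ Icc a b, ∀ v ∈ Icc a b,
      |u - τ| < ε → |v - τ| < ε → dist (σ u) (σ v) = |u - v|) → ∀ x ∈ Icc a b, ∀ y ∈ Icc a b,
      |x - τ| < ε → |y - τ| < ε → x ≠ y → σ x = γ x → σ y = γ y →
      ∀ u ∈ Icc a b, |u - τ| < ε → σ u = γ u := by
    intro τ hτ ε hε hiso x hx y hy hxε hyε hxy hxγ hyγ u hu huε
    refine eq_of_isometry_line hγ hxy ?_ ?_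
    · rw [← hxγ, hiso x hx u hu hxε huε, abs_sub_comm]
    · rw [← hyγ, hiso y hy u hu hyε huε, abs_sub_comm]
  have hstart : ∀ τ ∈ Icc a b, τ < a + η → σ τ = γ τ := by
    intro τ hτ hlt
    refine step a (left_mem_Icc.2 hab.le) δ hδ hδa a (left_mem_Icc.2 hab.le) (a + η) hmem (by simpa)
      (by simp [abs_of_pos hη0]; linarith) (by linarith) hγa hγη τ hτ ?_
    rw [abs_of_nonneg] <;> linarith [hτ.1]
  -- The strict inequality `τ < t` makes this set closed without using continuity of the path.
  set s : Set ℝ := {t | ∀ τ ∈ Icc a b, τ < t → σ τ = γ τ} with hs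
  have hext : ∀ x ∈ s, x ∈ Icc (a + η) b → ∃ ε > 0, ∀ u ∈ Icc a b, |u - x| < ε → σ u = γ u := by
    intro x hx hxI
    have hxab : x ∈ Icc a b := ⟨by linarith [hxI.1], hxI.2⟩
    obtain ⟨ε, hε, hiso⟩ := hloc x hxab
    set ζ := min (ε / 2) η with hζ
    have hζ0 : 0 < ζ := lt_min (by linarith) hη0
    have hζ1 : ζ ≤ ε / 2 := min_le_left _ _
    have hζ2 : ζ ≤ η := min_le_right _ _
    have m1 : x - ζ ∈ Icc a b := ⟨by linarith [hxI.1], by linarith [hxI.2]⟩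
    have m2 : x - ζ / 2 ∈ Icc a b := ⟨by linarith [hxI.1], by linarith [hxI.2]⟩
    refine ⟨ε, hε, step x hxab ε hε hiso _ m1 _ m2 ?_ ?_ (by linarith)
      (hx _ m1 (by linarith)) (hx _ m2 (by linarith))⟩
    · rw [sub_sub_cancel_left, abs_neg, abs_of_pos hζ0]
      linarith
    · rw [sub_sub_cancel_left, abs_neg, abs_of_pos (by linarith)]
      linarith
  have hclosed : IsClosed s := by
    have : s = ⋂ τ ∈ {τ | τ ∈ Icc a b ∧ σ τ ≠ γ τ}, Iic τ := by
      ext t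
      simp only [hs, mem_ofPred_eq, mem_iInter, mem_Iic, and_imp]
      refine forall_congr' fun τ => forall_congr' fun _ => ?_
      exact ⟨fun h hne => not_lt.1 fun hlt => hne (h hlt),
        fun h hlt => by_contra fun hne => (h hne).not_gt hlt⟩
    rw [this]
    exact isClosed_biInter fun _ _ => isClosed_Iic
  have hsub : Icc (a + η) b ⊆ s := by
    refine (hclosed.inter isClosed_Icc).Icc_subset_of_forall_exists_gt hstart ?_
    rintro x ⟨hx, hxI⟩ y hy
    obtain ⟨ε, hε, hεx⟩ := hext x hx ⟨hxI.1, hxI.2.le⟩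
    refine ⟨min y (x + ε), fun τ hτ hlt => ?_, lt_min hy (by linarith), min_le_left _ _⟩
    rcases lt_or_ge τ x with h | h
    · exact hx τ hτ h
    · refine hεx τ hτ ?_
      rw [abs_of_nonneg (by linarith)]
      linarith [min_le_right y (x + ε)]
  have hb : b ∈ s := hsub ⟨by linarith, le_rfl⟩
  intro τ hτ
  rcases hτ.2.lt_or_eq with h | rfl
  · exact hb τ hτ h
  · obtain ⟨ε, hε, hεx⟩ := hext τ hb ⟨by linarith, le_rfl⟩
    exact hεx τ hτ (by simpa)

/-! ### Interiors -/

theorem klein_mem_interior_iff {C : Set ℍ} {z : ℍ} :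
    klein z ∈ interior (klein '' C) ↔ z ∈ interior C := by
  rw [← mem_preimage, isOpenEmbedding_klein.isOpenMap.preimage_interior_eq_interior_preimage
    continuous_klein, klein_injective.preimage_image]

/-- In the projective model a convex set with nonempty interior lies in the closure of that
interior, so interior points occur arbitrarily near each of its points. -/
theorem GeodesicallyConvex.interior_inter_ball_nonempty {C : Set ℍ} (hC : GeodesicallyConvex C)
    (hint : (interior C).Nonempty) {p : ℍ} (hp : p ∈ C) {r : ℝ} (hr : 0 < r) :
    (interior (C ∩ Metric.ball p r)).Nonempty := by
  have hconv := convex_klein_image hC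
  obtain ⟨c, hc⟩ := hint
  have hne : (interior (klein '' C)).Nonempty := ⟨klein c, klein_mem_interior_iff.2 hc⟩
  have hcl : klein p ∈ closure (interior (klein '' C)) := by
    rw [hconv.closure_interior_eq_closure_of_nonempty_interior hne]
    exact subset_closure (mem_image_of_mem _ hp)
  have hopen : IsOpen (klein '' Metric.ball p r) := isOpenEmbedding_klein.isOpenMap _
    Metric.isOpen_ball
  obtain ⟨w, ⟨z, hz, rfl⟩, hw⟩ := mem_closure_iff.1 hcl _ hopen
    (mem_image_of_mem _ (Metric.mem_ball_self hr))
  refine ⟨z, ?_⟩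
  rw [interior_inter, Metric.isOpen_ball.interior_eq]
  exact ⟨klein_mem_interior_iff.1 hw, hz⟩

/-! ### Isometries of the hyperbolic plane -/

theorem exists_triple_det_ne_zero {S : Set ℍ} (hS : (interior S).Nonempty) :
    ∃ p : Fin 3 → ℍ, (∀ i, p i ∈ S) ∧ (Matrix.of fun i => hvec (p i)).det ≠ 0 := by
  obtain ⟨z, hz⟩ := hS
  have hopen : IsOpen (UpperHalfPlane.coe '' interior S) :=
    UpperHalfPlane.isOpenEmbedding_coe.isOpenMap _ isOpen_interior
  obtain ⟨ε, hε, hball⟩ := Metric.isOpen_iff.1 hopen z (mem_image_of_mem _ hz)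
  have key : ∀ w : ℂ, ‖w‖ < ε → ∃ q ∈ S, (q : ℂ) = z + w := by
    intro w hw
    obtain ⟨q, hq, hqw⟩ := hball (show (z : ℂ) + w ∈ _ by simpa using hw)
    exact ⟨q, interior_subset hq, hqw⟩
  obtain ⟨q, hq, hqz⟩ := key ((ε / 2 : ℝ) : ℂ) (by
    rw [Complex.norm_real, Real.norm_eq_abs, abs_of_pos] <;> linarith)
  obtain ⟨r, hr, hrz⟩ := key ((ε / 2 : ℝ) * Complex.I) (by
    rw [norm_mul, Complex.norm_real, Complex.norm_I, Real.norm_eq_abs, abs_of_pos] <;> linarith)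
  have q1 : q.re = z.re + ε / 2 := by simpa using congrArg Complex.re hqz
  have q2 : q.im = z.im := by simpa using congrArg Complex.im hqz
  have r1 : r.re = z.re := by simpa using congrArg Complex.re hrz
  have r2 : r.im = z.im + ε / 2 := by simpa using congrArg Complex.im hrz
  refine ⟨![z, q, r], ?_, ?_⟩
  · intro i
    fin_cases i
    exacts [interior_subset hz, hq, hr]
  · have hzi := z.im_pos
    rw [Matrix.det_fin_three]
    simp only [Matrix.of_apply, hvec, Matrix.cons_val_zero, Matrix.cons_val_one, Matrix.cons_val,
      q1, q2, r1, r2]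
    have : 0 < z.im + ε / 2 := by positivity
    have h3 : 0 < ε / 2 * (2 * z.im * (ε / 2) + (ε / 2) ^ 2) := by positivity
    have h4 : 0 < (z.im * z.im * (z.im + ε / 2))⁻¹ := by positivity
    have h5 := (mul_pos h3 h4).ne'
    intro h
    apply h5
    rw [← neg_eq_zero, ← h]
    field_simp
    ring

/-- Distances to the three points are three independent linear functionals of the hyperboloid
vector. -/
theorem eq_of_dist_eq_triple {p : Fin 3 → ℍ} (hp : (Matrix.of fun i => hvec (p i)).det ≠ 0)
    {z w : ℍ} (h : ∀ i, dist (p i) z = dist (p i) w) : z = w := by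
  apply hvec_injective
  have key : ∀ i, lform (hvec (p i)) (hvec z) = lform (hvec (p i)) (hvec w) := fun i => by
    rw [← cosh_dist_eq_lform, ← cosh_dist_eq_lform, h]
  -- This is the Lorentzian dual of the difference, so that multiplying by the matrix of the `p i`
  -- yields the pairings with them.
  let u : Fin 3 → ℝ := ![(hvec z 2 - hvec w 2) / 2, -(hvec z 1 - hvec w 1),
    (hvec z 0 - hvec w 0) / 2]
  have hu : u = 0 := by
    refine Matrix.eq_zero_of_mulVec_eq_zero hp ?_
    ext i
    have := key i
    simp only [lform] at this
    simp only [Matrix.mulVec, dotProduct, Fin.sum_univ_three, Matrix.of_apply, u,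
      Matrix.cons_val_zero, Matrix.cons_val_one, Matrix.cons_val, Pi.zero_apply]
    linarith
  have h0 := congrFun hu 0
  have h1 := congrFun hu 1
  have h2 := congrFun hu 2
  simp only [u, Matrix.cons_val_zero, Matrix.cons_val_one, Matrix.cons_val, Pi.zero_apply]
    at h0 h1 h2
  ext i
  fin_cases i
  · simp only [Fin.zero_eta]; linarith
  · simp only [Fin.mk_one]; linarith
  · simp only [Fin.reduceFinMk]; linarith

/-- An isometry is determined by its values on a set with nonempty interior. -/
theorem isometryEquiv_ext_of_interior {S : Set ℍ} (hS : (interior S).Nonempty) {g h : ℍ ≃ᵢ ℍ}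
    (hgh : ∀ z ∈ S, g z = h z) : g = h := by
  obtain ⟨p, hpS, hp⟩ := exists_triple_det_ne_zero hS
  ext1 z
  have : (g.trans h.symm) z = z := by
    refine eq_of_dist_eq_triple hp fun i => ?_
    have hi : h.symm (g (p i)) = p i := by rw [hgh _ (hpS i), h.symm_apply_apply]
    rw [IsometryEquiv.trans_apply]
    nth_rw 1 [← hi]
    rw [h.symm.dist_eq, g.dist_eq]
  rw [IsometryEquiv.trans_apply] at this
  rw [← this, h.apply_symm_apply, this]

/-- The matrix of the Lorentzian form. -/
noncomputable def lmatrix : Matrix (Fin 3) (Fin 3) ℝ := !![0, 0, 1 / 2; 0, -1, 0; 1 / 2, 0, 0]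

theorem lform_eq_dotProduct (v w : Fin 3 → ℝ) :
    lform v w = dotProduct v (Matrix.mulVec lmatrix w) := by
  simp [lform, lmatrix, Matrix.mulVec, dotProduct, Fin.sum_univ_three]
  ring

theorem det_lmatrix_ne_zero : lmatrix.det ≠ 0 := by
  simp [lmatrix, Matrix.det_fin_three]

theorem lform_vecMul {T : Matrix (Fin 3) (Fin 3) ℝ}
    (hT : T * lmatrix * T.transpose = lmatrix) (v w : Fin 3 → ℝ) :
    lform (Matrix.vecMul v T) (Matrix.vecMul w T) = lform v w := by
  rw [lform_eq_dotProduct, lform_eq_dotProduct, ← Matrix.mulVec_transpose T w,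
    ← Matrix.dotProduct_mulVec, Matrix.mulVec_mulVec, Matrix.mulVec_mulVec, hT]

theorem exists_isometry_of_matrix {T : Matrix (Fin 3) (Fin 3) ℝ}
    (hT : T * lmatrix * T.transpose = lmatrix) {p q : ℍ}
    (hpq : Matrix.vecMul (hvec p) T = hvec q) :
    ∃ g : ℍ → ℍ, Isometry g ∧ ∀ z, hvec (g z) = Matrix.vecMul (hvec z) T := by
  have : ∀ z, ∃ w : ℍ, hvec w = Matrix.vecMul (hvec z) T := fun z => by
    refine exists_hvec_eq_of_lform_pos (z := q) ?_ ?_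
    · rw [lform_vecMul hT, lform_hvec_self]
    · rw [← hpq, lform_vecMul hT, ← cosh_dist_eq_lform]
      exact Real.cosh_pos _
  choose g hg using this
  refine ⟨g, Isometry.of_dist_eq fun z w => ?_, hg⟩
  rw [dist_eq_abs_of_lform (t := dist z w), abs_of_nonneg dist_nonneg]
  rw [hg, hg, lform_vecMul hT, cosh_dist_eq_lform]

/-- An isometric embedding of a set with nonempty interior into the hyperbolic plane is the
restriction of an isometry. -/
theorem exists_isometryEquiv_extension {S : Set ℍ} (hS : (interior S).Nonempty) {f : ℍ → ℍ}
    (hf : ∀ z ∈ S, ∀ w ∈ S, dist (f z) (f w) = dist z w) :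
    ∃ g : ℍ ≃ᵢ ℍ, ∀ z ∈ S, g z = f z := by
  obtain ⟨p, hpS, hp⟩ := exists_triple_det_ne_zero hS
  set M : Matrix (Fin 3) (Fin 3) ℝ := Matrix.of fun i => hvec (p i) with hM
  set N : Matrix (Fin 3) (Fin 3) ℝ := Matrix.of fun i => hvec (f (p i)) with hN
  -- Equal distances mean equal Gram matrices, so `M⁻¹ * N` preserves the Lorentzian form; comparing
  -- determinants also shows that `N` is invertible.
  have gram : M * lmatrix * M.transpose = N * lmatrix * N.transpose := by
    ext i j
    have hG : ∀ (q : Fin 3 → ℍ), ((Matrix.of fun i => hvec (q i)) * lmatrix *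
        (Matrix.of fun i => hvec (q i)).transpose) i j = lform (hvec (q i)) (hvec (q j)) := by
      intro q
      rw [Matrix.mul_assoc, Matrix.mul_apply, lform_eq_dotProduct]
      simp [dotProduct, Matrix.mulVec, Matrix.mul_apply]
    rw [hM, hN, hG p, hG fun i => f (p i), ← cosh_dist_eq_lform, ← cosh_dist_eq_lform,
      hf _ (hpS i) _ (hpS j)]
  have hNdet : N.det ≠ 0 := by
    intro h
    have := congrArg Matrix.det gram
    rw [Matrix.det_mul, Matrix.det_mul, Matrix.det_mul, Matrix.det_mul, Matrix.det_transpose,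
      Matrix.det_transpose, h] at this
    simp [hp, det_lmatrix_ne_zero] at this
  have key : ∀ {A B : Matrix (Fin 3) (Fin 3) ℝ}, A.det ≠ 0 →
      A * lmatrix * A.transpose = B * lmatrix * B.transpose →
      (A⁻¹ * B) * lmatrix * (A⁻¹ * B).transpose = lmatrix := by
    intro A B hA h
    have hu : IsUnit A.det := isUnit_iff_ne_zero.2 hA
    have hut : IsUnit A.transpose.det := by rwa [Matrix.det_transpose]
    have e1 : A⁻¹ * B * lmatrix * (A⁻¹ * B).transpose =
        A⁻¹ * (B * lmatrix * B.transpose) * (A.transpose)⁻¹ := by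
      rw [Matrix.transpose_mul, Matrix.transpose_nonsing_inv]
      simp only [Matrix.mul_assoc]
    rw [e1, ← h, Matrix.mul_assoc A, Matrix.nonsing_inv_mul_cancel_left _ _ hu,
      Matrix.mul_nonsing_inv_cancel_right _ _ hut]
  have hrow : ∀ {A : Matrix (Fin 3) (Fin 3) ℝ} (B : Matrix (Fin 3) (Fin 3) ℝ), A.det ≠ 0 →
      ∀ i, Matrix.vecMul (A i) (A⁻¹ * B) = B i := by
    intro A B hA i
    have hu : IsUnit A.det := isUnit_iff_ne_zero.2 hA
    have := congrFun (Matrix.mul_nonsing_inv_cancel_left A B hu) i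
    rw [← this]
    ext j
    simp [Matrix.vecMul, Matrix.mul_apply, dotProduct]
  have hMN := hrow N hp
  have hNM := hrow M hNdet
  obtain ⟨g, hg, hgv⟩ := exists_isometry_of_matrix (key hp gram) (hMN 0)
  obtain ⟨g', hg', hgv'⟩ := exists_isometry_of_matrix (key hNdet gram.symm) (hNM 0)
  have gp : ∀ i, g (p i) = f (p i) := fun i => hvec_injective ((hgv _).trans (hMN i))
  have gp' : ∀ i, g' (f (p i)) = p i := fun i => hvec_injective ((hgv' _).trans (hNM i))
  have left : Function.LeftInverse g' g := fun z => eq_of_dist_eq_triple hp fun i => by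
    nth_rw 1 [← gp' i, ← gp i]
    rw [hg'.dist_eq, hg.dist_eq]
  have right : Function.RightInverse g' g := fun z => by
    refine eq_of_dist_eq_triple (p := fun i => f (p i)) hNdet fun i => ?_
    nth_rw 1 [← gp i, ← gp' i]
    rw [hg.dist_eq, hg'.dist_eq]
  refine ⟨⟨⟨g, g', left, right⟩, hg⟩, fun z hz => ?_⟩
  refine eq_of_dist_eq_triple (p := fun i => f (p i)) hNdet fun i => ?_
  rw [hf _ (hpS i) _ hz, ← gp i]
  exact hg.dist_eq _ _

end ConvexHyperbolic

/-! ### Uniform charts, holonomy along chains and chains of least energy -/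

namespace ConvexHyperbolic

open UpperHalfPlane

/-! ### Atlases of uniform radius -/

section

variable {X : Type*} [MetricSpace X]

theorem IsIsometricChart.restrict {C : Set ℍ} {x y : X} {ε δ : ℝ} {φ : X → ℍ}
    (h : IsIsometricChart C x ε φ) (hδ : 0 < δ) (hyx : dist y x + δ ≤ ε) :
    IsIsometricChart C y δ φ := by
  obtain ⟨h1, h2⟩ := h
  have hsub : Metric.ball y δ ⊆ Metric.ball x ε := Metric.ball_subset_ball' (by linarith)
  have hy : y ∈ Metric.ball x ε := hsub (Metric.mem_ball_self hδ)
  have hx : x ∈ Metric.ball x ε := Metric.mem_ball_self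
    (lt_of_lt_of_le (add_pos_of_nonneg_of_pos dist_nonneg hδ) hyx)
  refine ⟨fun a ha b hb => h1 a (hsub ha) b (hsub hb), ?_⟩
  ext c
  constructor
  · rintro ⟨a, ha, rfl⟩
    refine ⟨(h2 ▸ mem_image_of_mem φ (hsub ha) : φ a ∈ C ∩ _).1, ?_⟩
    rw [Metric.mem_ball, h1 a (hsub ha) y hy]
    exact ha
  · rintro ⟨hc, hcb⟩
    have : c ∈ C ∩ Metric.ball (φ x) ε := by
      refine ⟨hc, ?_⟩
      rw [Metric.mem_ball] at hcb ⊢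
      have := h1 y hy x hx
      linarith [dist_triangle c (φ y) (φ x)]
    rw [← h2] at this
    obtain ⟨a, ha, rfl⟩ := this
    refine ⟨a, ?_, rfl⟩
    rwa [Metric.mem_ball, h1 a ha y hy] at hcb

variable (X) in
/-- A choice of charts of one and the same radius about all points of a surface. -/
structure UniformAtlas where
  /-- A quarter of the radius up to which transition isometries exist. -/
  ρ : ℝ
  ρ_pos : 0 < ρ
  /-- The model of the surface near a point. -/
  C : X → Set ℍ
  convex : ∀ x, GeodesicallyConvex (C x)
  interior_nonempty : ∀ x, (interior (C x)).Nonempty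
  /-- The chart about a point. -/
  ψ : X → X → ℍ
  chart : ∀ x, IsIsometricChart (C x) x (8 * ρ) (ψ x)

/-- A chart of radius `ε` restricts to charts of radius `ε / 2` about all points of the ball of
radius `ε / 2`; compactness makes the radius uniform. -/
theorem IsConvexHyperbolicSurface.nonempty_uniformAtlas [CompactSpace X]
    (hX : IsConvexHyperbolicSurface X) : Nonempty (UniformAtlas X) := by
  suffices ∃ ε > 0, ∀ x ∈ (univ : Set X), ∃ C : Set ℍ, GeodesicallyConvex C ∧
      (interior C).Nonempty ∧ ∃ φ : X → ℍ, IsIsometricChart C x ε φ by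
    obtain ⟨ε, hε, h⟩ := this
    choose C hC hint ψ hψ using fun x => h x (mem_univ x)
    exact ⟨⟨ε / 8, by positivity, C, hC, hint, ψ, fun x => by convert hψ x using 1; ring⟩⟩
  refine isCompact_univ.induction_on (p := fun s => ∃ ε > 0, ∀ x ∈ s, ∃ C : Set ℍ,
    GeodesicallyConvex C ∧ (interior C).Nonempty ∧ ∃ φ : X → ℍ, IsIsometricChart C x ε φ) ?_ ?_ ?_ ?_
  · exact ⟨1, one_pos, by simp⟩
  · rintro s t hst ⟨ε, hε, h⟩
    exact ⟨ε, hε, fun x hx => h x (hst hx)⟩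
  · rintro s t ⟨ε, hε, h⟩ ⟨δ, hδ, h'⟩
    refine ⟨min ε δ, lt_min hε hδ, fun x hx => ?_⟩
    rcases hx with hx | hx
    · obtain ⟨C, h1, h2, φ, h3⟩ := h x hx
      exact ⟨C, h1, h2, φ, h3.restrict (lt_min hε hδ) (by simp)⟩
    · obtain ⟨C, h1, h2, φ, h3⟩ := h' x hx
      exact ⟨C, h1, h2, φ, h3.restrict (lt_min hε hδ) (by simp)⟩
  · intro x _
    obtain ⟨C, -, h1, h2, ε, hε, φ, h3⟩ := hX x
    refine ⟨Metric.ball x (ε / 2), mem_nhdsWithin_of_mem_nhds (Metric.ball_mem_nhds x (by positivity)),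
      ε / 2, by positivity, fun y hy => ⟨C, h1, h2, φ, h3.restrict (by positivity) ?_⟩⟩
    rw [Metric.mem_ball] at hy
    linarith

namespace UniformAtlas

variable (A : UniformAtlas X)

theorem dist_ψ {x y z : X} (hy : dist y x < 8 * A.ρ) (hz : dist z x < 8 * A.ρ) :
    dist (A.ψ x y) (A.ψ x z) = dist y z :=
  (A.chart x).1 y hy z hz

theorem ψ_mem {x y : X} (hy : dist y x < 8 * A.ρ) : A.ψ x y ∈ A.C x :=
  ((A.chart x).2 ▸ mem_image_of_mem (A.ψ x) (Metric.mem_ball.2 hy) : A.ψ x y ∈ A.C x ∩ _).1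

theorem exists_ψ_eq {x : X} {c : ℍ} (hc : c ∈ A.C x) (hd : dist c (A.ψ x x) < 8 * A.ρ) :
    ∃ y, dist y x = dist c (A.ψ x x) ∧ A.ψ x y = c := by
  have : c ∈ A.C x ∩ Metric.ball (A.ψ x x) (8 * A.ρ) := ⟨hc, hd⟩
  rw [← (A.chart x).2] at this
  obtain ⟨y, hy, rfl⟩ := this
  exact ⟨y, ((A.chart x).1 y hy x (Metric.mem_ball_self (by linarith [A.ρ_pos]))).symm, rfl⟩

theorem interior_image_ball_nonempty (x : X) {r : ℝ} (hr : 0 < r) (hr' : r ≤ 8 * A.ρ) :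
    (interior (A.ψ x '' Metric.ball x r)).Nonempty := by
  rw [((A.chart x).restrict hr (by simpa using hr')).2]
  exact (A.convex x).interior_inter_ball_nonempty (A.interior_nonempty x)
    (A.ψ_mem (by simpa using A.ρ_pos)) hr

/-- The ball of radius `4ρ` about `y` lies in both chart domains, so the change of charts is an
isometric map on a set with interior and extends to the plane. -/
theorem exists_transition {x y : X} (hxy : dist x y ≤ 4 * A.ρ) :
    ∃ g : ℍ ≃ᵢ ℍ, ∀ z, dist z x < 8 * A.ρ → dist z y < 8 * A.ρ → g (A.ψ y z) = A.ψ x z := by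
  have hρ := A.ρ_pos
  set D := Metric.ball x (8 * A.ρ) ∩ Metric.ball y (8 * A.ρ) with hD
  have hinj : InjOn (A.ψ y) D := by
    intro a ha b hb hab
    rw [← dist_eq_zero, ← A.dist_ψ ha.2 hb.2, hab, dist_self]
  have hne : (interior (A.ψ y '' D)).Nonempty := by
    refine (A.interior_image_ball_nonempty y (r := 4 * A.ρ) (by linarith) (by linarith)).mono
      (interior_mono (image_mono ?_))
    intro z hz
    rw [Metric.mem_ball] at hz
    constructor
    · rw [Metric.mem_ball]
      linarith [dist_triangle z y x, dist_comm x y]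
    · rw [Metric.mem_ball]
      linarith
  have : Nonempty X := ⟨x⟩
  obtain ⟨g, hg⟩ := exists_isometryEquiv_extension hne
    (f := fun z => A.ψ x (Function.invFunOn (A.ψ y) D z)) (by
      rintro _ ⟨a, ha, rfl⟩ _ ⟨b, hb, rfl⟩
      rw [hinj.leftInvOn_invFunOn ha, hinj.leftInvOn_invFunOn hb, A.dist_ψ ha.1 hb.1,
        A.dist_ψ ha.2 hb.2])
  refine ⟨g, fun z h1 h2 => ?_⟩
  have hz : z ∈ D := ⟨h1, h2⟩
  rw [hg _ (mem_image_of_mem _ hz), hinj.leftInvOn_invFunOn hz]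

open Classical in
/-- The isometry of the hyperbolic plane carrying the chart about `y` to the chart about `x`. -/
noncomputable def transition (x y : X) : ℍ ≃ᵢ ℍ :=
  if h : dist x y ≤ 4 * A.ρ then (A.exists_transition h).choose else 1

theorem transition_apply {x y z : X} (hxy : dist x y ≤ 4 * A.ρ) (hx : dist z x < 8 * A.ρ)
    (hy : dist z y < 8 * A.ρ) : A.transition x y (A.ψ y z) = A.ψ x z := by
  rw [transition, dif_pos hxy]
  exact (A.exists_transition hxy).choose_spec z hx hy

/-- Cocycle rule: both sides agree on the chart image of the ball of radius `4ρ` about `z`, and this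
determines an isometry. -/
theorem transition_mul {x y z : X} (hxy : dist x y ≤ 4 * A.ρ) (hyz : dist y z ≤ 4 * A.ρ)
    (hxz : dist x z ≤ 4 * A.ρ) : A.transition x y * A.transition y z = A.transition x z := by
  have hρ := A.ρ_pos
  refine isometryEquiv_ext_of_interior
    (A.interior_image_ball_nonempty z (r := 4 * A.ρ) (by linarith) (by linarith)) ?_
  rintro _ ⟨w, hw, rfl⟩
  rw [Metric.mem_ball] at hw
  have h1 : dist w x < 8 * A.ρ := by linarith [dist_triangle w z x, dist_comm x z]
  have h2 : dist w y < 8 * A.ρ := by linarith [dist_triangle w z y, dist_comm y z]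
  have h3 : dist w z < 8 * A.ρ := by linarith
  rw [IsometryEquiv.mul_apply, A.transition_apply hyz h2 h3, A.transition_apply hxy h1 h2,
    A.transition_apply hxz h1 h3]

theorem transition_self (x : X) : A.transition x x = 1 := by
  have h : dist x x ≤ 4 * A.ρ := by simpa using A.ρ_pos.le
  have := A.transition_mul h h h
  simpa using this

/-! ### Development along chains -/

/-- Consecutive points among the first `N + 1` points of `x` are close. -/
def IsChain (x : ℕ → X) (N : ℕ) : Prop := ∀ i < N, dist (x i) (x (i + 1)) ≤ A.ρ

/-- The composition of the transition isometries along a chain. -/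
noncomputable def hol (x : ℕ → X) : ℕ → ℍ ≃ᵢ ℍ
  | 0 => 1
  | n + 1 => hol x n * A.transition (x n) (x (n + 1))

theorem hol_congr {x y : ℕ → X} {n : ℕ} (h : ∀ i ≤ n, x i = y i) : A.hol x n = A.hol y n := by
  induction n with
  | zero => rfl
  | succ n ih => rw [hol, hol, ih fun i hi => h i (by omega), h n (by omega), h (n + 1) le_rfl]

/-- The two chains bound a strip of small quadrilaterals, and the cocycle rule applies across each.
In particular neighbouring chains with the same ends have the same holonomy. -/
theorem hol_near {x y : ℕ → X} {N : ℕ} (hx : A.IsChain x N) (hy : A.IsChain y N)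
    (h0 : x 0 = y 0) (hxy : ∀ i ≤ N, dist (x i) (y i) ≤ 2 * A.ρ) :
    ∀ n ≤ N, A.hol y n = A.hol x n * A.transition (x n) (y n) := by
  have hρ := A.ρ_pos
  intro n
  induction n with
  | zero => intro _; rw [hol, hol, h0, transition_self, one_mul]
  | succ n ih =>
    intro hn
    have d1 := hxy n (by omega)
    have d2 := hxy (n + 1) hn
    have d3 := hx n hn
    have d4 := hy n hn
    have d5 := dist_triangle (x n) (y n) (y (n + 1))
    rw [hol, hol, ih (by omega), mul_assoc, mul_assoc,
      A.transition_mul (by linarith) (by linarith) (by linarith),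
      A.transition_mul (by linarith) (by linarith) (by linarith)]

theorem hol_eq_of_near {x y : ℕ → X} {N : ℕ} (hx : A.IsChain x N) (hy : A.IsChain y N)
    (h0 : x 0 = y 0) (hN : x N = y N) (hxy : ∀ i ≤ N, dist (x i) (y i) ≤ 2 * A.ρ) :
    A.hol y N = A.hol x N := by
  rw [A.hol_near hx hy h0 hxy N le_rfl, hN, transition_self, mul_one]

/-- Among the chains with given endpoints, number of steps and holonomy there is one of least
energy. -/
theorem exists_energy_min [CompactSpace X] {x : ℕ → X} {N : ℕ} (hx : A.IsChain x N) :
    ∃ y : ℕ → X, A.IsChain y N ∧ y 0 = x 0 ∧ y N = x N ∧ A.hol y N = A.hol x N ∧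
      ∀ z : ℕ → X, A.IsChain z N → z 0 = x 0 → z N = x N → A.hol z N = A.hol x N →
        ∑ i ∈ Finset.range N, dist (y i) (y (i + 1)) ^ 2 ≤
          ∑ i ∈ Finset.range N, dist (z i) (z (i + 1)) ^ 2 := by
  have hρ := A.ρ_pos
  -- The ambient space of all sequences is compact by Tychonoff; the coordinates beyond `N` play no
  -- role.
  set S₀ : Set (ℕ → X) := {y | A.IsChain y N ∧ y 0 = x 0 ∧ y N = x N} with hS₀
  set S : Set (ℕ → X) := {y | y ∈ S₀ ∧ A.hol y N = A.hol x N} with hS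
  have hS₀c : IsClosed S₀ := by
    have : S₀ = (⋂ i ∈ Iio N, {y | dist (y i) (y (i + 1)) ≤ A.ρ}) ∩ {y | y 0 = x 0} ∩
        {y | y N = x N} := by
      ext y
      simp [hS₀, IsChain, and_assoc]
    rw [this]
    refine ((isClosed_biInter fun i _ => isClosed_le (by fun_prop) continuous_const).inter
      (isClosed_eq (by fun_prop) continuous_const)).inter
      (isClosed_eq (by fun_prop) continuous_const)
  -- On `S₀` the holonomy is locally constant, so prescribing it is a closed condition.
  have hSc : IsClosed S := by
    refine isClosed_of_closure_subset fun y hy => ?_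
    have hy₀ : y ∈ S₀ := hS₀c.closure_subset_iff.2 (fun _ h => h.1) hy
    have hopen : IsOpen (⋂ i ∈ Iic N, {z : ℕ → X | dist (y i) (z i) < A.ρ}) :=
      (finite_Iic N).isOpen_biInter fun i _ => isOpen_lt (by fun_prop) continuous_const
    obtain ⟨z, hz, hzS⟩ := mem_closure_iff.1 hy _ hopen (by simp [hρ])
    refine ⟨hy₀, ?_⟩
    rw [← hzS.2]
    refine (A.hol_eq_of_near hy₀.1 hzS.1.1 ?_ ?_ ?_).symm
    · rw [hy₀.2.1, hzS.1.2.1]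
    · rw [hy₀.2.2, hzS.1.2.2]
    · intro i hi
      have : dist (y i) (z i) < A.ρ := mem_iInter₂.1 hz i hi
      linarith
  obtain ⟨y, hy, hmin⟩ := hSc.isCompact.exists_isMinOn ⟨x, ⟨hx, rfl, rfl⟩, rfl⟩
    (f := fun y : ℕ → X => ∑ i ∈ Finset.range N, dist (y i) (y (i + 1)) ^ 2)
    (by fun_prop)
  exact ⟨y, hy.1.1, hy.1.2.1, hy.1.2.2, hy.2, fun z h1 h2 h3 h4 => hmin ⟨⟨h1, h2, h3⟩, h4⟩⟩

/-- The convex model of the chart about `x` contains the midpoint of the images of `x` and `y`, and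
it lies within the chart radius. -/
theorem exists_midpoint {x y : X} (hxy : dist x y < 8 * A.ρ) :
    ∃ m, dist x m = dist x y / 2 ∧ dist m y = dist x y / 2 := by
  have hρ := A.ρ_pos
  have hx : dist x x < 8 * A.ρ := by simpa using hρ
  have hy : dist y x < 8 * A.ρ := by rwa [dist_comm]
  obtain ⟨c, hc, h1, h2⟩ := (A.convex x).exists_midpoint (A.ψ_mem hx) (A.ψ_mem hy)
  rw [A.dist_ψ hx hy] at h1 h2
  have hn : 0 ≤ dist x y := dist_nonneg
  have hd : dist c (A.ψ x x) < 8 * A.ρ := by rw [dist_comm, h1]; linarith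
  obtain ⟨m, hm, rfl⟩ := A.exists_ψ_eq hc hd
  have hm' : dist m x < 8 * A.ρ := by rw [hm]; exact hd
  rw [A.dist_ψ hx hm'] at h1
  rw [A.dist_ψ hm' hy] at h2
  exact ⟨m, h1, h2⟩

/-- A chain of least energy consists of midpoints. -/
theorem eq_of_energy_min {y : ℕ → X} {N : ℕ} (hy : A.IsChain y N)
    (hmin : ∀ z : ℕ → X, A.IsChain z N → z 0 = y 0 → z N = y N → A.hol z N = A.hol y N →
        ∑ i ∈ Finset.range N, dist (y i) (y (i + 1)) ^ 2 ≤
          ∑ i ∈ Finset.range N, dist (z i) (z (i + 1)) ^ 2) {i : ℕ} (hi : i + 1 < N) :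
    dist (y i) (y (i + 1)) = dist (y (i + 1)) (y (i + 2)) ∧
      dist (y i) (y (i + 2)) = 2 * dist (y i) (y (i + 1)) := by
  have hρ := A.ρ_pos
  have ha := hy i (by omega)
  have hb : dist (y (i + 1)) (y (i + 2)) ≤ A.ρ := hy (i + 1) hi
  have hd := dist_triangle (y i) (y (i + 1)) (y (i + 2))
  -- The competitor replaces the middle point by `m`; the new steps have length at most `ρ` and `m`
  -- is within `2ρ` of the old point, so the holonomy is kept.
  obtain ⟨m, h1, h2⟩ := A.exists_midpoint (x := y i) (y := y (i + 2)) (by linarith)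
  set z := Function.update y (i + 1) m with hz
  have zi : z (i + 1) = m := by simp [hz]
  have zne : ∀ j, j ≠ i + 1 → z j = y j := fun j hj => by simp [hz, hj]
  have hzc : A.IsChain z N := by
    intro j hj
    rcases eq_or_ne j i with rfl | hji
    · rw [zi, zne _ (by omega), h1]
      linarith
    rcases eq_or_ne j (i + 1) with rfl | hji'
    · rw [zi, zne _ (by omega), h2]
      linarith
    · rw [zne _ hji', zne _ (by omega)]
      exact hy j hj
  have hz0 : z 0 = y 0 := zne 0 (by omega)
  have hzN : z N = y N := zne N (by omega)
  have hhol : A.hol z N = A.hol y N := by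
    refine A.hol_eq_of_near hy hzc hz0.symm hzN.symm fun j _ => ?_
    rcases eq_or_ne j (i + 1) with rfl | hj
    · rw [zi]
      linarith [dist_triangle (y (i + 1)) (y i) m, dist_comm (y i) (y (i + 1))]
    · rw [zne j hj, dist_self]
      linarith
  have hE := hmin z hzc hz0 hzN hhol
  have hm1 : i ∈ Finset.range N := by simp; omega
  have hm2 : i + 1 ∈ (Finset.range N).erase i := by simp; omega
  rw [← Finset.add_sum_erase _ _ hm1, ← Finset.add_sum_erase _ _ hm2,
    ← Finset.add_sum_erase _ _ hm1, ← Finset.add_sum_erase _ _ hm2] at hE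
  have hrest : ∑ j ∈ ((Finset.range N).erase i).erase (i + 1), dist (z j) (z (j + 1)) ^ 2 =
      ∑ j ∈ ((Finset.range N).erase i).erase (i + 1), dist (y j) (y (j + 1)) ^ 2 := by
    refine Finset.sum_congr rfl fun j hj => ?_
    simp only [Finset.mem_erase] at hj
    rw [zne j hj.1, zne (j + 1) (by omega)]
  rw [hrest, zi, zne i (by omega), zne (i + 1 + 1) (by omega), h1, h2] at hE
  change _ + (dist (y (i + 1)) (y (i + 2)) ^ 2 + _) ≤ _ at hE
  set a := dist (y i) (y (i + 1))
  set b := dist (y (i + 1)) (y (i + 2))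
  set d := dist (y i) (y (i + 2))
  have hd0 : 0 ≤ d := dist_nonneg
  -- Minimality reads `a ^ 2 + b ^ 2 ≤ d ^ 2 / 2`. With `d ≤ a + b` this forces `a = b`, and then `d
  -- = 2 * a`.
  have hdsq : d ^ 2 ≤ (a + b) ^ 2 := by gcongr
  have hab : (a - b) ^ 2 ≤ 0 := by nlinarith
  have hab' : a = b :=
    sub_eq_zero.1 ((pow_eq_zero_iff two_ne_zero).1 (le_antisymm hab (sq_nonneg _)))
  refine ⟨hab', le_antisymm (by linarith) (not_lt.1 fun hlt => ?_)⟩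
  have ha0 : 0 ≤ a := dist_nonneg
  rw [← hab'] at hE
  nlinarith

end UniformAtlas

end

end ConvexHyperbolic

/-! ### The developed surface: framed points and convexity of their positions -/

namespace ConvexHyperbolic

open UpperHalfPlane

section

variable {X : Type*} [MetricSpace X]

namespace UniformAtlas

variable (A : UniformAtlas X)

/-! ### The developed surface -/

/-- Continuation of a framed point `(x, g)`, standing for the chart `g ∘ ψ x` about `x`, to a
nearby point. -/
def Step (w w' : X × (ℍ ≃ᵢ ℍ)) : Prop :=
  dist w.1 w'.1 ≤ A.ρ ∧ w'.2 = w.2 * A.transition w.1 w'.1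

/-- Two framed points are related if one is a continuation of the other. -/
def Reach : X × (ℍ ≃ᵢ ℍ) → X × (ℍ ≃ᵢ ℍ) → Prop := Relation.ReflTransGen A.Step

/-- The position of a framed point in the hyperbolic plane. -/
noncomputable def dev (w : X × (ℍ ≃ᵢ ℍ)) : ℍ := w.2 (A.ψ w.1 w.1)

theorem transition_mul_symm {x y : X} (h : dist x y ≤ 4 * A.ρ) :
    A.transition x y * A.transition y x = 1 := by
  rw [A.transition_mul h (by rwa [dist_comm]) (by simpa using A.ρ_pos.le), transition_self]

theorem Step.symm {w w' : X × (ℍ ≃ᵢ ℍ)} (h : A.Step w w') : A.Step w' w := by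
  refine ⟨by rw [dist_comm]; exact h.1, ?_⟩
  rw [h.2, mul_assoc, A.transition_mul_symm (by linarith [h.1, A.ρ_pos]), mul_one]

theorem Reach.symm {w w' : X × (ℍ ≃ᵢ ℍ)} (h : A.Reach w w') : A.Reach w' w := by
  have : Std.Symm A.Step := ⟨fun _ _ h => Step.symm A h⟩
  exact Relation.ReflTransGen.stdSymm.symm _ _ h

/-- A continuation to `y` is placed exactly where the original chart about `x` already places `y`.
-/
theorem dev_transition {x y : X} (g : ℍ ≃ᵢ ℍ) (hxy : dist x y ≤ 4 * A.ρ) :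
    A.dev (y, g * A.transition x y) = g (A.ψ x y) := by
  have hρ := A.ρ_pos
  simp only [dev, IsometryEquiv.mul_apply]
  rw [A.transition_apply hxy (by rw [dist_comm]; linarith) (by simpa using hρ)]

theorem dist_dev_transition {x y : X} (g : ℍ ≃ᵢ ℍ) (hxy : dist x y ≤ 4 * A.ρ) :
    dist (A.dev (x, g)) (A.dev (y, g * A.transition x y)) = dist x y := by
  have hρ := A.ρ_pos
  rw [A.dev_transition g hxy, dev, g.dist_eq,
    A.dist_ψ (by simpa using hρ) (by rw [dist_comm]; linarith)]

theorem exists_chain_of_reach {w w' : X × (ℍ ≃ᵢ ℍ)} (h : A.Reach w w') :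
    ∃ (N : ℕ) (x : ℕ → X), A.IsChain x N ∧ x 0 = w.1 ∧ x N = w'.1 ∧ w'.2 = w.2 * A.hol x N := by
  induction h with
  | refl => exact ⟨0, fun _ => w.1, fun i hi => by omega, rfl, rfl, by simp [hol]⟩
  | @tail b c _ hbc ih =>
    obtain ⟨N, x, h1, h2, h3, h4⟩ := ih
    have e : ∀ i ≤ N, (fun i => if i ≤ N then x i else c.1) i = x i := fun i hi => if_pos hi
    have e' : (fun i => if i ≤ N then x i else c.1) (N + 1) = c.1 := if_neg (by omega)
    refine ⟨N + 1, fun i => if i ≤ N then x i else c.1, fun i hi => ?_, ?_, e', ?_⟩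
    · rw [e i (by omega)]
      rcases (Nat.lt_succ_iff.1 hi).lt_or_eq with h | rfl
      · rw [e _ h]
        exact h1 i h
      · rw [e', h3]
        exact hbc.1
    · rw [e 0 (by omega), h2]
    · rw [hol, A.hol_congr e, hbc.2, h4, mul_assoc, ← h3]
      exact congrArg₂ (fun a b => w.2 * (A.hol x N * A.transition a b)) (e N le_rfl).symm e'.symm

/-- Two different framed points one of which is a continuation of the other are joined by an
equally spaced chain whose development is straight. -/
theorem exists_straight_chain [CompactSpace X] {w w' : X × (ℍ ≃ᵢ ℍ)} (h : A.Reach w w')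
    (hne : w ≠ w') : ∃ (N : ℕ) (ℓ : ℝ) (W : ℕ → X × (ℍ ≃ᵢ ℍ)) (γ : ℝ → ℍ), 0 < N ∧ 0 < ℓ ∧
      ℓ ≤ A.ρ ∧ W 0 = w ∧ W N = w' ∧ (∀ i < N, A.Step (W i) (W (i + 1))) ∧
      (∀ i < N, dist (W i).1 (W (i + 1)).1 = ℓ) ∧ Isometry γ ∧
      ∀ i ≤ N, A.dev (W i) = γ (i * ℓ) := by
  have hρ := A.ρ_pos
  obtain ⟨N, x, hx, hx0, hxN, hw'⟩ := A.exists_chain_of_reach h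
  obtain ⟨y, hy, hy0, hyN, hyh, hmin⟩ := A.exists_energy_min hx
  have hmid : ∀ i, i + 1 < N → dist (y i) (y (i + 1)) = dist (y (i + 1)) (y (i + 2)) ∧
      dist (y i) (y (i + 2)) = 2 * dist (y i) (y (i + 1)) := fun i hi =>
    A.eq_of_energy_min hy (fun z h1 h2 h3 h4 => hmin z h1 (h2.trans hy0) (h3.trans hyN)
      (h4.trans hyh)) hi
  have hconst : ∀ i < N, dist (y i) (y (i + 1)) = dist (y 0) (y 1) := by
    intro i
    induction i with
    | zero => intro _; rfl
    | succ i ih => intro hi; rw [← ih (by omega), (hmid i hi).1]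
  set W : ℕ → X × (ℍ ≃ᵢ ℍ) := fun i => (y i, w.2 * A.hol y i) with hW
  have hW0 : W 0 = w := by simp [hW, hol, hy0, hx0]
  have hWN : W N = w' := by simp [hW, hyN, hxN, hyh, ← hw']
  have hstep : ∀ i < N, A.Step (W i) (W (i + 1)) := fun i hi => ⟨hy i hi, by
    simp [hW, hol, mul_assoc]⟩
  have hN : 0 < N := by
    rcases Nat.eq_zero_or_pos N with rfl | h
    · exact absurd (hW0.symm.trans hWN) hne
    · exact h
  -- With zero spacing the chain is constant and all transitions are trivial, so the two framed
  -- points would coincide.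
  have hℓ : 0 < dist (y 0) (y 1) := by
    refine lt_of_le_of_ne dist_nonneg fun h0 => hne ?_
    have : ∀ i ≤ N, W i = W 0 := by
      intro i
      induction i with
      | zero => intro _; rfl
      | succ i ih =>
        intro hi
        have hyy : y i = y (i + 1) := dist_eq_zero.1 ((hconst i hi).trans h0.symm)
        rw [← ih (by omega)]
        simp only [hW, hol, ← hyy, transition_self, mul_one]
    rw [← hW0, ← hWN, this N le_rfl]
  have hd1 : ∀ i < N, dist (A.dev (W i)) (A.dev (W (i + 1))) = dist (y 0) (y 1) := by
    intro i hi
    rw [← hconst i hi]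
    have := A.dist_dev_transition (w.2 * A.hol y i) (x := y i) (y := y (i + 1))
      (by linarith [hy i hi])
    simpa [hW, hol, mul_assoc] using this
  -- Two consecutive steps compose to one transition, so the midpoint property in `X` passes to the
  -- developed points.
  have hd2 : ∀ i, i + 1 < N → dist (A.dev (W i)) (A.dev (W (i + 2))) = 2 * dist (y 0) (y 1) := by
    intro i hi
    have h1 := hy i (by omega)
    have h2 : dist (y (i + 1)) (y (i + 2)) ≤ A.ρ := hy (i + 1) hi
    have h3 := dist_triangle (y i) (y (i + 1)) (y (i + 2))
    rw [← hconst i (by omega), ← (hmid i hi).2]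
    have := A.dist_dev_transition (w.2 * A.hol y i) (x := y i) (y := y (i + 2)) (by linarith)
    rw [← A.transition_mul (y := y (i + 1)) (by linarith) (by linarith) (by linarith)] at this
    simpa [hW, hol, mul_assoc] using this
  obtain ⟨γ, hγ, hγW⟩ := exists_line_of_midpoint_chain (P := fun i => A.dev (W i)) hℓ hN hd1 hd2
  exact ⟨N, dist (y 0) (y 1), W, γ, hN, hℓ, hy 0 hN, hW0, hWN, hstep, hconst, hγ, hγW⟩

/-- Different continuations would be joined by a straight development of positive length, whose ends
differ. -/
theorem dev_injOn_reach [CompactSpace X] {w w' : X × (ℍ ≃ᵢ ℍ)} (h : A.Reach w w')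
    (hdev : A.dev w = A.dev w') : w = w' := by
  by_contra hne
  obtain ⟨N, ℓ, W, γ, hN, hℓ, -, hW0, hWN, -, -, hγ, hγW⟩ := A.exists_straight_chain h hne
  rw [← hW0, ← hWN, hγW 0 (by omega), hγW N le_rfl] at hdev
  have h0 := hγ.injective hdev
  have hN' : (0 : ℝ) < N := by exact_mod_cast hN
  rw [Nat.cast_zero, zero_mul] at h0
  exact (mul_pos hN' hℓ).ne h0

/-- A continuation whose development is near is the direct continuation. -/
theorem eq_transition_of_dist_dev_lt [CompactSpace X] {w w' : X × (ℍ ≃ᵢ ℍ)} (h : A.Reach w w')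
    (hd : dist (A.dev w) (A.dev w') < A.ρ) :
    dist w.1 w'.1 < A.ρ ∧ w'.2 = w.2 * A.transition w.1 w'.1 := by
  have hρ := A.ρ_pos
  rcases eq_or_ne w w' with rfl | hne
  · rw [dist_self, transition_self, mul_one]
    exact ⟨hρ, rfl⟩
  obtain ⟨N, ℓ, W, γ, hN, hℓ, hℓρ, hW0, hWN, hstep, hdist, hγ, hγW⟩ := A.exists_straight_chain h hne
  -- A straight chain is as long as the distance of its developed ends, so the whole chain stays
  -- near its start and all its transitions collapse to one.
  have hNℓ : N * ℓ < A.ρ := by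
    rw [← hW0, ← hWN, hγW 0 (by omega), hγW N le_rfl, hγ.dist_eq, Real.dist_eq, abs_sub_comm] at hd
    simpa using (le_abs_self _).trans_lt hd
  have key : ∀ i ≤ N, dist (W 0).1 (W i).1 ≤ i * ℓ ∧
      (W i).2 = (W 0).2 * A.transition (W 0).1 (W i).1 := by
    intro i
    induction i with
    | zero => intro _; simp [transition_self]
    | succ i ih =>
      intro hi
      obtain ⟨h1, h2⟩ := ih (by omega)
      have h3 := hdist i hi
      have h4 := dist_triangle (W 0).1 (W i).1 (W (i + 1)).1
      have h5 : ((i + 1 : ℕ) : ℝ) * ℓ ≤ N * ℓ := by gcongr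
      have h6 : ((i + 1 : ℕ) : ℝ) * ℓ = i * ℓ + ℓ := by push_cast; ring
      refine ⟨by linarith, ?_⟩
      rw [(hstep i hi).2, h2, mul_assoc, A.transition_mul (by linarith) (by linarith) (by linarith)]
  obtain ⟨h1, h2⟩ := key N le_rfl
  rw [hW0, hWN] at h1 h2
  exact ⟨by linarith, h2⟩

/-- The set of positions of the continuations of a framed point. -/
def devSet (w : X × (ℍ ≃ᵢ ℍ)) : Set ℍ := {p | ∃ w', A.Reach w w' ∧ A.dev w' = p}

/-- The geodesic between two positions is the development of a straight chain; each piece between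
consecutive chain points lies in the convex model of one chart. -/
theorem convex_devSet [CompactSpace X] (w : X × (ℍ ≃ᵢ ℍ)) :
    GeodesicallyConvex (A.devSet w) := by
  have hρ := A.ρ_pos
  rintro p ⟨w₁, hw₁, rfl⟩ q ⟨w₂, hw₂, rfl⟩ r hr
  rcases eq_or_ne w₁ w₂ with rfl | hne
  · rw [dist_self, dist_comm r] at hr
    have : A.dev w₁ = r := dist_eq_zero.1 (by linarith [dist_nonneg (x := A.dev w₁) (y := r)])
    exact ⟨w₁, hw₁, this⟩
  obtain ⟨N, ℓ, W, γ, hN, hℓ, hℓρ, hW0, hWN, hstep, hdist, hγ, hγW⟩ :=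
    A.exists_straight_chain ((Reach.symm A hw₁).trans hw₂) hne
  have hreach : ∀ i ≤ N, A.Reach w (W i) := by
    intro i
    induction i with
    | zero => intro _; rwa [hW0]
    | succ i ih => intro hi; exact (ih (by omega)).tail (hstep i hi)
  have hp : A.dev w₁ = γ 0 := by rw [← hW0, hγW 0 (by omega)]; simp
  have hq : A.dev w₂ = γ (N * ℓ) := by rw [← hWN, hγW N le_rfl]
  have hN' : (0 : ℝ) < N := by exact_mod_cast hN
  have hNℓ := mul_pos hN' hℓ
  set t := dist (A.dev w₁) r with ht
  have ht0 : 0 ≤ t := dist_nonneg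
  have hrq : 0 ≤ dist r (A.dev w₂) := dist_nonneg
  have hd : dist (A.dev w₁) (A.dev w₂) = N * ℓ := by
    rw [hp, hq, hγ.dist_eq, Real.dist_eq, zero_sub, abs_neg, abs_of_pos hNℓ]
  rw [hd] at hr
  have hrγ : r = γ t := by
    refine eq_of_isometry_line hγ hNℓ.ne ?_ ?_
    · rw [← hp, sub_zero, abs_of_nonneg ht0]
    · rw [← hq, dist_comm, abs_sub_comm, abs_of_nonneg (by linarith)]
      linarith
  rcases (show t ≤ N * ℓ by linarith).lt_or_eq with htN | htN
  swap
  · exact ⟨w₂, hw₂, by rw [hrγ, htN, hq]⟩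
  -- Index of the chain piece containing `r`; the case `t = N * ℓ` was removed so that step `i`
  -- exists.
  set i := ⌊t / ℓ⌋₊ with hi
  have hi1 : i * ℓ ≤ t := (le_div_iff₀ hℓ).1 (Nat.floor_le (by positivity))
  have hi2 : t < (i + 1) * ℓ := (div_lt_iff₀ hℓ).1 (Nat.lt_floor_add_one _)
  have hiN : i < N := by
    have : (i : ℝ) < N := lt_of_mul_lt_mul_right (hi1.trans_lt htN) hℓ.le
    exact_mod_cast this
  have hs := hstep i hiN
  set x := (W i).1 with hx
  set g := (W i).2 with hg
  have hWi : W i = (x, g) := rfl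
  have hWi' : W (i + 1) = ((W (i + 1)).1, g * A.transition x (W (i + 1)).1) :=
    Prod.ext rfl hs.2
  have hdist' : dist x (W (i + 1)).1 = ℓ := hdist i hiN
  have d1 : A.dev (W i) = g (A.ψ x x) := rfl
  have d2 : A.dev (W (i + 1)) = g (A.ψ x (W (i + 1)).1) := by
    rw [hWi']
    exact A.dev_transition g (by linarith)
  have d3 : dist r (g (A.ψ x x)) = t - i * ℓ := by
    rw [← d1, hγW i hiN.le, hrγ, hγ.dist_eq, Real.dist_eq, abs_of_nonneg (by linarith)]
  have hmem : r ∈ g '' A.C x := by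
    refine ((A.convex x).image_isometryEquiv g) (g (A.ψ x x)) (mem_image_of_mem _ (A.ψ_mem ?_))
      (g (A.ψ x (W (i + 1)).1)) (mem_image_of_mem _ (A.ψ_mem ?_)) r ?_
    · simpa using hρ
    · rw [dist_comm]
      linarith
    · have h1 : ((i + 1 : ℕ) : ℝ) * ℓ = (i + 1) * ℓ := by push_cast; ring
      rw [← d1, ← d2, hγW i hiN.le, hγW (i + 1) hiN, hrγ, dist_line hγ hi1,
        dist_line hγ (by linarith), dist_line hγ (by linarith)]
      ring
  obtain ⟨c, hc, hcr⟩ := hmem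
  rw [← hcr, g.dist_eq] at d3
  obtain ⟨z, hz, rfl⟩ := A.exists_ψ_eq hc (by linarith)
  have hxz : dist x z ≤ A.ρ := by
    rw [dist_comm]
    linarith
  exact ⟨(z, g * A.transition x z), (hreach i hiN.le).tail ⟨hxz, rfl⟩,
    (A.dev_transition g (by linarith)).trans hcr⟩

end UniformAtlas

/-- Every point of a compact hyperbolic surface with convex boundary lies in the image of a locally
isometric map defined on a convex set in the hyperbolic plane, isometric on balls of a fixed
radius. -/
theorem IsConvexHyperbolicSurface.exists_developed_cover [CompactSpace X]
    (hX : IsConvexHyperbolicSurface X) (x₀ : X) : ∃ (ρ : ℝ) (K : Set ℍ) (π : ℍ → X), 0 < ρ ∧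
      GeodesicallyConvex K ∧ (interior K).Nonempty ∧ (∃ p ∈ K, π p = x₀) ∧
      ∀ p ∈ K, (∀ q ∈ K ∩ Metric.ball p ρ, ∀ r ∈ K ∩ Metric.ball p ρ,
        dist (π q) (π r) = dist q r) ∧ π '' (K ∩ Metric.ball p ρ) = Metric.ball (π p) ρ := by
  classical
  obtain ⟨A⟩ := hX.nonempty_uniformAtlas
  have hρ := A.ρ_pos
  set w₀ : X × (ℍ ≃ᵢ ℍ) := (x₀, 1) with hw₀
  set π : ℍ → X := fun p => if h : ∃ w, A.Reach w₀ w ∧ A.dev w = p then h.choose.1 else x₀ with hπ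
  have hπdev : ∀ w, A.Reach w₀ w → π (A.dev w) = w.1 := by
    intro w hw
    have h : ∃ w', A.Reach w₀ w' ∧ A.dev w' = A.dev w := ⟨w, hw, rfl⟩
    have : π (A.dev w) = h.choose.1 := dif_pos h
    rw [this, A.dev_injOn_reach ((UniformAtlas.Reach.symm A h.choose_spec.1).trans hw)
      h.choose_spec.2]
  have hball : ∀ w, A.Reach w₀ w → ∀ y, dist y w.1 < A.ρ →
      w.2 (A.ψ w.1 y) ∈ A.devSet w₀ ∧ π (w.2 (A.ψ w.1 y)) = y := by
    intro w hw y hy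
    have hy' : dist w.1 y ≤ A.ρ := by rw [dist_comm]; exact hy.le
    have hr : A.Reach w₀ (y, w.2 * A.transition w.1 y) := hw.tail ⟨hy', rfl⟩
    rw [← A.dev_transition w.2 (by linarith)]
    exact ⟨⟨_, hr, rfl⟩, hπdev _ hr⟩
  have hlocal : ∀ w, A.Reach w₀ w → ∀ q ∈ A.devSet w₀ ∩ Metric.ball (A.dev w) A.ρ,
      dist (π q) w.1 < A.ρ ∧ q = w.2 (A.ψ w.1 (π q)) := by
    rintro w hw q ⟨⟨w', hw', rfl⟩, hq⟩
    rw [Metric.mem_ball, dist_comm] at hq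
    obtain ⟨h1, h2⟩ := A.eq_transition_of_dist_dev_lt
      ((UniformAtlas.Reach.symm A hw).trans hw') hq
    rw [hπdev _ hw']
    refine ⟨by rwa [dist_comm], ?_⟩
    rw [← A.dev_transition w.2 (by linarith), ← h2]
  have hw₀r : A.Reach w₀ w₀ := Relation.ReflTransGen.refl
  refine ⟨A.ρ, A.devSet w₀, π, hρ, A.convex_devSet w₀, ?_, ⟨A.dev w₀, ⟨w₀, hw₀r, rfl⟩,
    hπdev _ hw₀r⟩, ?_⟩
  · refine (A.interior_image_ball_nonempty x₀ (r := A.ρ) hρ (by linarith)).mono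
      (interior_mono ?_)
    rintro _ ⟨y, hy, rfl⟩
    exact (hball w₀ hw₀r y hy).1
  · rintro _ ⟨w, hw, rfl⟩
    constructor
    · intro q hq r hr
      obtain ⟨q1, q2⟩ := hlocal w hw q hq
      obtain ⟨r1, r2⟩ := hlocal w hw r hr
      rw [← A.dist_ψ (x := w.1) (by linarith) (by linarith), ← w.2.dist_eq, ← q2, ← r2]
    · rw [hπdev w hw]
      ext y
      constructor
      · rintro ⟨q, hq, rfl⟩
        exact (hlocal w hw q hq).1
      · intro hy
        rw [Metric.mem_ball] at hy
        refine ⟨_, ⟨(hball w hw y hy).1, ?_⟩, (hball w hw y hy).2⟩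
        rw [Metric.mem_ball, UniformAtlas.dev, w.2.dist_eq,
          A.dist_ψ (by linarith) (by simpa using hρ)]
        exact hy

end

end ConvexHyperbolic

/-! ### The covering by a convex set and its boundary -/

namespace ConvexHyperbolic

open UpperHalfPlane

/-! ### Locally isometric coverings -/

/-- A map that is isometric on balls of a fixed radius and maps them onto balls of the same radius
is a covering map. -/
theorem isCoveringMap_of_isometric_balls {E X : Type*} [MetricSpace E] [MetricSpace X] {p : E → X}
    {ρ : ℝ} (hρ : 0 < ρ) (hiso : ∀ e, ∀ a ∈ Metric.ball e ρ, ∀ b ∈ Metric.ball e ρ,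
      dist (p a) (p b) = dist a b)
    (hsurj : ∀ e, p '' Metric.ball e ρ = Metric.ball (p e) ρ) : IsCoveringMap p := by
  have hiso' : ∀ a b, dist a b < ρ → dist (p a) (p b) = dist a b := fun a b h =>
    hiso b a h b (Metric.mem_ball_self hρ)
  have hsep : ∀ a b, p a = p b → dist a b < ρ → a = b := fun a b h hd => by
    rw [← dist_eq_zero, ← hiso' a b hd, h, dist_self]
  have hlift : ∀ e x, dist x (p e) < ρ → ∃ e', p e' = x ∧ dist e' e = dist x (p e) := by
    intro e x hx
    have : x ∈ p '' Metric.ball e ρ := by rw [hsurj]; exact hx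
    obtain ⟨e', he', rfl⟩ := this
    exact ⟨e', rfl, (hiso' _ _ he').symm⟩
  have hcont : Continuous p := by
    refine Metric.continuous_iff.2 fun e ε hε => ⟨min ε ρ, lt_min hε hρ, fun a ha => ?_⟩
    rw [hiso' a e (ha.trans_le (min_le_right _ _))]
    exact ha.trans_le (min_le_left _ _)
  intro x
  -- Points of one fibre closer than `ρ` coincide, so the balls of radius `ρ / 4` about the fibre
  -- points are disjoint sheets over `U`.
  set U := Metric.ball x (ρ / 4) with hU
  have hdisc : DiscreteTopology (p ⁻¹' {x}) := by
    rw [discreteTopology_iff_isOpen_singleton]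
    intro e
    refine Metric.isOpen_iff.2 fun e' he' => ⟨ρ, hρ, fun a ha => ?_⟩
    rw [mem_singleton_iff] at he' ⊢
    subst he'
    exact Subtype.ext (hsep _ _ (a.2.trans e'.2.symm) ha)
  have hfoot : ∀ e : p ⁻¹' U, ∃ i : p ⁻¹' {x}, dist (i : E) e < ρ / 4 := fun e => by
    have he : dist (p e) x < ρ / 4 := e.2
    obtain ⟨e', h1, h2⟩ := hlift e x (by rw [dist_comm]; linarith)
    exact ⟨⟨e', h1⟩, by rw [h2, dist_comm]; exact he⟩
  choose foot hfoot using hfoot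
  have hsec : ∀ u : U × p ⁻¹' {x}, ∃ e : p ⁻¹' U, p e = u.1 ∧ dist (e : E) u.2 < ρ / 4 := fun u => by
    have hu : dist (u.1 : X) x < ρ / 4 := u.1.2
    have hx : p u.2 = x := u.2.2
    obtain ⟨e', h1, h2⟩ := hlift u.2 u.1 (by rw [hx]; linarith)
    refine ⟨⟨e', ?_⟩, h1, by rw [h2, hx]; exact hu⟩
    rw [mem_preimage, h1]
    exact u.1.2
  choose sec hsec₁ hsec₂ using hsec
  refine ⟨hdisc, U, Metric.mem_ball_self (by positivity), Metric.isOpen_ball,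
    Metric.isOpen_ball.preimage hcont, ⟨⟨fun e => (⟨p e, e.2⟩, foot e), sec, ?_, ?_⟩, ?_, ?_⟩,
    fun _ => rfl⟩
  · intro e
    refine Subtype.ext (hsep _ _ (hsec₁ _) ?_)
    have h1 := hsec₂ (⟨p e, e.2⟩, foot e)
    have h2 := hfoot e
    have h3 := dist_triangle (sec (⟨p e, e.2⟩, foot e) : E) (foot e) e
    dsimp only at h1
    linarith
  · intro u
    refine Prod.ext (Subtype.ext (hsec₁ u)) (Subtype.ext (hsep _ _ ?_ ?_))
    · exact (foot (sec u)).2.trans u.2.2.symm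
    · have h1 := hsec₂ u
      have h2 := hfoot (sec u)
      have h3 := dist_triangle (foot (sec u) : E) (sec u) u.2
      dsimp only
      linarith
  · refine Continuous.prodMk ((hcont.comp continuous_subtype_val).subtype_mk _) ?_
    refine (IsLocallyConstant.iff_exists_open _).2 (fun e => ⟨Metric.ball e (ρ / 2),
      Metric.isOpen_ball, Metric.mem_ball_self (by positivity), fun a ha => ?_⟩) |>.continuous
    refine Subtype.ext (hsep _ _ ((foot a).2.trans (foot e).2.symm) ?_)
    have h1 := hfoot a
    have h2 := hfoot e
    have h3 : dist (a : E) e < ρ / 2 := ha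
    have h4 := dist_triangle4 (foot a : E) a e (foot e)
    rw [dist_comm (e : E)] at h4
    linarith
  · refine continuous_prod_of_discrete_right.2 fun i => Isometry.continuous
      (Isometry.of_dist_eq fun u v => ?_)
    have h1 := hsec₂ (u, i)
    have h2 := hsec₂ (v, i)
    have := hiso i (sec (u, i)) (by rw [Metric.mem_ball]; dsimp only at h1; linarith) (sec (v, i))
      (by rw [Metric.mem_ball]; dsimp only at h2; linarith)
    rw [hsec₁, hsec₁] at this
    exact this.symm

section

variable (X : Type*) [MetricSpace X]

/-- A locally isometric covering of part of `X` by a convex subset of the hyperbolic plane. -/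
structure DevelopedCover where
  /-- The covering convex set. -/
  K : Set ℍ
  convex : GeodesicallyConvex K
  interior_nonempty : (interior K).Nonempty
  /-- The covering map, relevant on `K` only. -/
  π : ℍ → X
  /-- The radius of the balls on which the covering map is isometric. -/
  ρ : ℝ
  ρ_pos : 0 < ρ
  isometric : ∀ p ∈ K, ∀ q ∈ K ∩ Metric.ball p ρ, ∀ r ∈ K ∩ Metric.ball p ρ,
    dist (π q) (π r) = dist q r
  image_ball : ∀ p ∈ K, π '' (K ∩ Metric.ball p ρ) = Metric.ball (π p) ρ

variable {X}

theorem IsConvexHyperbolicSurface.exists_developedCover [CompactSpace X]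
    (hX : IsConvexHyperbolicSurface X) (x₀ : X) :
    ∃ D : DevelopedCover X, ∃ p ∈ D.K, D.π p = x₀ := by
  obtain ⟨ρ, K, π, h1, h2, h3, h4, h5⟩ := hX.exists_developed_cover x₀
  exact ⟨⟨K, h2, h3, π, ρ, h1, fun p hp => (h5 p hp).1, fun p hp => (h5 p hp).2⟩, h4⟩

namespace DevelopedCover

variable (D : DevelopedCover X)

theorem isCoveringMap : IsCoveringMap fun p : D.K => D.π p := by
  refine isCoveringMap_of_isometric_balls D.ρ_pos (fun e a ha b hb =>
    D.isometric e e.2 a ⟨a.2, ha⟩ b ⟨b.2, hb⟩) fun e => ?_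
  rw [← D.image_ball e e.2]
  ext x
  constructor
  · rintro ⟨a, ha, rfl⟩
    exact ⟨a, ⟨a.2, ha⟩, rfl⟩
  · rintro ⟨a, ⟨ha, ha'⟩, rfl⟩
    exact ⟨⟨a, ha⟩, ha', rfl⟩

/-- The inverse of the covering map near a point is an isometric chart. -/
theorem exists_chart {p : ℍ} (hp : p ∈ D.K) : ∃ φ : X → ℍ,
    LeftInvOn φ D.π (D.K ∩ Metric.ball p D.ρ) ∧ IsIsometricChart D.K (D.π p) D.ρ φ := by
  set S := D.K ∩ Metric.ball p D.ρ with hS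
  have hinj : InjOn D.π S := fun q hq r hr h => by
    rw [← dist_eq_zero, ← D.isometric p hp q hq r hr, h, dist_self]
  have hleft := hinj.leftInvOn_invFunOn
  have hpS : p ∈ S := ⟨hp, Metric.mem_ball_self D.ρ_pos⟩
  refine ⟨Function.invFunOn D.π S, hleft, ?_, ?_⟩
  · rw [← D.image_ball p hp]
    rintro _ ⟨q, hq, rfl⟩ _ ⟨r, hr, rfl⟩
    rw [hleft hq, hleft hr, D.isometric p hp q hq r hr]
  · rw [hleft hpS, ← D.image_ball p hp, hleft.image_image]

/-- A disc chart and the local inverse of `π` differ by an isometry of the plane, so `K` contains a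
full disc about `p` whenever `π p` has a disc chart. The converse restricts the local inverse of
`π`. -/
theorem mem_surfaceBoundary_iff {p : ℍ} (hp : p ∈ D.K) :
    D.π p ∈ surfaceBoundary X ↔ p ∉ interior D.K := by
  obtain ⟨φ, hφl, hφ⟩ := D.exists_chart hp
  have hφp : φ (D.π p) = p := hφl ⟨hp, Metric.mem_ball_self D.ρ_pos⟩
  rw [surfaceBoundary, mem_ofPred_eq, not_iff_not]
  constructor
  · rintro ⟨ε, hε, χ, hχ⟩
    have : Nonempty X := ⟨D.π p⟩
    set r := min ε D.ρ with hr
    have hr0 : 0 < r := lt_min hε D.ρ_pos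
    have hφr := hφ.restrict (y := D.π p) hr0 (by simp [hr])
    have hχr := hχ.restrict (y := D.π p) hr0 (by simp [hr])
    set B := Metric.ball (D.π p) r with hB
    have hpB : D.π p ∈ B := Metric.mem_ball_self hr0
    have hinj : InjOn χ B := fun a ha b hb h => by
      rw [← dist_eq_zero, ← hχr.1 a ha b hb, h, dist_self]
    have hleft := hinj.leftInvOn_invFunOn
    have himg : χ '' B = Metric.ball (χ (D.π p)) r := by rw [hχr.2, univ_inter]
    obtain ⟨g, hg⟩ := exists_isometryEquiv_extension (S := χ '' B)
      (f := fun z => φ (Function.invFunOn χ B z)) (by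
        rw [himg, Metric.isOpen_ball.interior_eq]
        exact ⟨_, Metric.mem_ball_self hr0⟩) (by
        rintro _ ⟨a, ha, rfl⟩ _ ⟨b, hb, rfl⟩
        rw [hleft ha, hleft hb, hφr.1 a ha b hb, hχr.1 a ha b hb])
    have hgχ : ∀ a ∈ B, g (χ a) = φ a := fun a ha => by
      rw [hg _ (mem_image_of_mem _ ha), hleft ha]
    refine mem_interior.2 ⟨Metric.ball p r, fun q hq => ?_, Metric.isOpen_ball,
      Metric.mem_ball_self hr0⟩
    have hq' : g.symm q ∈ χ '' B := by
      rw [himg, Metric.mem_ball, ← g.dist_eq, g.apply_symm_apply, hgχ _ hpB, hφp]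
      exact hq
    obtain ⟨a, ha, haq⟩ := hq'
    have : q = φ a := by rw [← hgχ a ha, haq, g.apply_symm_apply]
    rw [this]
    exact (hφr.2 ▸ mem_image_of_mem φ ha : φ a ∈ D.K ∩ _).1
  · intro hint
    obtain ⟨ε, hε, hball⟩ := Metric.isOpen_iff.1 isOpen_interior p hint
    have hr0 : 0 < min ε D.ρ := lt_min hε D.ρ_pos
    have hφr := hφ.restrict (y := D.π p) hr0 (by simp)
    refine ⟨min ε D.ρ, hr0, φ, hφr.1, ?_⟩
    rw [hφr.2, univ_inter, inter_eq_right, hφp]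
    exact (Metric.ball_subset_ball (min_le_left _ _)).trans (hball.trans interior_subset)

/-- A lift of a geodesic path is part of a geodesic line. -/
theorem exists_line_of_lift {s : ℝ → X} {a b : ℝ} (hs : IsGeodesicPath s a b) {σ : ℝ → ℍ}
    (hσ : ContinuousOn σ (Icc a b)) (hK : ∀ τ ∈ Icc a b, σ τ ∈ D.K)
    (hπ : ∀ τ ∈ Icc a b, D.π (σ τ) = s τ) :
    ∃ γ : ℝ → ℍ, Isometry γ ∧ ∀ τ ∈ Icc a b, σ τ = γ τ := by
  refine IsGeodesicPath.exists_line ⟨hs.1, fun τ hτ => ?_⟩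
  obtain ⟨δ, hδ, hiso⟩ := hs.2 τ hτ
  obtain ⟨η, hη, hcont⟩ := Metric.continuousWithinAt_iff.1 (hσ τ hτ) D.ρ D.ρ_pos
  refine ⟨min δ η, lt_min hδ hη, fun u hu v hv huτ hvτ => ?_⟩
  rw [← hiso u hu v hv (huτ.trans_le (min_le_left _ _)) (hvτ.trans_le (min_le_left _ _)),
    ← hπ u hu, ← hπ v hv]
  exact (D.isometric (σ τ) (hK τ hτ) (σ u) ⟨hK u hu, hcont hu
    (by rw [Real.dist_eq]; exact huτ.trans_le (min_le_right _ _))⟩ (σ v) ⟨hK v hv, hcont hv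
    (by rw [Real.dist_eq]; exact hvτ.trans_le (min_le_right _ _))⟩).symm

end DevelopedCover

end

end ConvexHyperbolic

/-! ### Turning of the difference vector and forced meetings of planar paths -/

namespace ConvexHyperbolic

open ComplexConjugate

/-! ### Continuous logarithms -/

theorem exists_continuous_log {F : ℝ × ℝ → ℂ} (hF : Continuous F) (h0 : ∀ z, F z ≠ 0) :
    ∃ L : ℝ × ℝ → ℂ, Continuous L ∧ ∀ z, Complex.exp (L z) = F z := by
  obtain ⟨L, ⟨-, hL⟩, -⟩ := Complex.isCoveringMapOn_exp.existsUnique_continuousMap_lifts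
    (A := ℝ × ℝ) ⟨F, hF⟩ (a₀ := 0) (e₀ := Complex.log (F 0)) (Complex.exp_log (h0 0)) h0
  exact ⟨L, L.continuous, fun z => congrFun hL z⟩

/-- Two continuous logarithms of one function on a connected space differ by a constant, by
uniqueness of lifts through `exp`. -/
theorem sub_eq_sub_of_exp_eq {A : Type*} [TopologicalSpace A] [PreconnectedSpace A] {L M : A → ℂ}
    (hL : Continuous L) (hM : Continuous M) (h : ∀ a, Complex.exp (L a) = Complex.exp (M a))
    (a b : A) : L a - M a = L b - M b := by
  have hc : Complex.exp (L b - M b) = 1 := by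
    rw [Complex.exp_sub, h, div_self (Complex.exp_ne_zero _)]
  have key : L = fun a => M a + (L b - M b) := by
    refine Complex.isCoveringMap_exp.eq_of_comp_eq hL (hM.add continuous_const) ?_ b (by ring)
    ext a
    simp only [Function.comp_apply]
    rw [Complex.exp_add, hc, mul_one, h]
  have := congrFun key a
  rw [this]
  ring

/-- The change of the argument along a path in a closed half-plane punctured at the origin. -/
theorem log_im_sub_of_half_plane {L : ℝ → ℂ} (hL : Continuous L) {n : ℂ} (hn : n ≠ 0)
    (h : ∀ t, 0 ≤ (conj n * Complex.exp (L t)).re) (s t : ℝ) :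
    (L t).im - (L s).im =
      (conj n * Complex.exp (L t)).arg - (conj n * Complex.exp (L s)).arg := by
  have hn' : conj n ≠ 0 := by simpa using hn
  have h0 : ∀ t, conj n * Complex.exp (L t) ≠ 0 := fun t => mul_ne_zero hn' (Complex.exp_ne_zero _)
  have hslit : ∀ t, conj n * Complex.exp (L t) ∈ Complex.slitPlane := by
    intro t
    rw [Complex.mem_slitPlane_iff]
    rcases (h t).lt_or_eq with h1 | h1
    · exact Or.inl h1
    · exact Or.inr fun h2 => h0 t (Complex.ext h1.symm h2)
  have hc : Continuous fun t => Complex.log (conj n * Complex.exp (L t)) :=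
    Continuous.clog (by fun_prop) hslit
  have := sub_eq_sub_of_exp_eq (L := fun t => L t + Complex.log (conj n)) (by fun_prop) hc
    (fun t => by rw [Complex.exp_add, Complex.exp_log hn', Complex.exp_log (h0 t), mul_comm]) t s
  have him := congrArg Complex.im this
  simp only [Complex.sub_im, Complex.add_im, Complex.log_im] at him
  linarith

theorem im_conj_mul_eq_sin (z w : ℂ) :
    (conj z * w).im = ‖z‖ * ‖w‖ * Real.sin (w.arg - z.arg) := by
  nth_rw 1 [← Complex.norm_mul_cos_add_sin_mul_I z, ← Complex.norm_mul_cos_add_sin_mul_I w]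
  rw [Real.sin_sub]
  simp only [map_mul, map_add, Complex.conj_ofReal, Complex.conj_I, Complex.mul_im, Complex.mul_re,
    Complex.add_re, Complex.add_im, Complex.ofReal_re, Complex.ofReal_im, Complex.I_re,
    Complex.I_im, ← Complex.ofReal_cos, ← Complex.ofReal_sin, Complex.neg_re, Complex.neg_im]
  ring

/-- Along a path in a closed half-plane punctured at the origin the argument increases if the
endpoints are positively oriented. -/
theorem log_im_lt_of_half_plane {L : ℝ → ℂ} (hL : Continuous L) {n : ℂ} (hn : n ≠ 0)
    (h : ∀ t, 0 ≤ (conj n * Complex.exp (L t)).re) {s t : ℝ}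
    (hpos : 0 < (conj (Complex.exp (L s)) * Complex.exp (L t)).im) : (L s).im < (L t).im := by
  have key := log_im_sub_of_half_plane hL hn h s t
  set z := conj n * Complex.exp (L s) with hz
  set w := conj n * Complex.exp (L t) with hw
  have hzw : 0 < (conj z * w).im := by
    have : conj z * w = (Complex.normSq n : ℂ) * (conj (Complex.exp (L s)) * Complex.exp (L t)) := by
      rw [hz, hw, map_mul, Complex.conj_conj, Complex.normSq_eq_conj_mul_self]
      ring
    rw [this, Complex.im_ofReal_mul]
    exact mul_pos (Complex.normSq_pos.2 hn) hpos
  rw [im_conj_mul_eq_sin] at hzw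
  -- Both arguments lie in `[-π/2, π/2]`, so their difference lies in `[-π, π]`, where a positive
  -- sine means a positive difference.
  have hsin : 0 < Real.sin (w.arg - z.arg) := pos_of_mul_pos_right hzw (by positivity)
  have h1 := abs_le.1 (Complex.abs_arg_le_pi_div_two_iff.2 (h s))
  have h2 := abs_le.1 (Complex.abs_arg_le_pi_div_two_iff.2 (h t))
  rw [← hz] at h1
  rw [← hw] at h2
  by_contra hle
  have : Real.sin (w.arg - z.arg) ≤ 0 :=
    Real.sin_nonpos_of_nonpos_of_neg_pi_le (by linarith) (by linarith)
  linarith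

/-! ### Paths in planar convex sets -/

/-- A separating functional for the open interior becomes an outward normal; the inequality extends
to `K`, which lies in the closure of its interior. -/
theorem exists_support {K : Set ℂ} (hK : Convex ℝ K) (hint : (interior K).Nonempty) {a : ℂ}
    (ha : a ∉ interior K) : ∃ n : ℂ, n ≠ 0 ∧ ∀ z ∈ K, 0 ≤ (conj n * (a - z)).re := by
  obtain ⟨f, hf⟩ := geometric_hahn_banach_open_point hK.interior isOpen_interior ha
  have hfn : ∀ z : ℂ, f z = (conj (⟨f 1, f Complex.I⟩ : ℂ) * z).re := by
    intro z
    have : z = z.re • (1 : ℂ) + z.im • Complex.I := by simp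
    rw [this, map_add, map_smul, map_smul]
    simp
    ring
  refine ⟨⟨f 1, f Complex.I⟩, ?_, ?_⟩
  · intro h0
    obtain ⟨c, hc⟩ := hint
    have := hf c hc
    rw [hfn c, hfn a, h0] at this
    simp at this
  · intro z hz
    rw [← hfn, map_sub, sub_nonneg]
    have hcl : z ∈ closure (interior K) := by
      rw [hK.closure_interior_eq_closure_of_nonempty_interior hint]
      exact subset_closure hz
    exact closure_minimal (fun y hy => (hf y hy).le)
      (isClosed_le f.continuous continuous_const) hcl

/-- Two paths in a planar convex set whose endpoints lie on the boundary and span crossing segments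
meet. -/
theorem paths_meet_of_crossing {K : Set ℂ} (hK : Convex ℝ K) (hint : (interior K).Nonempty)
    {f g : ℝ → ℂ} (hf : Continuous f) (hg : Continuous g) (hfK : ∀ t, f t ∈ K)
    (hgK : ∀ t, g t ∈ K) (hf0 : f 0 ∉ interior K) (hf1 : f 1 ∉ interior K)
    (hg0 : g 0 ∉ interior K) (hg1 : g 1 ∉ interior K) {l m : ℝ} (hl : l ∈ Ioo (0 : ℝ) 1)
    (hm : m ∈ Ioo (0 : ℝ) 1) (hlm : f 0 + l * (f 1 - f 0) = g 0 + m * (g 1 - g 0))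
    (hD : (conj (f 1 - f 0) * (g 1 - g 0)).im ≠ 0) : ∃ x y, f x = g y := by
  by_contra hne
  push Not at hne
  -- On each side of the unit square one of the two points is fixed at a boundary point of `K`, so
  -- `f x - g y` stays in a support half-plane there.
  obtain ⟨L, hL, hexp⟩ := exists_continuous_log (F := fun z => f z.1 - g z.2) (by fun_prop)
    fun z => sub_ne_zero.2 (hne z.1 z.2)
  obtain ⟨n₁, hn₁, h₁⟩ := exists_support hK hint hf0
  obtain ⟨n₂, hn₂, h₂⟩ := exists_support hK hint hg1
  obtain ⟨n₃, hn₃, h₃⟩ := exists_support hK hint hf1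
  obtain ⟨n₄, hn₄, h₄⟩ := exists_support hK hint hg0
  have e₁ : ∀ t, 0 ≤ (conj n₁ * Complex.exp (L (0, t))).re := fun t => by
    rw [hexp]; exact h₁ _ (hgK t)
  have e₂ : ∀ t, 0 ≤ (conj (-n₂) * Complex.exp (L (t, 1))).re := fun t => by
    rw [hexp, map_neg, neg_mul, ← mul_neg, neg_sub]; exact h₂ _ (hfK t)
  have e₃ : ∀ t, 0 ≤ (conj n₃ * Complex.exp (L (1, t))).re := fun t => by
    rw [hexp]; exact h₃ _ (hgK t)
  have e₄ : ∀ t, 0 ≤ (conj (-n₄) * Complex.exp (L (t, 0))).re := fun t => by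
    rw [hexp, map_neg, neg_mul, ← mul_neg, neg_sub]; exact h₄ _ (hfK t)
  have c₁ : Continuous fun t => L (0, t) := by fun_prop
  have c₂ : Continuous fun t => L (t, 1) := by fun_prop
  have c₃ : Continuous fun t => L (1, t) := by fun_prop
  have c₄ : Continuous fun t => L (t, 0) := by fun_prop
  have hre := congrArg Complex.re hlm
  have him := congrArg Complex.im hlm
  simp only [Complex.add_re, Complex.add_im, Complex.mul_re, Complex.mul_im, Complex.ofReal_re,
    Complex.ofReal_im, zero_mul, sub_zero, add_zero, Complex.sub_re, Complex.sub_im] at hre him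
  have hDeq : (conj (f 1 - f 0) * (g 1 - g 0)).im = ((f 1).re - (f 0).re) * ((g 1).im - (g 0).im) -
      ((f 1).im - (f 0).im) * ((g 1).re - (g 0).re) := by
    simp
    ring
  set D := (conj (f 1 - f 0) * (g 1 - g 0)).im
  -- At the corners consecutive differences have cross products `l * D`, `(1 - m) * D`, `(1 - l) *
  -- D`, `m * D`, all of one sign. So the argument moves the same way along all four sides, yet must
  -- return to its start.
  have d₁ : (conj (f 0 - g 0) * (f 0 - g 1)).im = l * D := by
    rw [hDeq]
    simp only [Complex.mul_im, map_sub, Complex.sub_re, Complex.sub_im, Complex.conj_re,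
      Complex.conj_im]
    linear_combination (-1 : ℝ) * ((g 1).im - (g 0).im) * hre + ((g 1).re - (g 0).re) * him
  have d₂ : (conj (f 0 - g 1) * (f 1 - g 1)).im = (1 - m) * D := by
    rw [hDeq]
    simp only [Complex.mul_im, map_sub, Complex.sub_re, Complex.sub_im, Complex.conj_re,
      Complex.conj_im]
    linear_combination ((f 1).im - (f 0).im) * hre - ((f 1).re - (f 0).re) * him
  have d₃ : (conj (f 1 - g 1) * (f 1 - g 0)).im = (1 - l) * D := by
    rw [hDeq]
    simp only [Complex.mul_im, map_sub, Complex.sub_re, Complex.sub_im, Complex.conj_re,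
      Complex.conj_im]
    linear_combination ((g 1).im - (g 0).im) * hre - ((g 1).re - (g 0).re) * him
  have d₄ : (conj (f 1 - g 0) * (f 0 - g 0)).im = m * D := by
    rw [hDeq]
    simp only [Complex.mul_im, map_sub, Complex.sub_re, Complex.sub_im, Complex.conj_re,
      Complex.conj_im]
    linear_combination -((f 1).im - (f 0).im) * hre + ((f 1).re - (f 0).re) * him
  have swap : ∀ a b : ℂ, (conj b * a).im = -(conj a * b).im := fun a b => by
    simp
    ring
  have m₁ := hl.1
  have m₂ := hl.2
  have m₃ := hm.1
  have m₄ := hm.2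
  rcases lt_or_gt_of_ne hD with hneg | hpos
  · have q₁ := log_im_lt_of_half_plane c₁ hn₁ e₁ (s := 1) (t := 0) (by
      rw [hexp, hexp, swap, d₁]; nlinarith)
    have q₂ := log_im_lt_of_half_plane c₂ (neg_ne_zero.2 hn₂) e₂ (s := 1) (t := 0) (by
      rw [hexp, hexp, swap, d₂]; nlinarith)
    have q₃ := log_im_lt_of_half_plane c₃ hn₃ e₃ (s := 0) (t := 1) (by
      rw [hexp, hexp, swap, d₃]; nlinarith)
    have q₄ := log_im_lt_of_half_plane c₄ (neg_ne_zero.2 hn₄) e₄ (s := 0) (t := 1) (by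
      rw [hexp, hexp, swap, d₄]; nlinarith)
    linarith
  · have q₁ := log_im_lt_of_half_plane c₁ hn₁ e₁ (s := 0) (t := 1) (by
      rw [hexp, hexp, d₁]; nlinarith)
    have q₂ := log_im_lt_of_half_plane c₂ (neg_ne_zero.2 hn₂) e₂ (s := 0) (t := 1) (by
      rw [hexp, hexp, d₂]; nlinarith)
    have q₃ := log_im_lt_of_half_plane c₃ hn₃ e₃ (s := 1) (t := 0) (by
      rw [hexp, hexp, d₃]; nlinarith)
    have q₄ := log_im_lt_of_half_plane c₄ (neg_ne_zero.2 hn₄) e₄ (s := 1) (t := 0) (by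
      rw [hexp, hexp, d₄]; nlinarith)
    linarith

/-- Two paths in a half-plane whose endpoints interlace on the boundary line meet. -/
theorem paths_meet_of_interlacing {n e a : ℂ} (hn : n ≠ 0) (he : e ≠ 0)
    (hne : (conj n * e).re = 0) {f g : ℝ → ℂ} (hf : Continuous f) (hg : Continuous g)
    (hfK : ∀ t, 0 ≤ (conj n * (a - f t)).re) (hgK : ∀ t, 0 ≤ (conj n * (a - g t)).re)
    {α β : ℝ} (hα : 0 < α) (hαβ : α < β) (hβ : β < 1) (hg0 : g 0 = a) (hf0 : f 0 = a + α * e)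
    (hg1 : g 1 = a + β * e) (hf1 : f 1 = a + e) : ∃ x y, f x = g y := by
  by_contra hcon
  push Not at hcon
  obtain ⟨L, hL, hexp⟩ := exists_continuous_log (F := fun z => f z.1 - g z.2) (by fun_prop)
    fun z => sub_ne_zero.2 (hcon z.1 z.2)
  obtain ⟨c, hc⟩ : ∃ c : ℝ, conj n * e = c * Complex.I :=
    ⟨(conj n * e).im, by apply Complex.ext <;> simp [hne]⟩
  have hc0 : c ≠ 0 := by
    rintro rfl
    simp [hn, he] at hc
  have hline : ∀ r : ℝ, (conj n * (r * e)).re = 0 := fun r => by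
    rw [mul_left_comm, hc]
    simp
  have e₁ : ∀ t, 0 ≤ (conj n * Complex.exp (L (0, t))).re := fun t => by
    rw [hexp]
    have h1 := hgK t
    have h2 := hline α
    have : conj n * (f 0 - g t) = conj n * (a - g t) + conj n * (α * e) := by rw [hf0]; ring
    dsimp only
    rw [this, Complex.add_re]
    linarith
  have e₂ : ∀ t, 0 ≤ (conj (-n) * Complex.exp (L (t, 1))).re := fun t => by
    rw [hexp]
    have h1 := hfK t
    have h2 := hline β
    have : conj (-n) * (f t - g 1) = conj n * (a - f t) + conj n * (β * e) := by
      rw [hg1, map_neg]; ring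
    dsimp only
    rw [this, Complex.add_re]
    linarith
  have e₃ : ∀ t, 0 ≤ (conj n * Complex.exp (L (1, t))).re := fun t => by
    rw [hexp]
    have h1 := hgK t
    have : conj n * (f 1 - g t) = conj n * (a - g t) + conj n * e := by rw [hf1]; ring
    dsimp only
    rw [this, Complex.add_re]
    linarith
  have e₄ : ∀ t, 0 ≤ (conj (-n) * Complex.exp (L (t, 0))).re := fun t => by
    rw [hexp]
    have h1 := hfK t
    have : conj (-n) * (f t - g 0) = conj n * (a - f t) := by rw [hg0, map_neg]; ring
    dsimp only
    rwa [this]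
  have q₁ := log_im_sub_of_half_plane (L := fun t => L (0, t)) (by fun_prop) hn e₁ 0 1
  have q₂ := log_im_sub_of_half_plane (L := fun t => L (t, 1)) (by fun_prop) (neg_ne_zero.2 hn)
    e₂ 0 1
  have q₃ := log_im_sub_of_half_plane (L := fun t => L (1, t)) (by fun_prop) hn e₃ 0 1
  have q₄ := log_im_sub_of_half_plane (L := fun t => L (t, 0)) (by fun_prop) (neg_ne_zero.2 hn)
    e₄ 0 1
  simp only [hexp] at q₁ q₂ q₃ q₄
  have z₁ : conj n * (f 0 - g 0) = ((α * c : ℝ) : ℂ) * Complex.I := by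
    rw [hf0, hg0]; push_cast; linear_combination α * hc
  have z₂ : conj n * (f 0 - g 1) = (((β - α) * -c : ℝ) : ℂ) * Complex.I := by
    rw [hf0, hg1]; push_cast; linear_combination (α - β) * hc
  have z₃ : conj n * (f 1 - g 1) = (((1 - β) * c : ℝ) : ℂ) * Complex.I := by
    rw [hf1, hg1]; push_cast; linear_combination (1 - β) * hc
  have z₄ : conj n * (f 1 - g 0) = ((c : ℝ) : ℂ) * Complex.I := by
    rw [hf1, hg0]; linear_combination hc
  have n₁ : conj (-n) * (f 0 - g 0) = ((α * -c : ℝ) : ℂ) * Complex.I := by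
    rw [map_neg, neg_mul, z₁]; push_cast; ring
  have n₂ : conj (-n) * (f 0 - g 1) = (((β - α) * c : ℝ) : ℂ) * Complex.I := by
    rw [map_neg, neg_mul, z₂]; push_cast; ring
  have n₃ : conj (-n) * (f 1 - g 1) = (((1 - β) * -c : ℝ) : ℂ) * Complex.I := by
    rw [map_neg, neg_mul, z₃]; push_cast; ring
  have n₄ : conj (-n) * (f 1 - g 0) = ((-c : ℝ) : ℂ) * Complex.I := by
    rw [map_neg, neg_mul, z₄]; push_cast; ring
  -- Along two sides the argument turns by `π` in the same sense and along the other two not at all,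
  -- so the two routes between opposite corners disagree by `2π`.
  rw [z₂, z₁] at q₁
  rw [n₃, n₂] at q₂
  rw [z₃, z₄] at q₃
  rw [n₄, n₁] at q₄
  have apos : ∀ r : ℝ, 0 < r → ((r : ℂ) * Complex.I).arg = Real.pi / 2 := fun r hr => by
    rw [Complex.arg_real_mul _ hr, Complex.arg_I]
  have aneg : ∀ r : ℝ, r < 0 → ((r : ℂ) * Complex.I).arg = -(Real.pi / 2) := fun r hr => by
    have : (r : ℂ) * Complex.I = ((-r : ℝ) : ℂ) * -Complex.I := by push_cast; ring
    rw [this, Complex.arg_real_mul _ (neg_pos.2 hr), Complex.arg_neg_I]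
  have hπ := Real.pi_pos
  rcases lt_or_gt_of_ne hc0 with hneg | hpos
  · rw [aneg (α * c) (by nlinarith), apos _ (by nlinarith)] at q₁
    rw [aneg ((β - α) * c) (by nlinarith), apos _ (by nlinarith)] at q₂
    rw [aneg _ (by nlinarith), aneg _ hneg] at q₃
    rw [apos _ (by linarith), apos _ (by nlinarith)] at q₄
    linarith
  · rw [apos (α * c) (by positivity), aneg _ (by nlinarith)] at q₁
    rw [apos ((β - α) * c) (by nlinarith), aneg _ (by nlinarith)] at q₂
    rw [apos _ (by nlinarith), apos _ hpos] at q₃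
    rw [aneg _ (by linarith), aneg _ (by nlinarith)] at q₄
    linarith

end ConvexHyperbolic

/-! ### Chords of planar convex sets and persistence of their crossings -/

namespace ConvexHyperbolic

open UpperHalfPlane ComplexConjugate

/-! ### Segments in planar convex sets -/

theorem mem_segment_iff_real {a b z : ℂ} :
    z ∈ segment ℝ a b ↔ ∃ l ∈ Icc (0 : ℝ) 1, z = a + l * (b - a) := by
  rw [segment_eq_image']
  exact ⟨fun ⟨l, hl, h⟩ => ⟨l, hl, by rw [← h]; simp⟩, fun ⟨l, hl, h⟩ => ⟨l, hl, by rw [h]; simp⟩⟩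

theorem mem_openSegment_iff_real {a b z : ℂ} :
    z ∈ openSegment ℝ a b ↔ ∃ l ∈ Ioo (0 : ℝ) 1, z = a + l * (b - a) := by
  rw [openSegment_eq_image']
  exact ⟨fun ⟨l, hl, h⟩ => ⟨l, hl, by rw [← h]; simp⟩, fun ⟨l, hl, h⟩ => ⟨l, hl, by rw [h]; simp⟩⟩

/-- A segment in a convex set that touches the boundary in its relative interior lies in the
boundary. -/
theorem notMem_interior_of_mem_segment {K : Set ℂ} (hK : Convex ℝ K) {a b z w : ℂ} (ha : a ∈ K)
    (hb : b ∈ K) (hz : z ∈ openSegment ℝ a b) (hzi : z ∉ interior K) (hw : w ∈ segment ℝ a b) :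
    w ∉ interior K := by
  intro hwi
  obtain ⟨l, hl, rfl⟩ := mem_openSegment_iff_real.1 hz
  obtain ⟨k, hk, rfl⟩ := mem_segment_iff_real.1 hw
  rcases lt_trichotomy l k with h | rfl | h
  · refine hzi (hK.openSegment_self_interior_subset_interior ha hwi
      (mem_openSegment_iff_real.2 ⟨l / k, ⟨div_pos hl.1 (hl.1.trans h),
        (div_lt_one (hl.1.trans h)).2 h⟩, ?_⟩))
    have : (k : ℂ) ≠ 0 := by exact_mod_cast (hl.1.trans h).ne'
    push_cast
    field_simp
    ring
  · exact hzi hwi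
  · have h1 : 0 < 1 - k := by linarith [hl.2]
    refine hzi (hK.openSegment_interior_self_subset_interior hwi hb
      (mem_openSegment_iff_real.2 ⟨(l - k) / (1 - k), ⟨div_pos (by linarith) h1,
        (div_lt_one h1).2 (by linarith [hl.2])⟩, ?_⟩))
    have : (1 : ℂ) - k ≠ 0 := by exact_mod_cast h1.ne'
    push_cast
    field_simp
    ring

/-- Chords of a convex set with four different endpoints that meet cross transversally. -/
theorem crossing_of_meet {K : Set ℂ} {a b a' b' z : ℂ} (ha : a ∉ interior K)
    (hb : b ∉ interior K) (ha' : a' ∉ interior K) (hb' : b' ∉ interior K)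
    (hab : openSegment ℝ a b ⊆ interior K) (hab' : openSegment ℝ a' b' ⊆ interior K)
    (h₁ : a ≠ a') (h₂ : a ≠ b') (h₃ : b ≠ a') (h₄ : b ≠ b') (hz : z ∈ segment ℝ a b)
    (hz' : z ∈ segment ℝ a' b') : ∃ l ∈ Ioo (0 : ℝ) 1, ∃ m ∈ Ioo (0 : ℝ) 1,
      a + l * (b - a) = a' + m * (b' - a') ∧ (conj (b - a) * (b' - a')).im ≠ 0 := by
  have key : ∀ {p q r : ℂ}, r ∉ interior K → p ≠ r → q ≠ r → openSegment ℝ p q ⊆ interior K →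
      r ∉ segment ℝ p q := fun hr hp hq hpq hmem =>
    hr (hpq (mem_openSegment_of_ne_left_right hp hq hmem))
  have hzo : z ∈ openSegment ℝ a b := by
    refine mem_openSegment_of_ne_left_right ?_ ?_ hz
    · rintro rfl
      exact key ha h₁.symm h₂.symm hab' hz'
    · rintro rfl
      exact key hb h₃.symm h₄.symm hab' hz'
  have hzo' : z ∈ openSegment ℝ a' b' := by
    refine mem_openSegment_of_ne_left_right ?_ ?_ hz'
    · rintro rfl
      exact key ha' h₁ h₃ hab hz
    · rintro rfl
      exact key hb' h₂ h₄ hab hz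
  obtain ⟨l, hl, hlz⟩ := mem_openSegment_iff_real.1 hzo
  obtain ⟨m, hm, hmz⟩ := mem_openSegment_iff_real.1 hzo'
  have hlm := hlz.symm.trans hmz
  refine ⟨l, hl, m, hm, hlm, fun hD => ?_⟩
  have hba : b - a ≠ 0 := by
    intro h
    rw [sub_eq_zero] at h
    subst h
    rw [openSegment_same] at hab
    exact ha (hab rfl)
  -- If the chords were parallel, all four ends would be collinear, with `a'` and `b'` at parameters
  -- `x`, `y` outside `[0, 1]`. Since `l` lies between `x` and `y`, they are on opposite sides, so
  -- `a` would lie on the other chord.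
  obtain ⟨r, hr⟩ : ∃ r : ℝ, b' - a' = r * (b - a) := by
    have hcb : conj (b - a) ≠ 0 := (map_ne_zero _).2 hba
    refine ⟨(conj (b - a) * (b' - a')).re / Complex.normSq (b - a), ?_⟩
    have h1 : conj (b - a) * (b' - a') = ((conj (b - a) * (b' - a')).re : ℂ) :=
      Complex.ext (by simp) (by rw [hD, Complex.ofReal_im])
    have h2 : ((Complex.normSq (b - a) : ℝ) : ℂ) = conj (b - a) * (b - a) :=
      Complex.normSq_eq_conj_mul_self
    push_cast
    rw [← h1, h2]
    field_simp
  have ea : a' = a + ((l - m * r : ℝ) : ℂ) * (b - a) := by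
    push_cast
    linear_combination (-1 : ℂ) * hlm + (-m : ℂ) * hr
  have eb : b' = a + ((l + (1 - m) * r : ℝ) : ℂ) * (b - a) := by
    push_cast
    linear_combination (-1 : ℂ) * hlm + (1 - m : ℂ) * hr
  set x := l - m * r with hx
  set y := l + (1 - m) * r with hy
  have out : ∀ {w : ℂ} {t : ℝ}, w ∉ interior K → a ≠ w → b ≠ w → w = a + t * (b - a) →
      t < 0 ∨ 1 < t := by
    intro w t hw haw hbw hwt
    by_contra hcon
    push Not at hcon
    exact key hw haw hbw hab (mem_segment_iff_real.2 ⟨t, hcon, hwt⟩)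
  have hxy : l = (1 - m) * x + m * y := by rw [hx, hy]; ring
  have m1 := hm.1
  have m2 := hm.2
  have hxyne : y - x ≠ 0 := by
    intro h
    have hyx : y = x := by linarith
    have : l = x := by rw [hxy, hyx]; ring
    rcases out ha' h₁ h₃ ea with h | h <;> linarith [hl.1, hl.2]
  have hneg : x * y < 0 := by
    rcases out ha' h₁ h₃ ea with h | h <;> rcases out hb' h₂ h₄ eb with h' | h'
    · exfalso; nlinarith [hl.1]
    · nlinarith
    · nlinarith
    · exfalso; nlinarith [hl.2]
  refine key ha h₁.symm h₂.symm hab' (mem_segment_iff_real.2 ⟨-x / (y - x), ?_, ?_⟩)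
  · rcases lt_or_gt_of_ne hxyne with h | h
    · have hx0 : 0 < x := by nlinarith
      have hy0 : y < 0 := by nlinarith
      exact ⟨div_nonneg_of_nonpos (by linarith) h.le, (div_le_one_of_neg h).2 (by linarith)⟩
    · have hx0 : x < 0 := by nlinarith
      have hy0 : 0 < y := by nlinarith
      exact ⟨div_nonneg (by linarith) h.le, (div_le_one h).2 (by linarith)⟩
  · have : (y : ℂ) - x ≠ 0 := by exact_mod_cast hxyne
    rw [ea, eb]
    push_cast
    field_simp
    ring

/-- If two moving segments meet at first, and cross transversally whenever they meet, then they meet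
forever. -/
theorem segments_meet_of_continuous {a b a' b' : ℝ → ℂ} (ha : Continuous a) (hb : Continuous b)
    (ha' : Continuous a') (hb' : Continuous b')
    (hcross : ∀ u, (segment ℝ (a u) (b u) ∩ segment ℝ (a' u) (b' u)).Nonempty →
      ∃ l ∈ Ioo (0 : ℝ) 1, ∃ m ∈ Ioo (0 : ℝ) 1, a u + l * (b u - a u) = a' u + m * (b' u - a' u) ∧
        (conj (b u - a u) * (b' u - a' u)).im ≠ 0) {u₀ : ℝ}
    (h0 : (segment ℝ (a u₀) (b u₀) ∩ segment ℝ (a' u₀) (b' u₀)).Nonempty) (u : ℝ) :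
    (segment ℝ (a u) (b u) ∩ segment ℝ (a' u) (b' u)).Nonempty := by
  set S : Set ℝ := {u | (segment ℝ (a u) (b u) ∩ segment ℝ (a' u) (b' u)).Nonempty} with hS
  -- The meeting parameters range over a compact square, so projecting them away preserves
  -- closedness.
  have hclosed : IsClosed S := by
    have : S = Prod.fst '' {z : ℝ × unitInterval × unitInterval |
        a z.1 + ((z.2.1 : ℝ) : ℂ) * (b z.1 - a z.1) =
          a' z.1 + ((z.2.2 : ℝ) : ℂ) * (b' z.1 - a' z.1)} := by
      ext u
      constructor
      · rintro ⟨z, h1, h2⟩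
        obtain ⟨l, hl, rfl⟩ := mem_segment_iff_real.1 h1
        obtain ⟨m, hm, h⟩ := mem_segment_iff_real.1 h2
        exact ⟨(u, ⟨l, hl⟩, ⟨m, hm⟩), h, rfl⟩
      · rintro ⟨⟨u', l, m⟩, h, rfl⟩
        exact ⟨_, mem_segment_iff_real.2 ⟨l, l.2, rfl⟩, mem_segment_iff_real.2 ⟨m, m.2, h⟩⟩
    rw [this]
    exact isClosedMap_fst_of_compactSpace _ (isClosed_eq (by fun_prop) (by fun_prop))
  have hopen : IsOpen S := by
    rw [isOpen_iff_mem_nhds]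
    intro u hu
    obtain ⟨l, hl, m, hm, heq, hD⟩ := hcross u hu
    set D : ℝ → ℝ := fun u => (conj (b u - a u) * (b' u - a' u)).im with hDdef
    set P : ℝ → ℝ := fun u => (conj (a' u - a u) * (b' u - a' u)).im with hP
    set Q : ℝ → ℝ := fun u => (conj (a' u - a u) * (b u - a u)).im with hQ
    have cD : Continuous D := by
      exact Complex.continuous_im.comp ((Complex.continuous_conj.comp (hb.sub ha)).mul (hb'.sub ha'))
    have cP : Continuous P := by
      exact Complex.continuous_im.comp ((Complex.continuous_conj.comp (ha'.sub ha)).mul (hb'.sub ha'))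
    have cQ : Continuous Q := by
      exact Complex.continuous_im.comp ((Complex.continuous_conj.comp (ha'.sub ha)).mul (hb.sub ha))
    have hre := congrArg Complex.re heq
    have him := congrArg Complex.im heq
    simp only [Complex.add_re, Complex.add_im, Complex.mul_re, Complex.mul_im, Complex.ofReal_re,
      Complex.ofReal_im, zero_mul, sub_zero, add_zero, Complex.sub_re, Complex.sub_im] at hre him
    -- Cramer's rule: the crossing parameters are continuous quotients and stay in `(0, 1)` for
    -- nearby times.
    have hl' : P u / D u = l := by
      rw [div_eq_iff hD]
      simp only [hP, Complex.mul_im, map_sub, Complex.sub_re, Complex.sub_im,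
        Complex.conj_re, Complex.conj_im]
      linear_combination ((b' u).re - (a' u).re) * him - ((b' u).im - (a' u).im) * hre
    have hm' : Q u / D u = m := by
      rw [div_eq_iff hD]
      simp only [hQ, Complex.mul_im, map_sub, Complex.sub_re, Complex.sub_im,
        Complex.conj_re, Complex.conj_im]
      linear_combination ((b u).re - (a u).re) * him - ((b u).im - (a u).im) * hre
    have e1 : ∀ᶠ v in nhds u, D v ≠ 0 := cD.continuousAt.eventually_ne hD
    have e2 : ∀ᶠ v in nhds u, P v / D v ∈ Ioo (0 : ℝ) 1 :=
      (cP.continuousAt.div cD.continuousAt hD).eventually_mem (isOpen_Ioo.mem_nhds (by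
        change P u / D u ∈ _; rwa [hl']))
    have e3 : ∀ᶠ v in nhds u, Q v / D v ∈ Ioo (0 : ℝ) 1 :=
      (cQ.continuousAt.div cD.continuousAt hD).eventually_mem (isOpen_Ioo.mem_nhds (by
        change Q u / D u ∈ _; rwa [hm']))
    filter_upwards [e1, e2, e3] with v h1 h2 h3
    refine ⟨_, mem_segment_iff_real.2 ⟨_, Ioo_subset_Icc_self h2, rfl⟩,
      mem_segment_iff_real.2 ⟨_, Ioo_subset_Icc_self h3, ?_⟩⟩
    have hDv : D v = ((b v).re - (a v).re) * ((b' v).im - (a' v).im) -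
        ((b v).im - (a v).im) * ((b' v).re - (a' v).re) := by
      simp [hDdef]; ring
    have hPv : P v = ((a' v).re - (a v).re) * ((b' v).im - (a' v).im) -
        ((a' v).im - (a v).im) * ((b' v).re - (a' v).re) := by
      simp [hP]; ring
    have hQv : Q v = ((a' v).re - (a v).re) * ((b v).im - (a v).im) -
        ((a' v).im - (a v).im) * ((b v).re - (a v).re) := by
      simp [hQ]; ring
    apply Complex.ext
    · simp only [Complex.add_re, Complex.mul_re, Complex.ofReal_re,
        Complex.ofReal_im, zero_mul, sub_zero, Complex.sub_re]
      rw [← sub_eq_zero]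
      field_simp
      rw [hDv, hPv, hQv]
      ring
    · simp only [Complex.add_im, Complex.mul_im, Complex.ofReal_re,
        Complex.ofReal_im, zero_mul, add_zero, Complex.sub_im]
      rw [← sub_eq_zero]
      field_simp
      rw [hDv, hPv, hQv]
      ring
  have hu : u ∈ S := by
    rw [IsClopen.eq_univ ⟨hclosed, hopen⟩ ⟨u₀, h0⟩]
    exact mem_univ u
  exact hu

/-! ### The projective model along lines -/

theorem klein_line_mem_openSegment {γ : ℝ → ℍ} (hγ : Isometry γ) {r s t : ℝ} (hrs : r < s)
    (hst : s < t) : klein (γ s) ∈ openSegment ℝ (klein (γ r)) (klein (γ t)) := by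
  have hseg : klein (γ s) ∈ segment ℝ (klein (γ r)) (klein (γ t)) := by
    rw [← dist_add_dist_eq_iff, dist_line hγ hrs.le, dist_line hγ hst.le,
      dist_line hγ (hrs.trans hst).le]
    ring
  refine mem_openSegment_of_ne_left_right ?_ ?_ hseg
  · exact fun h => hrs.ne (hγ.injective (klein_injective h))
  · exact fun h => hst.ne' (hγ.injective (klein_injective h))

theorem klein_line_mem_segment {γ : ℝ → ℍ} (hγ : Isometry γ) {r s t : ℝ} (hrs : r ≤ s)
    (hst : s ≤ t) : klein (γ s) ∈ segment ℝ (klein (γ r)) (klein (γ t)) := by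
  rw [← dist_add_dist_eq_iff, dist_line hγ hrs, dist_line hγ hst, dist_line hγ (hrs.trans hst)]
  ring

/-- A point collinear with two points of a geodesic line lies on that line. -/
theorem exists_eq_line_of_collinear {γ : ℝ → ℍ} (hγ : Isometry γ) {s t : ℝ} (hst : s < t) {p : ℍ}
    {r : ℝ} (h : klein p = klein (γ s) + r * (klein (γ t) - klein (γ s))) : ∃ u, p = γ u := by
  have hd := dist_line hγ hst.le
  rcases lt_or_ge r 0 with h0 | h0
  · have : klein (γ s) ∈ segment ℝ (klein p) (klein (γ t)) := by
      refine mem_segment_iff_real.2 ⟨-r / (1 - r), ⟨div_nonneg (by linarith) (by linarith),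
        (div_le_one (by linarith)).2 (by linarith)⟩, ?_⟩
      have : (1 : ℂ) - r ≠ 0 := by exact_mod_cast (by linarith : (1 : ℝ) - r ≠ 0)
      rw [h]
      push_cast
      field_simp
      ring
    rw [← dist_add_dist_eq_iff, hd] at this
    refine ⟨s - dist p (γ s), eq_of_isometry_line hγ hst.ne ?_ ?_⟩
    · rw [sub_sub_cancel_left, abs_neg, abs_of_nonneg dist_nonneg, dist_comm]
    · rw [abs_sub_comm, abs_of_nonneg (by linarith [dist_nonneg (x := p) (y := γ s)]), dist_comm]
      linarith
  rcases le_or_gt r 1 with h1 | h1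
  · have : klein p ∈ segment ℝ (klein (γ s)) (klein (γ t)) :=
      mem_segment_iff_real.2 ⟨r, ⟨h0, h1⟩, h⟩
    rw [← dist_add_dist_eq_iff, hd] at this
    refine ⟨s + dist (γ s) p, eq_of_isometry_line hγ hst.ne ?_ ?_⟩
    · rw [add_sub_cancel_left, abs_of_nonneg dist_nonneg]
    · rw [abs_sub_comm, abs_of_nonneg (by linarith [dist_nonneg (x := p) (y := γ t)]), dist_comm]
      linarith
  · have : klein (γ t) ∈ segment ℝ (klein (γ s)) (klein p) := by
      refine mem_segment_iff_real.2 ⟨1 / r, ⟨by positivity, (div_le_one (by linarith)).2 h1.le⟩, ?_⟩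
      have : (r : ℂ) ≠ 0 := by exact_mod_cast (by linarith : r ≠ 0)
      rw [h]
      push_cast
      field_simp
      ring
    rw [← dist_add_dist_eq_iff, hd] at this
    refine ⟨t + dist (γ t) p, eq_of_isometry_line hγ hst.ne ?_ ?_⟩
    · rw [abs_of_nonneg (by linarith [dist_nonneg (x := γ t) (y := p)])]
      linarith
    · rw [add_sub_cancel_left, abs_of_nonneg dist_nonneg]

end ConvexHyperbolic

/-! ### Lifted homotopies and paths between different boundary components -/

namespace ConvexHyperbolic

open UpperHalfPlane ComplexConjugate

section

variable {X : Type*} [MetricSpace X]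

namespace DevelopedCover

variable (D : DevelopedCover X)

/-! ### Lifting -/

theorem exists_lift {F : ℝ × ℝ → X} (hF : Continuous F) {z₀ : ℝ × ℝ} {p : ℍ} (hp : p ∈ D.K)
    (hpz : D.π p = F z₀) : ∃ G : ℝ × ℝ → ℍ, Continuous G ∧ (∀ z, G z ∈ D.K) ∧
      (∀ z, D.π (G z) = F z) ∧ G z₀ = p := by
  obtain ⟨G, ⟨h1, h2⟩, -⟩ := D.isCoveringMap.existsUnique_continuousMap_lifts
    (⟨F, hF⟩ : C(ℝ × ℝ, X)) z₀ ⟨p, hp⟩ hpz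
  exact ⟨fun z => G z, by fun_prop, fun z => (G z).2, fun z => congrFun h2 z,
    congrArg Subtype.val h1⟩

theorem eq_of_lift {A : Type*} [TopologicalSpace A] [PreconnectedSpace A] {F G : A → ℍ}
    (hF : Continuous F) (hG : Continuous G) (hFK : ∀ z, F z ∈ D.K) (hGK : ∀ z, G z ∈ D.K)
    (h : ∀ z, D.π (F z) = D.π (G z)) {z₀ : A} (h0 : F z₀ = G z₀) : F = G := by
  have := D.isCoveringMap.eq_of_comp_eq (g₁ := fun z => (⟨F z, hFK z⟩ : D.K))
    (g₂ := fun z => ⟨G z, hGK z⟩) (by fun_prop) (by fun_prop) (funext h) z₀ (Subtype.ext h0)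
  funext z
  exact congrArg Subtype.val (congrFun this z)

/-! ### Boundary points -/

theorem klein_notMem_interior {p : ℍ} (hp : p ∈ D.K) (h : D.π p ∈ surfaceBoundary X) :
    klein p ∉ interior (klein '' D.K) := by
  rw [klein_mem_interior_iff]
  exact (D.mem_surfaceBoundary_iff hp).1 h

theorem continuousOn_π : ContinuousOn D.π D.K :=
  continuousOn_iff_continuous_domRestrict.2 D.isCoveringMap.continuous

theorem klein_interior_nonempty : (interior (klein '' D.K)).Nonempty :=
  D.interior_nonempty.imp' klein fun _ h => klein_mem_interior_iff.2 h

/-- A chord joining different boundary components runs in the interior. -/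
theorem openSegment_subset_interior {p q : ℍ} (hp : p ∈ D.K) (hq : q ∈ D.K)
    (hne : connectedComponentIn (surfaceBoundary X) (D.π p) ≠
      connectedComponentIn (surfaceBoundary X) (D.π q)) :
    openSegment ℝ (klein p) (klein q) ⊆ interior (klein '' D.K) := by
  intro z hz
  by_contra hzi
  apply hne
  have hpq : p ≠ q := by
    rintro rfl
    exact hne rfl
  obtain ⟨γ, hγ, hγ0, hγ1⟩ := exists_isometry_line hpq
  set d := dist p q with hd
  have hd0 : 0 ≤ d := dist_nonneg
  have hseg : ∀ t ∈ Icc 0 d, klein (γ t) ∈ segment ℝ (klein p) (klein q) := by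
    intro t ht
    have := klein_line_mem_segment hγ ht.1 ht.2
    rwa [hγ0, hγ1] at this
  have hK : ∀ t ∈ Icc 0 d, γ t ∈ D.K := fun t ht =>
    D.convex p hp q hq _ (dist_add_dist_eq_iff.2 (hseg t ht))
  -- A chord touching the boundary inside runs in it entirely, and its image then connects the two
  -- components.
  have hbd : ∀ t ∈ Icc 0 d, D.π (γ t) ∈ surfaceBoundary X := by
    intro t ht
    rw [D.mem_surfaceBoundary_iff (hK t ht), ← klein_mem_interior_iff]
    exact notMem_interior_of_mem_segment (convex_klein_image D.convex) (mem_image_of_mem _ hp)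
      (mem_image_of_mem _ hq) hz hzi (hseg t ht)
  have hconn : IsPreconnected ((fun t => D.π (γ t)) '' Icc 0 d) :=
    isPreconnected_Icc.image _ (D.continuousOn_π.comp hγ.continuous.continuousOn hK)
  have hsub := hconn.subset_connectedComponentIn (F := surfaceBoundary X) (x := D.π p)
    ⟨0, left_mem_Icc.2 hd0, by simp [hγ0]⟩ (by rintro _ ⟨t, ht, rfl⟩; exact hbd t ht)
  exact connectedComponentIn_eq (hsub ⟨d, right_mem_Icc.2 hd0, by simp [hγ1]⟩)

end DevelopedCover

theorem connectedComponentIn_eq_of_path {S : Set X} {c : ℝ → X} (hc : Continuous c)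
    (hS : ∀ t, c t ∈ S) (u v : ℝ) :
    connectedComponentIn S (c u) = connectedComponentIn S (c v) := by
  have hsub := (isPreconnected_univ.image c hc.continuousOn).subset_connectedComponentIn
    (F := S) (x := c u) ⟨u, mem_univ _, rfl⟩ (by rintro _ ⟨t, -, rfl⟩; exact hS t)
  exact connectedComponentIn_eq (hsub ⟨v, mem_univ _, rfl⟩)

/-- The extension of a map on the square to the plane, constant along the normal directions. -/
noncomputable def squareExtend (H : unitInterval × unitInterval → X) (z : ℝ × ℝ) : X :=
  H (projIcc 0 1 zero_le_one z.1, projIcc 0 1 zero_le_one z.2)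

theorem continuous_squareExtend {H : unitInterval × unitInterval → X} (hH : Continuous H) :
    Continuous (squareExtend H) :=
  hH.comp ((continuous_projIcc.comp continuous_fst).prodMk (continuous_projIcc.comp continuous_snd))

/-- The two lifts of a homotopy starting at a geodesic path that are determined by a double point of
that path. -/
theorem exists_lifts_of_double_point [CompactSpace X] (hX : IsConvexHyperbolicSurface X)
    {s : ℝ → X} {a b : ℝ} (hs : IsGeodesicPath s a b) {H : unitInterval × unitInterval → X}
    (hH : Continuous H) (hHs : ∀ τ : unitInterval, H (τ, 0) = s (a + τ * (b - a))) {u v : ℝ}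
    (hu : u ∈ Icc a b) (hv : v ∈ Icc a b) (huv : u ≠ v) (hsuv : s u = s v) :
    ∃ (D : DevelopedCover X) (F G : ℝ × ℝ → ℍ) (γ δ : ℝ → ℍ), Continuous F ∧ Continuous G ∧
      (∀ z, F z ∈ D.K) ∧ (∀ z, G z ∈ D.K) ∧ (∀ z, D.π (F z) = squareExtend H z) ∧
      (∀ z, D.π (G z) = squareExtend H z) ∧ (∀ z, F z ≠ G z) ∧ Isometry γ ∧ Isometry δ ∧
      (∀ τ ∈ Icc a b, F ((τ - a) / (b - a), 0) = γ τ) ∧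
      (∀ τ ∈ Icc a b, G ((τ - a) / (b - a), 0) = δ τ) ∧ γ u = δ v := by
  have hab : 0 < b - a := sub_pos.2 hs.1
  have hbase : ∀ τ ∈ Icc a b, squareExtend H ((τ - a) / (b - a), 0) = s τ := by
    intro τ hτ
    have hmem : (τ - a) / (b - a) ∈ Icc (0 : ℝ) 1 :=
      ⟨div_nonneg (by linarith [hτ.1]) hab.le, (div_le_one hab).2 (by linarith [hτ.2])⟩
    rw [squareExtend, projIcc_of_mem _ hmem, projIcc_left]
    refine (hHs _).trans (congrArg s ?_)
    dsimp only
    rw [div_mul_cancel₀ _ hab.ne']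
    ring
  obtain ⟨D, p, hp, hpu⟩ := hX.exists_developedCover (s u)
  -- `F` and `G` lift the same map from the same point `p`, but `F` sits at `p` at parameter `u` and
  -- `G` at parameter `v`.
  have hHc := continuous_squareExtend hH
  obtain ⟨F, hF, hFK, hFπ, hFp⟩ := D.exists_lift hHc (z₀ := ((u - a) / (b - a), 0)) hp
    (by rw [hpu, hbase u hu])
  obtain ⟨G, hG, hGK, hGπ, hGp⟩ := D.exists_lift hHc (z₀ := ((v - a) / (b - a), 0)) hp
    (by rw [hpu, hbase v hv, hsuv])
  have hline : ∀ F : ℝ × ℝ → ℍ, Continuous F → (∀ z, F z ∈ D.K) →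
      (∀ z, D.π (F z) = squareExtend H z) →
      ∃ γ : ℝ → ℍ, Isometry γ ∧ ∀ τ ∈ Icc a b, F ((τ - a) / (b - a), 0) = γ τ := by
    intro F hF hFK hFπ
    refine D.exists_line_of_lift hs (σ := fun τ => F ((τ - a) / (b - a), 0))
      (Continuous.continuousOn (by fun_prop)) (fun τ _ => hFK _) fun τ hτ => ?_
    rw [hFπ, hbase τ hτ]
  obtain ⟨γ, hγ, hγF⟩ := hline F hF hFK hFπ
  obtain ⟨δ, hδ, hδG⟩ := hline G hG hGK hGπ
  refine ⟨D, F, G, γ, δ, hF, hG, hFK, hGK, hFπ, hGπ, fun z hz => huv ?_, hγ, hδ, hγF, hδG, ?_⟩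
  -- One common value would make the lifts equal, and the line through `F` would take the value `p`
  -- at both `u` and `v`.
  · have hFG : F = G := D.eq_of_lift hF hG hFK hGK (fun z => by rw [hFπ, hGπ]) hz
    apply hγ.injective
    rw [← hγF u hu, hFp, ← hγF v hv, hFG, hGp]
  · rw [← hγF u hu, ← hδG v hv, hFp, hGp]

/-! ### Paths between different boundary components -/

theorem isSimple_of_pathsHomotopic [CompactSpace X] (hX : IsConvexHyperbolicSurface X)
    {s : ℝ → X} {a b : ℝ} {t : ℝ → X} {c d : ℝ} (hs : IsGeodesicPath s a b)
    (hjoin : JoinsDifferentBoundaryComponents s a b) (hcd : c < d)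
    (hst : PathsHomotopic s a b t c d) (ht : InjOn t (Icc c d)) : IsSimple s a b := by
  intro u hu v hv hsuv
  by_contra huv
  obtain ⟨H, hH, hHs, hHt, hHb⟩ := hst
  have hab := hs.1
  have hab' : b - a ≠ 0 := (sub_pos.2 hab).ne'
  obtain ⟨D, F, G, γ, δ, hF, hG, hFK, hGK, hFπ, hGπ, hFG, hγ, hδ, hγF, hδG, hγδ⟩ :=
    exists_lifts_of_double_point hX hs hH hHs (Ioo_subset_Icc_self hu) (Ioo_subset_Icc_self hv)
      huv hsuv
  have hHc := continuous_squareExtend hH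
  have hleft : ∀ r, squareExtend H (0, r) ∈ surfaceBoundary X := fun r => by
    rw [squareExtend, projIcc_left]
    exact (hHb _).1
  have hright : ∀ r, squareExtend H (1, r) ∈ surfaceBoundary X := fun r => by
    rw [squareExtend, projIcc_right]
    exact (hHb _).2
  have h00 : squareExtend H (0, 0) = s a := by
    rw [squareExtend, projIcc_left]
    refine (hHs _).trans (congrArg s ?_)
    simp
  have h10 : squareExtend H (1, 0) = s b := by
    rw [squareExtend, projIcc_left, projIcc_right]
    refine (hHs _).trans (congrArg s ?_)
    simp
  have hcomp : ∀ r r', connectedComponentIn (surfaceBoundary X) (squareExtend H (0, r)) ≠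
      connectedComponentIn (surfaceBoundary X) (squareExtend H (1, r')) := by
    intro r r'
    rw [connectedComponentIn_eq_of_path (c := fun r => squareExtend H (0, r)) (by fun_prop) hleft
      r 0, connectedComponentIn_eq_of_path (c := fun r => squareExtend H (1, r)) (by fun_prop)
      hright r' 0, h00, h10]
    exact hjoin.2.2
  have bd : ∀ F : ℝ × ℝ → ℍ, (∀ z, F z ∈ D.K) → (∀ z, D.π (F z) = squareExtend H z) → ∀ r,
      klein (F (0, r)) ∉ interior (klein '' D.K) ∧ klein (F (1, r)) ∉ interior (klein '' D.K) ∧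
      openSegment ℝ (klein (F (0, r))) (klein (F (1, r))) ⊆ interior (klein '' D.K) := by
    intro F hFK hFπ r
    have h1 : D.π (F (0, r)) ∈ surfaceBoundary X := by rw [hFπ]; exact hleft r
    have h2 : D.π (F (1, r)) ∈ surfaceBoundary X := by rw [hFπ]; exact hright r
    refine ⟨D.klein_notMem_interior (hFK _) h1, D.klein_notMem_interior (hFK _) h2,
      D.openSegment_subset_interior (hFK _) (hFK _) ?_⟩
    rw [hFπ, hFπ]
    exact hcomp r r
  -- Corresponding ends differ because the lifts agree nowhere; opposite ends differ because they
  -- lie over different boundary components.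
  have hcross : ∀ r, (segment ℝ (klein (F (0, r))) (klein (F (1, r))) ∩
      segment ℝ (klein (G (0, r))) (klein (G (1, r)))).Nonempty →
      ∃ l ∈ Ioo (0 : ℝ) 1, ∃ m ∈ Ioo (0 : ℝ) 1,
        klein (F (0, r)) + l * (klein (F (1, r)) - klein (F (0, r))) =
          klein (G (0, r)) + m * (klein (G (1, r)) - klein (G (0, r))) ∧
        (conj (klein (F (1, r)) - klein (F (0, r))) *
          (klein (G (1, r)) - klein (G (0, r)))).im ≠ 0 := by
    rintro r ⟨z, hz, hz'⟩
    obtain ⟨f1, f2, f3⟩ := bd F hFK hFπ r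
    obtain ⟨g1, g2, g3⟩ := bd G hGK hGπ r
    refine crossing_of_meet f1 f2 g1 g2 f3 g3 ?_ ?_ ?_ ?_ hz hz'
    · exact fun h => hFG _ (klein_injective h)
    · intro h
      refine hcomp r r ?_
      rw [← hFπ (0, r), klein_injective h, hGπ]
    · intro h
      refine hcomp r r ?_
      rw [← hFπ (1, r), klein_injective h, hGπ]
    · exact fun h => hFG _ (klein_injective h)
  have ha : a ∈ Icc a b := left_mem_Icc.2 hab.le
  have hb : b ∈ Icc a b := right_mem_Icc.2 hab.le
  have F0 : F (0, 0) = γ a := by rw [← hγF a ha, sub_self, zero_div]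
  have F1 : F (1, 0) = γ b := by rw [← hγF b hb, div_self hab']
  have G0 : G (0, 0) = δ a := by rw [← hδG a ha, sub_self, zero_div]
  have G1 : G (1, 0) = δ b := by rw [← hδG b hb, div_self hab']
  have hk := continuous_klein
  have hmeet := segments_meet_of_continuous (a := fun r => klein (F (0, r)))
    (b := fun r => klein (F (1, r))) (a' := fun r => klein (G (0, r)))
    (b' := fun r => klein (G (1, r))) (by fun_prop) (by fun_prop) (by fun_prop) (by fun_prop)
    hcross (u₀ := 0) (by
      refine ⟨klein (γ u), ?_, ?_⟩
      · simp only [F0, F1]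
        exact klein_line_mem_segment hγ hu.1.le hu.2.le
      · simp only [G0, G1]
        rw [hγδ]
        exact klein_line_mem_segment hδ hv.1.le hv.2.le) 1
  obtain ⟨l, hl, m, hm, hlm, hne⟩ := hcross 1 hmeet
  obtain ⟨f1, f2, -⟩ := bd F hFK hFπ 1
  obtain ⟨g1, g2, -⟩ := bd G hGK hGπ 1
  set P : ℝ → ℝ := fun x => projIcc (0 : ℝ) 1 zero_le_one x with hP
  have hPc : Continuous P := continuous_subtype_val.comp continuous_projIcc
  have P0 : P 0 = 0 := by simp [hP]
  have P1 : P 1 = 1 := by simp [hP]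
  obtain ⟨x, y, hxy⟩ := paths_meet_of_crossing (convex_klein_image D.convex)
    D.klein_interior_nonempty (f := fun x => klein (F (P x, 1))) (g := fun x => klein (G (P x, 1)))
    (by fun_prop) (by fun_prop) (fun _ => mem_image_of_mem _ (hFK _))
    (fun _ => mem_image_of_mem _ (hGK _)) (by simpa [P0] using f1) (by simpa [P1] using f2)
    (by simpa [P0] using g1) (by simpa [P1] using g2) hl hm (by simpa [P0, P1] using hlm)
    (by simpa [P0, P1] using hne)
  have hFGxy := klein_injective hxy
  have hend : ∀ x, squareExtend H (P x, 1) = t (c + P x * (d - c)) := fun x => by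
    rw [squareExtend, projIcc_right, hP]
    dsimp only
    rw [projIcc_val]
    exact hHt _
  have hmem : ∀ x, c + P x * (d - c) ∈ Icc c d := fun x => by
    have h0 : 0 ≤ P x := (projIcc (0 : ℝ) 1 zero_le_one x).2.1
    have h1 : P x ≤ 1 := (projIcc (0 : ℝ) 1 zero_le_one x).2.2
    constructor <;> nlinarith
  have hteq : t (c + P x * (d - c)) = t (c + P y * (d - c)) := by
    rw [← hend, ← hend, ← hFπ, ← hGπ, hFGxy]
  have hPxy : P x = P y :=
    mul_right_cancel₀ (sub_pos.2 hcd).ne' (add_left_cancel (ht (hmem x) (hmem y) hteq))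
  rw [hPxy] at hFGxy
  exact hFG _ hFGxy

/-- A geodesic path joining different boundary components stays off the boundary. -/
theorem notMem_surfaceBoundary_of_joins [CompactSpace X] (hX : IsConvexHyperbolicSurface X)
    {t : ℝ → X} {c d : ℝ} (ht : IsGeodesicPath t c d)
    (hjoin : JoinsDifferentBoundaryComponents t c d) {τ : ℝ} (hτ : τ ∈ Ioo c d) :
    t τ ∉ surfaceBoundary X := by
  have hcd := ht.1
  have htc : ContinuousOn t (Icc c d) := by
    intro u hu
    obtain ⟨δ, hδ, hiso⟩ := ht.2 u hu
    refine Metric.continuousWithinAt_iff.2 fun ε hε => ⟨min δ ε, lt_min hδ hε, fun v hv hvu => ?_⟩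
    rw [Real.dist_eq] at hvu
    rw [hiso v hv u hu (hvu.trans_le (min_le_left _ _)) (by simpa)]
    exact hvu.trans_le (min_le_right _ _)
  obtain ⟨D, p, hp, hpc⟩ := hX.exists_developedCover (t c)
  set P : ℝ → ℝ := fun x => projIcc c d hcd.le x with hP
  have hPc : Continuous P := continuous_subtype_val.comp continuous_projIcc
  have hPt : Continuous fun x => t (P x) := htc.comp_continuous hPc fun x => (projIcc c d _ x).2
  have hPx : ∀ x ∈ Icc c d, P x = x := fun x hx => by simp [hP, projIcc_of_mem hcd.le hx]
  have hc : c ∈ Icc c d := left_mem_Icc.2 hcd.le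
  have hd : d ∈ Icc c d := right_mem_Icc.2 hcd.le
  obtain ⟨G, hG, hGK, hGπ, -⟩ := D.exists_lift (F := fun z => t (P z.1))
    (hPt.comp continuous_fst) (z₀ := (c, 0)) hp (by rw [hpc]; simp only [hPx c hc])
  have hGt : ∀ x ∈ Icc c d, D.π (G (x, 0)) = t x := fun x hx => by
    rw [hGπ]
    simp only [hPx x hx]
  obtain ⟨γ, hγ, hγG⟩ := D.exists_line_of_lift ht (σ := fun x => G (x, 0))
    (Continuous.continuousOn (by fun_prop)) (fun _ _ => hGK _) hGt
  have hτ' := Ioo_subset_Icc_self hτ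
  have hsub := D.openSegment_subset_interior (hGK (c, 0)) (hGK (d, 0))
    (by rw [hGt c hc, hGt d hd]; exact hjoin.2.2)
  rw [hγG c hc, hγG d hd] at hsub
  rw [← hGt τ hτ', D.mem_surfaceBoundary_iff (hGK _), not_not, hγG τ hτ', ← klein_mem_interior_iff]
  exact hsub (klein_line_mem_openSegment hγ hτ.1 hτ.2)

/-- Reduction to arcs: the homotopy carries the boundary components of the ends of `s` to those of
`t`, so `t` stays off `∂X` inside and its ends are distinct. Simplicity on the open interval is then
injectivity on the closed one. -/
theorem isSimple_of_pathsHomotopic_geodesic [CompactSpace X] (hX : IsConvexHyperbolicSurface X)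
    {s : ℝ → X} {a b : ℝ} {t : ℝ → X} {c d : ℝ} (hs : IsGeodesicPath s a b)
    (hjoin : JoinsDifferentBoundaryComponents s a b) (ht : IsGeodesicPath t c d)
    (hst : PathsHomotopic s a b t c d) (hts : IsSimple t c d) : IsSimple s a b := by
  refine isSimple_of_pathsHomotopic hX hs hjoin ht.1 hst ?_
  obtain ⟨H, hH, hHs, hHt, hHb⟩ := hst
  have hHc := continuous_squareExtend hH
  have h0 : ∀ r, squareExtend H (0, r) ∈ surfaceBoundary X := fun r => by
    rw [squareExtend, projIcc_left]
    exact (hHb _).1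
  have h1 : ∀ r, squareExtend H (1, r) ∈ surfaceBoundary X := fun r => by
    rw [squareExtend, projIcc_right]
    exact (hHb _).2
  have e00 : squareExtend H (0, 0) = s a := by
    rw [squareExtend, projIcc_left]
    exact (hHs _).trans (congrArg s (by simp))
  have e10 : squareExtend H (1, 0) = s b := by
    rw [squareExtend, projIcc_left, projIcc_right]
    exact (hHs _).trans (congrArg s (by simp))
  have e01 : squareExtend H (0, 1) = t c := by
    rw [squareExtend, projIcc_left, projIcc_right]
    exact (hHt _).trans (congrArg t (by simp))
  have e11 : squareExtend H (1, 1) = t d := by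
    rw [squareExtend, projIcc_right]
    exact (hHt _).trans (congrArg t (by simp))
  have hjt : JoinsDifferentBoundaryComponents t c d := by
    refine ⟨e01 ▸ h0 1, e11 ▸ h1 1, ?_⟩
    rw [← e01, ← e11,
      connectedComponentIn_eq_of_path (c := fun r => squareExtend H (0, r)) (by fun_prop) h0 1 0,
      connectedComponentIn_eq_of_path (c := fun r => squareExtend H (1, r)) (by fun_prop) h1 1 0,
      e00, e10]
    exact hjoin.2.2
  have hint := fun τ => notMem_surfaceBoundary_of_joins hX ht hjt (τ := τ)
  have htcd : t c ≠ t d := fun h => hjt.2.2 (by rw [h])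
  have cases : ∀ x ∈ Icc c d, x = c ∨ x = d ∨ x ∈ Ioo c d := by
    intro x hx
    rcases hx.1.eq_or_lt with h | h
    · exact Or.inl h.symm
    rcases hx.2.eq_or_lt with h' | h'
    · exact Or.inr (Or.inl h')
    · exact Or.inr (Or.inr ⟨h, h'⟩)
  intro x hx y hy hxy
  rcases cases x hx with rfl | rfl | hx' <;> rcases cases y hy with rfl | rfl | hy'
  · rfl
  · exact absurd hxy htcd
  · exact absurd (hxy ▸ hjt.1) (hint y hy')
  · exact absurd hxy.symm htcd
  · rfl
  · exact absurd (hxy ▸ hjt.2.1) (hint y hy')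
  · exact absurd (hxy ▸ hjt.1) (hint x hx')
  · exact absurd (hxy ▸ hjt.2.1) (hint x hx')
  · exact hts hx' hy' hxy

end

end ConvexHyperbolic

/-! ### Loops based at a boundary point -/

namespace ConvexHyperbolic

open UpperHalfPlane ComplexConjugate

section

variable {X : Type*} [MetricSpace X]

/-! ### Loops at a boundary point -/

/-- Two lines that are reversed copies of each other share the centre of the reversal at equal
parameters; lifts that agree nowhere cannot do this. -/
theorem eq_reverse_line {γ δ : ℝ → ℍ} (hγ : Isometry γ) (hδ : Isometry δ) {x y k : ℝ}
    (hxy : x ≠ y) (hx : δ x = γ (k - x)) (hy : δ y = γ (k - y)) : δ (k / 2) = γ (k / 2) := by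
  refine eq_of_isometry_line hγ (s := k - x) (t := k - y) (fun h => hxy (by linarith)) ?_ ?_
  · rw [← hx, hδ.dist_eq, Real.dist_eq, abs_sub_comm, ← abs_neg]
    congr 1
    ring
  · rw [← hy, hδ.dist_eq, Real.dist_eq, abs_sub_comm, ← abs_neg]
    congr 1
    ring

theorem exists_real_mul_of_re_conj_mul_eq_zero {n e w : ℂ} (hn : n ≠ 0) (he : e ≠ 0)
    (hne : (conj n * e).re = 0) (hnw : (conj n * w).re = 0) : ∃ r : ℝ, w = r * e := by
  have hn' : conj n ≠ 0 := (map_ne_zero _).2 hn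
  obtain ⟨x, hx⟩ : ∃ x : ℝ, conj n * e = x * Complex.I :=
    ⟨(conj n * e).im, by apply Complex.ext <;> simp [hne]⟩
  obtain ⟨y, hy⟩ : ∃ y : ℝ, conj n * w = y * Complex.I :=
    ⟨(conj n * w).im, by apply Complex.ext <;> simp [hnw]⟩
  have hx0 : (x : ℂ) ≠ 0 := by
    intro h
    rw [h, zero_mul] at hx
    exact mul_ne_zero hn' he hx
  refine ⟨y / x, mul_left_cancel₀ hn' ?_⟩
  rw [mul_left_comm, hx, hy]
  push_cast
  field_simp

theorem isSimpleLoop_of_loopsHomotopicRel [CompactSpace X] (hX : IsConvexHyperbolicSurface X)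
    {p : X} (hp : p ∈ surfaceBoundary X) {s : ℝ → X} {a b : ℝ} {t : ℝ → X} {c d : ℝ}
    (hs : IsGeodesicPath s a b) (hsa : s a = p) (hsb : s b = p) (hcd : c < d)
    (hst : LoopsHomotopicRel p s a b t c d) (ht : IsSimpleLoop t c d p) :
    IsSimpleLoop s a b p := by
  refine ⟨hsa, hsb, ?_⟩
  intro u hu v hv hsuv
  by_contra huv
  wlog hlt : u < v generalizing u v
  · exact this hv hu hsuv.symm (Ne.symm huv) (lt_of_le_of_ne (not_lt.1 hlt) (Ne.symm huv))
  obtain ⟨H, hH, hHs, hHt, hHp⟩ := hst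
  have hab := hs.1
  have hab0 : 0 < b - a := sub_pos.2 hab
  have hau := hu.1
  have hub := hu.2
  have hvb := hv.2
  obtain ⟨D, F, G, γ, δ, hF, hG, hFK, hGK, hFπ, hGπ, hFG, hγ, hδ, hγF, hδG, hγδ⟩ :=
    exists_lifts_of_double_point hX hs hH hHs (Ico_subset_Icc_self hu) (Ico_subset_Icc_self hv)
      huv hsuv
  have ha : a ∈ Icc a b := left_mem_Icc.2 hab.le
  have hb : b ∈ Icc a b := right_mem_Icc.2 hab.le
  have hne : ∀ τ ∈ Icc a b, γ τ ≠ δ τ := fun τ hτ => by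
    rw [← hγF τ hτ, ← hδG τ hτ]
    exact hFG _
  -- The homotopy is constant over `p` at the ends, so the ends of a lift do not move.
  have hends : ∀ F : ℝ × ℝ → ℍ, Continuous F → (∀ z, F z ∈ D.K) →
      (∀ z, D.π (F z) = squareExtend H z) → F (0, 1) = F (0, 0) ∧ F (1, 1) = F (1, 0) := by
    intro F hF hFK hFπ
    have key : ∀ x, (∀ r, squareExtend H (x, r) = p) → F (x, 1) = F (x, 0) := fun x hx =>
      congrFun (D.eq_of_lift (F := fun r : ℝ => F (x, r)) (G := fun _ : ℝ => F (x, 0))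
        (by fun_prop) (by fun_prop) (fun _ => hFK _) (fun _ => hFK _)
        (fun r => by rw [hFπ, hFπ, hx, hx]) (z₀ := 0) rfl) 1
    constructor
    · exact key 0 fun r => by
        rw [squareExtend, projIcc_left]
        exact (hHp _).1
    · exact key 1 fun r => by
        rw [squareExtend, projIcc_right]
        exact (hHp _).2
  have F0 : F (0, 1) = γ a := by
    rw [(hends F hF hFK hFπ).1, ← hγF a ha, sub_self, zero_div]
  have F1 : F (1, 1) = γ b := by
    rw [(hends F hF hFK hFπ).2, ← hγF b hb, div_self hab0.ne']
  have G0 : G (0, 1) = δ a := by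
    rw [(hends G hG hGK hGπ).1, ← hδG a ha, sub_self, zero_div]
  have G1 : G (1, 1) = δ b := by
    rw [(hends G hG hGK hGπ).2, ← hδG b hb, div_self hab0.ne']
  have hπ : ∀ τ ∈ Icc a b, D.π (γ τ) = s τ ∧ D.π (δ τ) = s τ := by
    intro τ hτ
    have hmem : (τ - a) / (b - a) ∈ Icc (0 : ℝ) 1 :=
      ⟨div_nonneg (by linarith [hτ.1]) hab0.le, (div_le_one hab0).2 (by linarith [hτ.2])⟩
    have : squareExtend H ((τ - a) / (b - a), 0) = s τ := by
      rw [squareExtend, projIcc_of_mem _ hmem, projIcc_left]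
      refine (hHs _).trans (congrArg s ?_)
      dsimp only
      rw [div_mul_cancel₀ _ hab0.ne']
      ring
    rw [← hγF τ hτ, ← hδG τ hτ, hFπ, hGπ]
    exact ⟨this, this⟩
  have hγK : ∀ τ ∈ Icc a b, γ τ ∈ D.K := fun τ hτ => hγF τ hτ ▸ hFK _
  have hδK : ∀ τ ∈ Icc a b, δ τ ∈ D.K := fun τ hτ => hδG τ hτ ▸ hGK _
  have hreverse : ∀ {x y k : ℝ}, x ≠ y → k / 2 ∈ Icc a b → δ x = γ (k - x) → δ y = γ (k - y) →
      False := fun hxy hk hx hy => hne _ hk (eq_reverse_line hγ hδ hxy hx hy).symm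
  have hmid : (a + b) / 2 ∈ Icc a b := ⟨by linarith, by linarith⟩
  have dγδ : ∀ {x y x' y' : ℝ}, γ x = δ y → γ x' = δ y' → |x - x'| = |y - y'| := by
    intro x y x' y' h h'
    rw [← Real.dist_eq, ← Real.dist_eq, ← hγ.dist_eq, ← hδ.dist_eq, h, h']
  -- Together with `γ u = δ v` equality would make `δ` the reversal of `γ` about the midpoint of
  -- `[a, b]`.
  have hne₁ : γ a ≠ δ b := by
    intro h
    have h1 := dγδ h hγδ
    rw [abs_sub_comm, abs_of_nonneg (by linarith), abs_of_nonneg (by linarith)] at h1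
    refine hreverse (x := b) (y := v) (k := a + b) (by linarith) hmid ?_ ?_
    · rw [← h]
      congr 1
      ring
    · rw [← hγδ]
      congr 1
      linarith
  have hne₂ : γ b ≠ δ a := by
    intro h
    have h1 := dγδ h hγδ
    rw [abs_of_nonneg (by linarith), abs_sub_comm, abs_of_nonneg (by linarith)] at h1
    refine hreverse (x := a) (y := v) (k := a + b) (by linarith) hmid ?_ ?_
    · rw [← h]
      congr 1
      ring
    · rw [← hγδ]
      congr 1
      linarith
  set P : ℝ → ℝ := fun x => projIcc (0 : ℝ) 1 zero_le_one x with hP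
  have hPc : Continuous P := continuous_subtype_val.comp continuous_projIcc
  have P0 : P 0 = 0 := by simp [hP]
  have P1 : P 1 = 1 := by simp [hP]
  have hk := continuous_klein
  -- A meeting of the lifts of `t` happens at equal parameters or at opposite ends of the loop; the
  -- latter is excluded by `hne₁` and `hne₂`.
  have hdisj : ¬ ∃ x y, klein (F (P x, 1)) = klein (G (P y, 1)) := by
    rintro ⟨x, y, hxy⟩
    have hFGxy := klein_injective hxy
    have hend : ∀ x, squareExtend H (P x, 1) = t (c + P x * (d - c)) := fun x => by
      rw [squareExtend, projIcc_right, hP]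
      dsimp only
      rw [projIcc_val]
      exact hHt _
    have hteq : t (c + P x * (d - c)) = t (c + P y * (d - c)) := by
      rw [← hend, ← hend, ← hFπ, ← hGπ, hFGxy]
    have hle : ∀ x, 0 ≤ P x ∧ P x ≤ 1 := fun x =>
      ⟨(projIcc (0 : ℝ) 1 zero_le_one x).2.1, (projIcc (0 : ℝ) 1 zero_le_one x).2.2⟩
    have hmem : ∀ x, P x ≠ 1 → c + P x * (d - c) ∈ Ico c d := fun x hx => by
      have h0 := (hle x).1
      have h1 := lt_of_le_of_ne (hle x).2 hx
      constructor <;> nlinarith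
    have hcmem : c ∈ Ico c d := ⟨le_rfl, hcd⟩
    have hdc : (d - c) ≠ 0 := (sub_pos.2 hcd).ne'
    have hone : ∀ x, P x = 1 → t (c + P x * (d - c)) = t c := fun x hx => by
      rw [hx, ht.1, ← ht.2.1]
      congr 1
      ring
    have hzero : ∀ x, P x ≠ 1 → t (c + P x * (d - c)) = t c → P x = 0 := fun x hx h => by
      have := ht.2.2 (hmem x hx) hcmem h
      have : P x * (d - c) = 0 := by linarith
      exact (mul_eq_zero.1 this).resolve_right hdc
    by_cases hx : P x = 1 <;> by_cases hy : P y = 1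
    · rw [hx, hy] at hFGxy
      exact hFG _ hFGxy
    · have hy0 := hzero y hy (hteq.symm.trans (hone x hx))
      rw [hx, hy0, F1, G0] at hFGxy
      exact hne₂ hFGxy
    · have hx0 := hzero x hx (hteq.trans (hone y hy))
      rw [hy, hx0, F0, G1] at hFGxy
      exact hne₁ hFGxy
    · have hPxy : P x = P y :=
        mul_right_cancel₀ hdc (add_left_cancel (ht.2.2 (hmem x hx) (hmem y hy) hteq))
      rw [hPxy] at hFGxy
      exact hFG _ hFGxy
  have hconv := convex_klein_image D.convex
  have bγa := D.klein_notMem_interior (hγK a ha) (by rw [(hπ a ha).1, hsa]; exact hp)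
  have bγb := D.klein_notMem_interior (hγK b hb) (by rw [(hπ b hb).1, hsb]; exact hp)
  have bδa := D.klein_notMem_interior (hδK a ha) (by rw [(hπ a ha).2, hsa]; exact hp)
  have bδb := D.klein_notMem_interior (hδK b hb) (by rw [(hπ b hb).2, hsb]; exact hp)
  have kmem : ∀ {q}, q ∈ D.K → klein q ∈ klein '' D.K := fun h => mem_image_of_mem _ h
  have hvI : v ∈ Ioo a b := ⟨by linarith, hvb⟩
  -- One point of `s` off `∂X` puts the open chords of both lifts inside `K`, and they cross.
  -- Otherwise `s` runs in `∂X`.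
  by_cases hcase : ∃ τ ∈ Icc a b, s τ ∉ surfaceBoundary X
  · obtain ⟨τ, hτ, hτb⟩ := hcase
    have hsub : ∀ ε : ℝ → ℍ, Isometry ε → (∀ τ ∈ Icc a b, ε τ ∈ D.K) →
        (∀ τ ∈ Icc a b, D.π (ε τ) = s τ) →
        openSegment ℝ (klein (ε a)) (klein (ε b)) ⊆ interior (klein '' D.K) := by
      intro ε hε hεK hεπ z hz
      by_contra hzi
      have h1 := notMem_interior_of_mem_segment hconv (kmem (hεK a ha)) (kmem (hεK b hb)) hz hzi
        (klein_line_mem_segment hε hτ.1 hτ.2)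
      rw [klein_mem_interior_iff, ← D.mem_surfaceBoundary_iff (hεK τ hτ), hεπ τ hτ] at h1
      exact hτb h1
    obtain ⟨l, hl, m, hm, hlm, hD⟩ := crossing_of_meet bγa bγb bδa bδb
      (hsub γ hγ hγK fun τ hτ => (hπ τ hτ).1) (hsub δ hδ hδK fun τ hτ => (hπ τ hτ).2)
      (fun h => hne a ha (klein_injective h)) (fun h => hne₁ (klein_injective h))
      (fun h => hne₂ (klein_injective h)) (fun h => hne b hb (klein_injective h))
      (klein_line_mem_segment hγ hau hub.le)
      (hγδ ▸ klein_line_mem_segment hδ hvI.1.le hvI.2.le)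
    exact hdisj (paths_meet_of_crossing hconv D.klein_interior_nonempty
      (f := fun x => klein (F (P x, 1))) (g := fun x => klein (G (P x, 1))) (by fun_prop)
      (by fun_prop) (fun _ => kmem (hFK _)) (fun _ => kmem (hGK _))
      (by simpa only [P0, F0] using bγa) (by simpa only [P1, F1] using bγb)
      (by simpa only [P0, G0] using bδa) (by simpa only [P1, G1] using bδb) hl hm
      (by simpa only [P0, P1, F0, F1, G0, G1] using hlm)
      (by simpa only [P0, P1, F0, F1, G0, G1] using hD))
  · push Not at hcase
    have hmidb := D.klein_notMem_interior (hγK _ hmid) (by rw [(hπ _ hmid).1]; exact hcase _ hmid)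
    obtain ⟨n, hn, hsupp⟩ := exists_support hconv D.klein_interior_nonempty hmidb
    -- The support functional is nonnegative at both ends and affine along the chord, so vanishing
    -- inside forces vanishing at the ends.
    have flat : ∀ ε : ℝ → ℍ, Isometry ε → (∀ τ ∈ Icc a b, ε τ ∈ D.K) → ∀ τ ∈ Ioo a b,
        (conj n * (klein (γ ((a + b) / 2)) - klein (ε τ))).re = 0 →
        (conj n * (klein (γ ((a + b) / 2)) - klein (ε a))).re = 0 ∧
        (conj n * (klein (γ ((a + b) / 2)) - klein (ε b))).re = 0 := by
      intro ε hε hεK τ hτ h0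
      obtain ⟨l, hl, hlz⟩ := mem_openSegment_iff_real.1 (klein_line_mem_openSegment hε hτ.1 hτ.2)
      have h1 := hsupp _ (kmem (hεK a ha))
      have h2 := hsupp _ (kmem (hεK b hb))
      have h3 : conj n * (klein (γ ((a + b) / 2)) - klein (ε τ)) =
          ((1 - l : ℝ) : ℂ) * (conj n * (klein (γ ((a + b) / 2)) - klein (ε a))) +
            (l : ℂ) * (conj n * (klein (γ ((a + b) / 2)) - klein (ε b))) := by
        rw [hlz]
        push_cast
        ring
      rw [h3, Complex.add_re, Complex.re_ofReal_mul, Complex.re_ofReal_mul] at h0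
      have hl1 : 0 < 1 - l := by linarith [hl.2]
      have := mul_nonneg hl1.le h1
      have := mul_nonneg hl.1.le h2
      constructor
      · exact (mul_eq_zero.1 (by linarith : (1 - l) * _ = 0)).resolve_left hl1.ne'
      · exact (mul_eq_zero.1 (by linarith : l * _ = 0)).resolve_left hl.1.ne'
    obtain ⟨fa, fb⟩ := flat γ hγ hγK ((a + b) / 2) ⟨by linarith, by linarith⟩ (by simp)
    set z₀ := klein (γ ((a + b) / 2)) with hz₀
    have hab_ne : klein (γ b) - klein (γ a) ≠ 0 := by
      rw [sub_ne_zero]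
      exact fun h => hab.ne' (hγ.injective (klein_injective h))
    have hdir : (conj n * (klein (γ b) - klein (γ a))).re = 0 := by
      have : conj n * (klein (γ b) - klein (γ a)) =
          conj n * (z₀ - klein (γ a)) - conj n * (z₀ - klein (γ b)) := by ring
      rw [this, Complex.sub_re, fa, fb, sub_zero]
    have fu : (conj n * (z₀ - klein (δ v))).re = 0 := by
      rw [← hγδ]
      obtain ⟨l, -, hlz⟩ := mem_segment_iff_real.1 (klein_line_mem_segment hγ hau hub.le)
      have : conj n * (z₀ - klein (γ u)) = conj n * (z₀ - klein (γ a)) -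
          (l : ℂ) * (conj n * (klein (γ b) - klein (γ a))) := by
        rw [hlz]
        ring
      rw [this, Complex.sub_re, Complex.re_ofReal_mul, fa, hdir]
      simp
    obtain ⟨ga, gb⟩ := flat δ hδ hδK v hvI fu
    have online : ∀ q : ℍ, (conj n * (z₀ - klein q)).re = 0 → ∃ r, q = γ r := by
      intro q hq
      obtain ⟨r, hr⟩ := exists_real_mul_of_re_conj_mul_eq_zero hn hab_ne hdir
        (w := klein q - klein (γ a)) (by
          have : conj n * (klein q - klein (γ a)) =
            conj n * (z₀ - klein (γ a)) - conj n * (z₀ - klein q) := by ring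
          rw [this, Complex.sub_re, fa, hq, sub_zero])
      exact exists_eq_line_of_collinear hγ hab (r := r) (by rw [← hr]; ring)
    obtain ⟨x, hx⟩ := online _ ga
    obtain ⟨y, hy⟩ := online _ gb
    have d1 := dγδ hx.symm hγδ
    have d2 := dγδ hy.symm hγδ
    have d3 := dγδ hx.symm hy.symm
    rw [abs_sub_comm a v, abs_of_pos (sub_pos.2 hvI.1)] at d1
    rw [abs_of_pos (sub_pos.2 hvb)] at d2
    rw [abs_sub_comm a b, abs_of_pos hab0] at d3
    -- The signs give the position of `δ` on the line of `γ`: a reversal is excluded by `hreverse`,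
    -- a translation makes the ends interlace, and the mixed signs contradict the length of `s`.
    rcases abs_eq (sub_pos.2 hvI.1).le |>.1 d1 with e1 | e1 <;>
      rcases abs_eq (sub_pos.2 hvb).le |>.1 d2 with e2 | e2
    · have : x - y = (v - a) - (b - v) := by linarith
      rw [this] at d3
      rcases abs_eq hab0.le |>.1 d3 with h | h <;> linarith [hvI.1]
    · refine hreverse (x := a) (y := b) (k := u + v) hab.ne ⟨by linarith, by linarith⟩ ?_ ?_
      · rw [hx]
        congr 1
        linarith
      · rw [hy]
        congr 1
        linarith
    · have hxk : x = a - (v - u) := by linarith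
      have hyk : y = b - (v - u) := by linarith
      -- The order on the line is `δ a`, `γ a`, `δ b`, `γ b`; measured from `δ a` in units of the
      -- whole span, the last three sit at `θ * β`, `β` and `1`.
      obtain ⟨β, hβ, hβz⟩ := mem_openSegment_iff_real.1
        (klein_line_mem_openSegment hγ (r := x) (s := y) (t := b) (by linarith) (by linarith))
      obtain ⟨θ, hθ, hθz⟩ := mem_openSegment_iff_real.1
        (klein_line_mem_openSegment hγ (r := x) (s := a) (t := y) (by linarith) (by linarith))
      have hnK : ∀ q ∈ D.K, 0 ≤ (conj n * (klein (δ a) - klein q)).re := by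
        intro q hq
        have : conj n * (klein (δ a) - klein q) =
            conj n * (z₀ - klein q) - conj n * (z₀ - klein (δ a)) := by ring
        rw [this, Complex.sub_re, ga, sub_zero]
        exact hsupp _ (kmem hq)
      refine hdisj (paths_meet_of_interlacing (n := n) (e := klein (γ b) - klein (γ x))
        (a := klein (δ a)) hn ?_ ?_ (f := fun x => klein (F (P x, 1)))
        (g := fun x => klein (G (P x, 1))) (by fun_prop) (by fun_prop) (fun _ => hnK _ (hFK _))
        (fun _ => hnK _ (hGK _)) (α := θ * β) (β := β) (mul_pos hθ.1 hβ.1) ?_ hβ.2 ?_ ?_ ?_ ?_)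
      · rw [sub_ne_zero]
        exact fun h => (by linarith : x ≠ b) (hγ.injective (klein_injective h)).symm
      · have : conj n * (klein (γ b) - klein (γ x)) =
            conj n * (z₀ - klein (δ a)) - conj n * (z₀ - klein (γ b)) := by rw [hx]; ring
        rw [this, Complex.sub_re, ga, fb, sub_zero]
      · nlinarith [hθ.2, hβ.1]
      · simp only [P0, G0]
      · simp only [P0, F0]
        rw [hθz, hβz, hx]
        push_cast
        ring
      · simp only [P1, G1]
        rw [hy, hβz, hx]
      · simp only [P1, F1]
        rw [hx]
        ring
    · have : x - y = (b - v) - (v - a) := by linarith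
      rw [this] at d3
      rcases abs_eq hab0.le |>.1 d3 with h | h <;> linarith [hvI.1]

end

end ConvexHyperbolic

/-! ### Topological invariance of the boundary and the annulus -/

namespace ConvexHyperbolic

open UpperHalfPlane Topology Filter

/-- Invariance of the boundary: no neighbourhood of a boundary point of a planar convex set is
homeomorphic to a disc centred at that point. -/
theorem mem_interior_of_local_homeomorph {C : Set ℂ} (hC : Convex ℝ C)
    (hCi : (interior C).Nonempty) {x y : ℂ} {r ε : ℝ} (hr : 0 < r) {f g : ℂ → ℂ}
    (hε : 0 < ε) (hx : x ∈ C) (hg : ContinuousOn g (Metric.ball y r))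
    (hgC : MapsTo g (Metric.ball y r) (C ∩ Metric.ball x ε))
    (hf : ContinuousOn f (C ∩ Metric.ball x ε))
    (hfg : ∀ w ∈ Metric.ball y r, f (g w) = w)
    (hfx : ∀ z ∈ C ∩ Metric.ball x ε, f z = y → z = x) (hgy : g y = x) : x ∈ interior C := by
  by_contra hxi
  have hcl : x ∈ closure (interior C) := by
    rw [hC.closure_interior_eq_closure_of_nonempty_interior hCi]
    exact subset_closure hx
  obtain ⟨c, hcx, hc⟩ := mem_closure_iff.1 hcl _ Metric.isOpen_ball (Metric.mem_ball_self hε)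
  have hcC := interior_subset hc
  have hfy : f x = y := by rw [← hgy, hfg y (Metric.mem_ball_self hr)]
  set l : ℝ → ℂ := fun τ => y + (r / 2 : ℝ) * Complex.exp (τ * (2 * Real.pi * Complex.I)) with hl
  have hlc : Continuous l := by fun_prop
  have hexp : ∀ τ : ℝ, ‖Complex.exp (τ * (2 * Real.pi * Complex.I))‖ = 1 := fun τ => by
    rw [← mul_assoc]
    exact_mod_cast Complex.norm_exp_ofReal_mul_I (τ * (2 * Real.pi))
  have hlb : ∀ τ, l τ ∈ Metric.ball y r := fun τ => by
    rw [mem_ball_iff_norm, hl]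
    simp only [add_sub_cancel_left, norm_mul, hexp, mul_one, Complex.norm_real, Real.norm_eq_abs]
    rw [abs_of_pos (by linarith)]
    linarith
  have hl1 : l 1 = l 0 := by simp [hl]
  set k : ℝ → ℝ := fun u => projIcc (0 : ℝ) 1 zero_le_one u with hk
  have hkc : Continuous k := continuous_subtype_val.comp continuous_projIcc
  have hkI : ∀ u, k u ∈ Icc (0 : ℝ) 1 := fun u => (projIcc (0 : ℝ) 1 zero_le_one u).2
  -- The image of a circle about `y` is contracted linearly to an interior point `c`. It avoids `x`,
  -- since at positive times it is interior and at time `0` `f` takes it to the circle.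
  set m : ℝ × ℝ → ℂ := fun z => (1 - k z.2) • g (l z.1) + k z.2 • c with hm
  have hmC : ∀ z, m z ∈ C ∩ Metric.ball x ε := fun z =>
    (hC.inter (convex_ball x ε)) (hgC (hlb _)) ⟨hcC, hcx⟩ (by linarith [(hkI z.2).2]) (hkI z.2).1
      (by ring)
  have hmx : ∀ z, m z ≠ x := by
    intro z hz
    rcases (hkI z.2).1.eq_or_lt with h0 | h0
    · have : g (l z.1) = x := by
        rw [← hz, hm]
        simp only [← h0]
        simp
      have h2 := hfg _ (hlb z.1)
      rw [this, hfy] at h2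
      have h3 : ((r / 2 : ℝ) : ℂ) * Complex.exp (z.1 * (2 * Real.pi * Complex.I)) = 0 := by
        have : y = y + (r / 2 : ℝ) * Complex.exp (z.1 * (2 * Real.pi * Complex.I)) := h2
        linear_combination -this
      rcases mul_eq_zero.1 h3 with h | h
      · rw [Complex.ofReal_eq_zero] at h
        linarith
      · exact Complex.exp_ne_zero _ h
    · apply hxi
      rw [← hz]
      exact hC.combo_self_interior_mem_interior (hgC (hlb _)).1 hc (by linarith [(hkI z.2).2]) h0
        (by ring)
  have hmc : Continuous m := by
    have : Continuous fun τ => g (l τ) := hg.comp_continuous hlc hlb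
    exact ((continuous_const.sub (hkc.comp continuous_snd)).smul (this.comp continuous_fst)).add
      ((hkc.comp continuous_snd).smul continuous_const)
  obtain ⟨L, hLc, hL⟩ := exists_continuous_log (F := fun z => f (m z) - y)
    ((hf.comp_continuous hmc hmC).sub continuous_const)
    (fun z h => hmx z (hfx _ (hmC z) (sub_eq_zero.1 h)))
  -- Around the square the logarithm gains `2πi` on the circle side, nothing on the constant side,
  -- and equal amounts on the two identified sides: a contradiction.
  have e1 := sub_eq_sub_of_exp_eq (L := fun u : ℝ => L (1, u)) (M := fun u : ℝ => L (0, u))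
    (by fun_prop) (by fun_prop) (fun u => by simp only [hL, hm, hl1]) 0 1
  have e2 := sub_eq_sub_of_exp_eq (L := fun τ : ℝ => L (τ, 1)) (M := fun _ => L (0, 1))
    (by fun_prop) (by fun_prop) (fun u => by
      have : k 1 = 1 := by simp [hk]
      simp [hL, hm, this]) 0 1
  have e3 := sub_eq_sub_of_exp_eq (L := fun τ : ℝ => L (τ, 0))
    (M := fun τ => Complex.log (r / 2 : ℝ) + τ * (2 * Real.pi * Complex.I))
    (by fun_prop) (by fun_prop) (fun τ => by
      have h0 : k 0 = 0 := by simp [hk]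
      have h1 : m (τ, 0) = g (l τ) := by simp [hm, h0]
      have hr2 : ((r / 2 : ℝ) : ℂ) ≠ 0 := Complex.ofReal_ne_zero.2 (by linarith)
      rw [hL, h1, hfg _ (hlb τ), Complex.exp_add, Complex.exp_log hr2, hl]
      simp) 0 1
  simp only [Complex.ofReal_zero, Complex.ofReal_one, zero_mul, one_mul] at e1 e2 e3
  exact Complex.two_pi_I_ne_zero (by linear_combination e3 + e1 - e2)

section

variable {Y : Type*} [TopologicalSpace Y]

/-- `φ` is a local homeomorphism at `y` onto a neighbourhood of `φ y` in `C`, with local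
inverse `ψ`. -/
structure IsPlanarChart (C : Set ℂ) (y : Y) (φ : Y → ℂ) (ψ : ℂ → Y) : Prop where
  eventually : ∀ᶠ z in 𝓝 y, ContinuousAt φ z ∧ φ z ∈ C ∧ ψ (φ z) = z
  exists_ball : ∃ ε > 0, ContinuousOn ψ (C ∩ Metric.ball (φ y) ε) ∧
    ∀ w ∈ C ∩ Metric.ball (φ y) ε, φ (ψ w) = w

/-- Comparing the two charts gives a local homeomorphism from a disc about `φ y` into `C'`, so `φ'
y` cannot be a boundary point. -/
theorem IsPlanarChart.mem_interior {C C' : Set ℂ} {y : Y} {φ φ' : Y → ℂ} {ψ ψ' : ℂ → Y}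
    (h : IsPlanarChart C y φ ψ) (h' : IsPlanarChart C' y φ' ψ') (hC' : Convex ℝ C')
    (hCi' : (interior C').Nonempty) (hy : φ y ∈ interior C) : φ' y ∈ interior C' := by
  obtain ⟨ε, hε, hψ, hφψ⟩ := h.exists_ball
  obtain ⟨ε', hε', hψ', hφψ'⟩ := h'.exists_ball
  obtain ⟨-, hyC, hψy⟩ := h.eventually.self_of_nhds
  obtain ⟨-, hyC', hψy'⟩ := h'.eventually.self_of_nhds
  have hyb : φ' y ∈ C' ∩ Metric.ball (φ' y) ε' := ⟨hyC', Metric.mem_ball_self hε'⟩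
  have ev1 : ∀ᶠ w in 𝓝[C' ∩ Metric.ball (φ' y) ε'] (φ' y),
      ContinuousAt φ (ψ' w) ∧ ψ (φ (ψ' w)) = ψ' w := by
    have := (hψ' _ hyb).tendsto
    rw [hψy'] at this
    exact (this.eventually h.eventually).mono fun z hz => ⟨hz.1, hz.2.2⟩
  obtain ⟨η, hη, hηb⟩ := Metric.mem_nhdsWithin_iff.1 ev1
  set ε₁ := min η ε' with hε₁
  have hε₁0 : 0 < ε₁ := lt_min hη hε'
  have hsub : ∀ w ∈ C' ∩ Metric.ball (φ' y) ε₁, w ∈ C' ∩ Metric.ball (φ' y) ε' ∧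
      ContinuousAt φ (ψ' w) ∧ ψ (φ (ψ' w)) = ψ' w := fun w hw => by
    have hw' : w ∈ C' ∩ Metric.ball (φ' y) ε' :=
      ⟨hw.1, Metric.ball_subset_ball (min_le_right _ _) hw.2⟩
    exact ⟨hw', hηb ⟨Metric.ball_subset_ball (min_le_left _ _) hw.2, hw'⟩⟩
  have hnhds : C ∩ Metric.ball (φ y) ε ∈ 𝓝 (φ y) :=
    inter_mem (mem_interior_iff_mem_nhds.1 hy) (Metric.ball_mem_nhds _ hε)
  have hψc : Tendsto ψ (𝓝 (φ y)) (𝓝 y) := by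
    have := hψ.continuousAt hnhds
    rwa [ContinuousAt, hψy] at this
  have hφ'c : ContinuousAt φ' y := h'.eventually.self_of_nhds.1
  have ev2 : ∀ᶠ w in 𝓝 (φ y), w ∈ C ∩ Metric.ball (φ y) ε ∧ (ContinuousAt φ' (ψ w) ∧
      φ' (ψ w) ∈ C' ∧ ψ' (φ' (ψ w)) = ψ w) ∧ φ' (ψ w) ∈ Metric.ball (φ' y) ε₁ :=
    (eventually_mem_set.2 hnhds).and ((hψc.eventually h'.eventually).and
      ((hφ'c.tendsto.comp hψc).eventually (Metric.ball_mem_nhds _ hε₁0)))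
  obtain ⟨r, hr, hrb⟩ := Metric.eventually_nhds_iff_ball.1 ev2
  refine mem_interior_of_local_homeomorph hC' hCi' (y := φ y) hr (f := φ ∘ ψ') (g := φ' ∘ ψ)
    hε₁0 hyC' ?_ (fun w hw => ⟨(hrb w hw).2.1.2.1, (hrb w hw).2.2⟩) ?_ ?_ ?_ ?_
  · intro w hw
    exact ((hrb w hw).2.1.1.comp_continuousWithinAt (hψ _ (hrb w hw).1)).mono
      fun v hv => (hrb v hv).1
  · intro w hw
    exact ((hsub w hw).2.1.comp_continuousWithinAt (hψ' _ (hsub w hw).1)).mono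
      fun v hv => (hsub v hv).1
  · intro w hw
    simp only [Function.comp_apply]
    rw [(hrb w hw).2.1.2.2, hφψ w (hrb w hw).1]
  · intro z hz hzy
    have h1 := (hsub z hz).2.2
    simp only [Function.comp_apply] at hzy
    rw [hzy, hψy] at h1
    rw [h1, hφψ' z (hsub z hz).1]
  · simp [hψy]

theorem IsPlanarChart.comp_homeomorph {Z : Type*} [TopologicalSpace Z] {C : Set ℂ} {z : Z}
    {φ : Y → ℂ} {ψ : ℂ → Y} (h : Z ≃ₜ Y) (hφ : IsPlanarChart C (h z) φ ψ) :
    IsPlanarChart C z (φ ∘ h) (h.symm ∘ ψ) := by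
  refine ⟨?_, ?_⟩
  · refine (h.continuous.continuousAt.eventually hφ.eventually).mono fun w hw =>
      ⟨hw.1.comp h.continuous.continuousAt, hw.2.1, ?_⟩
    simp [hw.2.2]
  · obtain ⟨ε, hε, h1, h2⟩ := hφ.exists_ball
    exact ⟨ε, hε, h.symm.continuous.comp_continuousOn h1, fun w hw => by simpa using h2 w hw⟩

end

theorem exists_isPlanarChart_annulus (y : Circle × unitInterval) :
    ∃ φ ψ, IsPlanarChart (Complex.im ⁻¹' Icc 0 1) y φ ψ ∧ (φ y).im = y.2 := by
  obtain ⟨e, he, hexp⟩ := isLocalHomeomorph_circleExp (Complex.arg y.1)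
  have hey : Circle.exp (Complex.arg y.1) = y.1 := Circle.exp_arg y.1
  have hys : y.1 ∈ e.target := by
    rw [← hey, hexp]
    exact e.map_source he
  refine ⟨fun z => e.symm z.1 + (z.2 : ℝ) * Complex.I,
    fun w => (Circle.exp w.re, projIcc 0 1 zero_le_one w.im), ⟨?_, ?_⟩, by simp⟩
  · filter_upwards [(e.open_target.preimage continuous_fst).mem_nhds hys] with z hz
    have h1 : ContinuousAt (fun z : Circle × unitInterval => e.symm z.1) z :=
      (e.continuousAt_symm hz).comp continuousAt_fst
    refine ⟨by fun_prop, by simp, ?_⟩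
    refine Prod.ext ?_ ?_
    · simp [hexp, e.right_inv hz]
    · simp
  · have hsrc : e.symm y.1 ∈ e.source := e.map_target hys
    obtain ⟨ε, hε, hb⟩ := Metric.isOpen_iff.1 (e.open_source.preimage Complex.continuous_re)
      (e.symm y.1 + (y.2 : ℝ) * Complex.I) (by simpa using hsrc)
    refine ⟨ε, hε, Continuous.continuousOn ?_, ?_⟩
    · exact (Circle.exp.continuous.comp Complex.continuous_re).prodMk
        (continuous_projIcc.comp Complex.continuous_im)
    · rintro w ⟨hw, hwb⟩
      have := hb hwb
      simp only [mem_preimage] at this hw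
      apply Complex.ext
      · simp [hexp, e.left_inv this]
      · simp [projIcc_of_mem zero_le_one hw]

variable {X : Type*} [MetricSpace X]

theorem DevelopedCover.exists_isPlanarChart (D : DevelopedCover X) {p : ℍ} (hp : p ∈ D.K) :
    ∃ φ ψ, IsPlanarChart (klein '' D.K) (D.π p) φ ψ ∧ φ (D.π p) = klein p := by
  obtain ⟨χ, hχl, hχ⟩ := D.exists_chart hp
  have hχp : χ (D.π p) = p := hχl ⟨hp, Metric.mem_ball_self D.ρ_pos⟩
  have hkinv : Function.LeftInverse (Function.invFun klein) klein :=
    Function.leftInverse_invFun klein_injective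
  refine ⟨klein ∘ χ, D.π ∘ Function.invFun klein, ⟨?_, ?_⟩, by simp [hχp]⟩
  · filter_upwards [Metric.ball_mem_nhds (D.π p) D.ρ_pos] with z hz
    have hcont : ContinuousOn χ (Metric.ball (D.π p) D.ρ) := by
      refine LipschitzOnWith.continuousOn (K := 1) (LipschitzOnWith.of_dist_le_mul ?_)
      intro u hu v hv
      simp [hχ.1 u hu v hv]
    refine ⟨continuous_klein.continuousAt.comp
      (hcont.continuousAt (Metric.isOpen_ball.mem_nhds hz)), ?_, ?_⟩
    · exact mem_image_of_mem _ (hχ.2.subset (mem_image_of_mem _ hz)).1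
    · rw [← D.image_ball p hp] at hz
      obtain ⟨q, hq, rfl⟩ := hz
      simp [hχl hq, hkinv q]
  · obtain ⟨ε, hε, hb⟩ := Metric.isOpen_iff.1
      (isOpenEmbedding_klein.isOpenMap _ (Metric.isOpen_ball (x := p) (ε := D.ρ))) (klein p)
      (mem_image_of_mem _ (Metric.mem_ball_self D.ρ_pos))
    have hmem : ∀ w ∈ klein '' D.K ∩ Metric.ball (klein p) ε,
        ∃ q ∈ D.K ∩ Metric.ball p D.ρ, klein q = w := by
      rintro _ ⟨⟨q, hq, rfl⟩, hw⟩
      obtain ⟨q', hq', he⟩ := hb hw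
      rw [klein_injective he] at hq'
      exact ⟨q, ⟨hq, hq'⟩, rfl⟩
    refine ⟨ε, hε, ?_, ?_⟩
    · rw [Function.comp_apply, hχp]
      refine D.continuousOn_π.comp (t := D.K) ?_ ?_
      · intro w hw
        obtain ⟨q, hq, rfl⟩ := hmem w hw
        refine ContinuousAt.continuousWithinAt ?_
        rw [← isOpenEmbedding_klein.continuousAt_iff]
        rw [show Function.invFun klein ∘ klein = id from funext hkinv]
        exact continuousAt_id
      · intro w hw
        obtain ⟨q, hq, rfl⟩ := hmem w hw
        rw [hkinv q]
        exact hq.1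
    · intro w hw
      rw [Function.comp_apply, hχp] at hw
      obtain ⟨q, hq, rfl⟩ := hmem w hw
      simp [hkinv q, hχl hq]

/-- The developed chart and the strip chart of the annulus are planar charts at the same point, and
interiority does not depend on the chart. -/
theorem mem_surfaceBoundary_iff_of_annulus [CompactSpace X] (hX : IsConvexHyperbolicSurface X)
    (h : X ≃ₜ Circle × unitInterval) (x : X) :
    x ∈ surfaceBoundary X ↔ ((h x).2 : ℝ) ∉ Ioo (0 : ℝ) 1 := by
  obtain ⟨D, p, hp, rfl⟩ := hX.exists_developedCover x
  obtain ⟨φ, ψ, hφ, hφp⟩ := D.exists_isPlanarChart hp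
  obtain ⟨φ', ψ', hφ', him⟩ := exists_isPlanarChart_annulus (h (D.π p))
  have hφ'' := hφ'.comp_homeomorph h
  have hint : interior (Complex.im ⁻¹' Icc (0 : ℝ) 1) = Complex.im ⁻¹' Ioo 0 1 := by
    rw [Complex.interior_preimage_im, interior_Icc]
  rw [D.mem_surfaceBoundary_iff hp, not_iff_not, ← klein_mem_interior_iff, ← hφp]
  have hmem : φ' (h (D.π p)) ∈ interior (Complex.im ⁻¹' Icc (0 : ℝ) 1) ↔
      ((h (D.π p)).2 : ℝ) ∈ Ioo (0 : ℝ) 1 := by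
    rw [hint, mem_preimage, him]
  rw [← hmem]
  refine ⟨fun hi => hφ.mem_interior hφ'' ?_ ?_ hi, fun hi => hφ''.mem_interior hφ
    (convex_klein_image D.convex) D.klein_interior_nonempty hi⟩
  · exact (convex_Icc (0 : ℝ) 1).linear_preimage Complex.imLm
  · rw [hint]
    exact ⟨(1 / 2 : ℝ) * Complex.I, by simp; norm_num⟩

theorem IsGeodesicPath.continuousOn {s : ℝ → X} {a b : ℝ} (hs : IsGeodesicPath s a b) :
    ContinuousOn s (Icc a b) := by
  intro τ hτ
  obtain ⟨δ, hδ, h⟩ := hs.2 τ hτ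
  rw [Metric.continuousWithinAt_iff]
  intro ε hε
  refine ⟨min δ ε, lt_min hδ hε, fun u hu hd => ?_⟩
  rw [Real.dist_eq] at hd
  rw [h u hu τ hτ (hd.trans_le (min_le_left _ _)) (by simpa using hδ)]
  exact hd.trans_le (min_le_right _ _)

theorem isSimple_of_annulus [CompactSpace X] (hX : IsConvexHyperbolicSurface X)
    (h : X ≃ₜ Circle × unitInterval) {s : ℝ → X} {a b : ℝ} (hs : IsGeodesicPath s a b)
    (hjoin : JoinsDifferentBoundaryComponents s a b) : IsSimple s a b := by
  have hab := hs.1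
  -- At equal heights the circle through both ends would lie in `∂X` and join them.
  have hlevel : (h (s a)).2 ≠ (h (s b)).2 := by
    intro hl
    set c : ℝ → X := fun θ => h.symm (Circle.exp θ, (h (s a)).2) with hc
    have hcc : Continuous c :=
      h.symm.continuous.comp (Circle.exp.continuous.prodMk continuous_const)
    have hcS : ∀ θ, c θ ∈ surfaceBoundary X := fun θ => by
      rw [mem_surfaceBoundary_iff_of_annulus hX h, hc, h.apply_symm_apply]
      exact (mem_surfaceBoundary_iff_of_annulus hX h _).1 hjoin.1
    have ha : c (Complex.arg (h (s a)).1) = s a := by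
      simp only [hc]
      rw [Circle.exp_arg, Prod.mk.eta, h.symm_apply_apply]
    have hb : c (Complex.arg (h (s b)).1) = s b := by
      simp only [hc]
      rw [Circle.exp_arg, hl, Prod.mk.eta, h.symm_apply_apply]
    apply hjoin.2.2
    rw [← ha, ← hb]
    exact connectedComponentIn_eq_of_path hcc hcS _ _
  have hmem : ∀ τ : unitInterval, a + τ * (b - a) ∈ Icc a b := fun τ =>
    ⟨by nlinarith [τ.2.1], by nlinarith [τ.2.2]⟩
  set σ : unitInterval → X := fun τ => s (a + τ * (b - a)) with hσ
  have hσc : Continuous σ := hs.continuousOn.comp_continuous (by fun_prop) hmem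
  have hσ0 : σ 0 = s a := by simp [hσ]
  have hσ1 : σ 1 = s b := by simp [hσ]
  obtain ⟨θ, hθ, -⟩ := Circle.isCoveringMap_exp.exists_path_lifts
    (⟨fun τ => (h (σ τ)).1, by fun_prop⟩ : C(unitInterval, Circle))
    (Complex.arg (h (σ 0)).1) (Circle.exp_arg _).symm
  have hθ' : ∀ τ, Circle.exp (θ τ) = (h (σ τ)).1 := fun τ => congrFun hθ τ
  -- Straight segment in the covering strip with the ends of the lifted path. Linear interpolation
  -- fixes the ends, and the height along `lin` is injective because its end heights differ.
  set lin : ℝ → ℝ × ℝ := fun τ => ((1 - τ) * θ 0 + τ * θ 1,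
    (1 - τ) * (h (σ 0)).2 + τ * (h (σ 1)).2) with hlin
  set P : ℝ × ℝ → X := fun w => h.symm (Circle.exp w.1, projIcc 0 1 zero_le_one w.2) with hP
  have hPc : Continuous P := h.symm.continuous.comp
    ((Circle.exp.continuous.comp continuous_fst).prodMk (continuous_projIcc.comp continuous_snd))
  have hPσ : ∀ τ, P (θ τ, (h (σ τ)).2) = σ τ := fun τ => by
    simp only [hP]
    rw [hθ', projIcc_val, Prod.mk.eta, h.symm_apply_apply]
  refine isSimple_of_pathsHomotopic hX hs hjoin (t := P ∘ lin) zero_lt_one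
    ⟨fun z => P ((1 - (z.2 : ℝ)) * θ z.1 + z.2 * (lin z.1).1,
      (1 - (z.2 : ℝ)) * (h (σ z.1)).2 + z.2 * (lin z.1).2), ?_, ?_, ?_, ?_⟩ ?_
  · refine hPc.comp ?_
    have : Continuous lin := by fun_prop
    fun_prop
  · intro τ
    simpa using hPσ τ
  · intro τ
    simp
  · intro u
    have e0 := hPσ 0
    have e1 := hPσ 1
    constructor
    · convert hjoin.1 using 1
      rw [← hσ0, ← e0]
      refine congrArg P (Prod.ext ?_ ?_) <;> simp [hlin] <;> ring
    · convert hjoin.2.1 using 1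
      rw [← hσ1, ← e1]
      refine congrArg P (Prod.ext ?_ ?_) <;> simp [hlin] <;> ring
  · intro u hu v hv huv
    have h1 := congrArg Prod.snd (h.symm.injective huv)
    have hI : ∀ w ∈ Icc (0 : ℝ) 1, (lin w).2 ∈ Icc (0 : ℝ) 1 := fun w hw =>
      (convex_Icc (0 : ℝ) 1) (h (σ 0)).2.2 (h (σ 1)).2.2 (by linarith [hw.2]) hw.1 (by ring)
    simp only [projIcc_of_mem zero_le_one (hI u hu), projIcc_of_mem zero_le_one (hI v hv),
      Subtype.mk.injEq] at h1
    have hne : ((h (σ 1)).2 : ℝ) - (h (σ 0)).2 ≠ 0 := by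
      rw [hσ0, hσ1, sub_ne_zero]
      exact fun e => hlevel (Subtype.ext e.symm)
    refine mul_right_cancel₀ hne ?_
    simp only [hlin] at h1
    linear_combination h1

end ConvexHyperbolic

theorem proposition4p1 {X : Type*} [MetricSpace X] [CompactSpace X] [ConnectedSpace X]
    (hX : ConvexHyperbolic.IsConvexHyperbolicSurface X) (hπ : ¬ SimplyConnectedSpace X) :
    -- (1) the annulus
    (Nonempty (X ≃ₜ Circle × unitInterval) →
      ∀ (s : ℝ → X) (a b : ℝ), ConvexHyperbolic.IsGeodesicPath s a b →
        ConvexHyperbolic.JoinsDifferentBoundaryComponents s a b →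
        ConvexHyperbolic.IsSimple s a b) ∧
    -- (2) paths between different boundary components: `t` a simple geodesic path
    (∀ (s : ℝ → X) (a b : ℝ) (t : ℝ → X) (c d : ℝ), ConvexHyperbolic.IsGeodesicPath s a b →
      ConvexHyperbolic.JoinsDifferentBoundaryComponents s a b →
      ConvexHyperbolic.IsGeodesicPath t c d → ConvexHyperbolic.PathsHomotopic s a b t c d →
      ConvexHyperbolic.IsSimple t c d → ConvexHyperbolic.IsSimple s a b) ∧
    -- (2) more generally, `t` an arbitrary simple arc
    (∀ (s : ℝ → X) (a b : ℝ) (t : ℝ → X) (c d : ℝ), ConvexHyperbolic.IsGeodesicPath s a b →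
      ConvexHyperbolic.JoinsDifferentBoundaryComponents s a b →
      c < d → ConvexHyperbolic.PathsHomotopic s a b t c d →
      Set.InjOn t (Set.Icc c d) → ConvexHyperbolic.IsSimple s a b) ∧
    -- (3) loops at a boundary point
    (∀ p ∈ ConvexHyperbolic.surfaceBoundary X,
      ∀ (s : ℝ → X) (a b : ℝ) (t : ℝ → X) (c d : ℝ), ConvexHyperbolic.IsGeodesicPath s a b →
      s a = p → s b = p → c < d → ConvexHyperbolic.LoopsHomotopicRel p s a b t c d →
      ConvexHyperbolic.IsSimpleLoop t c d p → ConvexHyperbolic.IsSimpleLoop s a b p) := by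
  refine ⟨?_, ?_, ?_, ?_⟩
  · rintro ⟨h⟩ s a b hs hjoin
    exact ConvexHyperbolic.isSimple_of_annulus hX h hs hjoin
  · intro s a b t c d hs hjoin ht hst hts
    exact ConvexHyperbolic.isSimple_of_pathsHomotopic_geodesic hX hs hjoin ht hst hts
  · intro s a b t c d hs hjoin hcd hst ht
    exact ConvexHyperbolic.isSimple_of_pathsHomotopic hX hs hjoin hcd hst ht
  · intro p hp s a b t c d hs hsa hsb hcd hst ht
    exact ConvexHyperbolic.isSimpleLoop_of_loopsHomotopicRel hX hp hs hsa hsb hcd hst ht
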